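/- All vector spaces and Lie algebras are real; $\mathfrak l,\mathfrak a,\mathfrak g$ below are finite-dimensional, "inner product" means non-degenerate symmetric bilinear form. **Equivariant objects.** Let $\mathfrak h$ be a Lie algebra and $K$ a Lie group with finitely many connected components that acts on $\mathfrak h$ by Lie algebra automorphisms such that $\mathfrak h$ is a semisimple $K$-module. An $(\mathfrak h,K)$-module $(V,\Phi)$ is a finite-dimensional vector space with a representation of $\mathfrak h$ and a (continuous) representation of $K$, both denoted $\Phi$, with $\Phi(k\cdot X)=\Phi(k)\Phi(X)\Phi(k)^{-1}$; it is semisimple if every submodule has a complementary submodule. An $(\mathfrak h,K)$-equivariant Lie algebra is a Lie algebra with a semisimple $(\mathfrak h,K)$-module structure such that $\mathfrak h$ acts by derivations and $K$ by automorphisms. It is an $(\mathfrak h,K)$-equivariant metric Lie algebra if it carries an $\operatorname{ad}$-invariant inner product for which $\Phi(\mathfrak h)$ is antisymmetric and $\Phi(K)$ isometric. Let $(\mathfrak l,\Phi_{\mathfrak l})$ be an $(\mathfrak h,K)$-equivariant Lie algebra, and let $(\rho,\mathfrak a,\langle\cdot,\cdot\rangle_{\mathfrak a},\Phi_{\mathfrak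 a})$ be an orthogonal $(\mathfrak l,\Phi_{\mathfrak l})$-module: $(\mathfrak a,\Phi_{\mathfrak a})$ is a semisimple $(\mathfrak h,K)$-module with an inner product for which $\Phi_{\mathfrak a}(\mathfrak h)$ is antisymmetric and $\Phi_{\mathfrak a}(K)$ isometric, and $\rho:\mathfrak l\to\mathfrak{so}(\mathfrak a)$ is a representation with $\rho(\Phi_{\mathfrak l}(k)L)=\Phi_{\mathfrak a}(k)\rho(L)\Phi_{\mathfrak a}(k)^{-1}$ and $\rho(\Phi_{\mathfrak l}(X)L)=[\Phi_{\mathfrak a}(X),\rho(L)]$. **Quadratic extensions.** A quadratic extension of $(\mathfrak l,\Phi_{\mathfrak l})$ by $\mathfrak a$ is a quadruple $(\mathfrak g,\mathfrak i,i,p)$, where $\mathfrak g$ is an $(\mathfrak h,K)$-equivariant metric Lie algebra, $\mathfrak i\subset\mathfrak g$ is an isotropic $\Phi$-invariant ideal, and $0\to\mathfrak a\xrightarrow{i}\mathfrak g/\mathfrak i\xrightarrow{p}\mathfrak l\to0$ is an exact sequence of homomorphisms of $(\mathfrak h,K)$-equivariant Lie algebras ($\mathfrak a$ abelian) with $[x,i(A)]=i(\rho(p(x))A)$,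 such that $i$ is an isometry of $\mathfrak a$ onto $\mathfrak i^\perp/\mathfrak i$. Two quadratic extensions are equivalent if there is an isomorphism $F:\mathfrak g_1\to\mathfrak g_2$ of $(\mathfrak h,K)$-equivariant metric Lie algebras with $F(\mathfrak i_1)=\mathfrak i_2$ whose induced map $\overline F:\mathfrak g_1/\mathfrak i_1\to\mathfrak g_2/\mathfrak i_2$ satisfies $\overline F\circ i_1=i_2$, $p_2\circ\overline F=p_1$. For a Lie algebra $\mathfrak g$ put $R_0(\mathfrak g)=\mathfrak g$ and let $R_{k}(\mathfrak g)$ be the smallest ideal contained in $R_{k-1}(\mathfrak g)$ such that the $\mathfrak g$-module $R_{k-1}(\mathfrak g)/R_k(\mathfrak g)$ is semisimple. A quadratic extension is balanced if $\mathfrak i=\sum_{k\ge1}R_k(\mathfrak g)\cap R_k(\mathfrak g)^\perp$. **Quadratic cohomology.** Let $C^p(\mathfrak l,\mathfrak a)=\operatorname{Hom}(\bigwedge^p\mathfrak l,\mathfrak a)$ and $C^p(\mathfrak l)=\operatorname{Hom}(\bigwedge^p\mathfrak l,\mathbb R)$ with the Chevalley–Eilenberg differential $d$. Let $C^p(\mathfrak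 l,\mathfrak a)^{(\mathfrak h,K)}$ be the space of $\alpha$ with $e^{-\Phi_{\mathfrak a}(X)}\alpha(e^{\Phi_{\mathfrak l}(X)}\cdot,\dots)=\alpha$ and $\Phi_{\mathfrak a}(k)^{-1}\alpha(\Phi_{\mathfrak l}(k)\cdot,\dots)=\alpha$ for all $X\in\mathfrak h$, $k\in K$, and define $C^p(\mathfrak l)^{(\mathfrak h,K)}$ in the same way with trivial action on $\mathbb R$. Let $\langle\cdot\wedge\cdot\rangle$ be the exterior product (sum over shuffles) composed with $\langle\cdot,\cdot\rangle_{\mathfrak a}$. Set $$\mathcal Z^2_Q(\mathfrak l,\Phi_{\mathfrak l},\mathfrak a)=\{(\alpha,\gamma)\in C^2(\mathfrak l,\mathfrak a)^{(\mathfrak h,K)}\oplus C^3(\mathfrak l)^{(\mathfrak h,K)}\mid d\alpha=0,\ d\gamma=\tfrac12\langle\alpha\wedge\alpha\rangle\}.$$ The set $\mathcal C^1_Q=C^1(\mathfrak l,\mathfrak a)^{(\mathfrak h,K)}\oplus C^2(\mathfrak l)^{(\mathfrak h,K)}$, with group law $(\tau_1,\sigma_1)*(\tau_2,\sigma_2)=(\tau_1+\tau_2,\sigma_1+\sigma_2+\frac12\langle\tau_1\wedge\tau_2\rangle)$,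 acts on it from the right by $(\alpha,\gamma)(\tau,\sigma)=(\alpha+d\tau,\ \gamma+d\sigma+\langle(\alpha+\tfrac12d\tau)\wedge\tau\rangle)$, and $\mathcal H^2_Q(\mathfrak l,\Phi_{\mathfrak l},\mathfrak a)$ is the orbit space; $[\alpha,\gamma]$ denotes the orbit of $(\alpha,\gamma)$. **Balanced classes.** Let $\rho$ be semisimple, let $\alpha=\alpha_0+\alpha_1$ according to $\mathfrak a=\mathfrak a^{\mathfrak l}\oplus\rho(\mathfrak l)\mathfrak a$, let $S(\mathfrak l)$ be the maximal ideal of $\mathfrak l$ on which $\mathfrak l$ acts semisimply, and let $m$ be such that $R_{m+1}(\mathfrak l)=0$. A cocycle $(\alpha,\gamma)\in\mathcal Z^2_Q(\mathfrak l,\Phi_{\mathfrak l},\mathfrak a)$ is balanced if $(A_k)$ and $(B_k)$ hold for $0\le k\le m$: - $(A_0)$ If $L_0\in\mathfrak z(\mathfrak l)\cap\ker\rho$ and there are $A_0\in\mathfrak a$, $Z_0\in\mathfrak l^*$ with $\alpha(L,L_0)=\rho(L)A_0$ and $\gamma(L,L_0,\cdot)=-\langle A_0,\alpha(L,\cdot)\rangle_{\mathfrak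 a}+\langle Z_0,[L,\cdot]\rangle$ in $\mathfrak l^*$ for all $L\in\mathfrak l$, then $L_0=0$. - $(B_0)$ The image under $\alpha_0:\bigwedge^2\mathfrak l\to\mathfrak a^{\mathfrak l}$ of the kernel of the bracket $\bigwedge^2\mathfrak l\to\mathfrak l$ is non-degenerate. - $(A_k)$, $k\ge1$: If $\mathfrak k\subset S(\mathfrak l)\cap R_k(\mathfrak l)$ is an ideal of $\mathfrak l$ and there are $\Phi_1\in\operatorname{Hom}(\mathfrak k,\mathfrak a)$, $\Phi_2\in\operatorname{Hom}(\mathfrak k,R_k(\mathfrak l)^*)$ with $\alpha(L,X)=\rho(L)\Phi_1(X)-\Phi_1([L,X])$ and $\gamma(L,X,\cdot)=-\langle\Phi_1(X),\alpha(L,\cdot)\rangle_{\mathfrak a}+\langle\Phi_2(X),[L,\cdot]\rangle+\langle\Phi_2([L,X]),\cdot\rangle$ in $R_k(\mathfrak l)^*$ for all $L\in\mathfrak l$, $X\in\mathfrak k$, then $\mathfrak k=0$. - $(B_k)$, $k\ge1$: The maximal $\mathfrak l$-submodule $\mathfrak b_k\subset\mathfrak a$ for which there is $\Psi_k\in\operatorname{Hom}(R_k(\mathfrak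 l),\mathfrak a)$ with $\langle\alpha(L,X),B\rangle_{\mathfrak a}=\langle\rho(L)\Psi_k(X)-\Psi_k([L,X]),B\rangle_{\mathfrak a}$ for all $L\in\mathfrak l$, $X\in R_k(\mathfrak l)$, $B\in\mathfrak b_k$ is non-degenerate. Let $\mathcal H^2_Q(\mathfrak l,\Phi_{\mathfrak l},\mathfrak a)_b$ be the set of the classes of balanced cocycles if $\rho$ is semisimple, and the empty set otherwise. **Theorem.** There is a bijective map $\Psi$ from the set of equivalence classes of quadratic extensions of $(\mathfrak l,\Phi_{\mathfrak l})$ by $\mathfrak a$ to $\mathcal H^2_Q(\mathfrak l,\Phi_{\mathfrak l},\mathfrak a)$, and the image under $\Psi$ of the subset of all equivalence classes of balanced extensions equals $\mathcal H^2_Q(\mathfrak l,\Phi_{\mathfrak l},\mathfrak a)_b$. Explicitly, for every quadratic extension $(\mathfrak g,\mathfrak i,i,p)$ the map $\mathfrak g\to\mathfrak l$ induced by $p$ has an $(\mathfrak h,K)$-equivariant section $s$ with isotropic image, and for each such $s$ the class of the extension is mapped to $[\alpha,\gamma]$, where $(\alpha,\gamma)\in\mathcal Z^2_Q(\mathfrak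 l,\Phi_{\mathfrak l},\mathfrak a)$ is given by $i(\alpha(L_1,L_2))=[s(L_1),s(L_2)]-s([L_1,L_2])+\mathfrak i$ and $\gamma(L_1,L_2,L_3)=\langle[s(L_1),s(L_2)],s(L_3)\rangle$. -/

import Mathlib

open scoped Manifold ContDiff

universe u v

noncomputable section

/-! ### Modules, Lie algebras and metric Lie algebras with an action of a pair `(𝔥, K)` -/

/-- A group `K` acting on a Lie algebra `𝔥` by Lie algebra automorphisms, such that `𝔥` is a
semisimple `K`-module. -/
structure HKPair (𝔥 K : Type*) [LieRing 𝔥] [LieAlgebra ℝ 𝔥] [Group K] where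
  act : Representation ℝ K 𝔥
  act_lie : ∀ (k : K) (X Y : 𝔥), act k ⁅X, Y⁆ = ⁅act k X, act k Y⁆
  semisimple : ∀ W : Submodule ℝ 𝔥, (∀ k, ∀ X ∈ W, act k X ∈ W) →
    ∃ W' : Submodule ℝ 𝔥, (∀ k, ∀ X ∈ W', act k X ∈ W') ∧ IsCompl W W'

/-- An `(𝔥, K)`-module structure on a (finite-dimensional) real vector space `V`: a representation
of the Lie algebra `𝔥` and a continuous representation of the Lie group `K`, with
`Φ (k • X) = Φ k ∘ Φ X ∘ (Φ k)⁻¹`. -/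
structure HKModule {𝔥 K : Type*} [LieRing 𝔥] [LieAlgebra ℝ 𝔥] [Group K] [TopologicalSpace K]
    (κ : HKPair 𝔥 K) (V : Type*) [AddCommGroup V] [Module ℝ V] where
  alg : 𝔥 →ₗ[ℝ] Module.End ℝ V
  alg_bracket : ∀ X Y : 𝔥, alg ⁅X, Y⁆ = alg X * alg Y - alg Y * alg X
  grp : Representation ℝ K V
  /-- all matrix coefficients of the representation of `K` are continuous -/
  continuous_grp : ∀ (f : Module.Dual ℝ V) (x : V), Continuous fun k : K => f (grp k x)
  alg_act : ∀ (k : K) (X : 𝔥), alg (κ.act k X) = grp k * alg X * grp k⁻¹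

/-- A subspace that is invariant under all `Φ X` and all `Φ k`. -/
def HKModule.Invariant {𝔥 K : Type*} [LieRing 𝔥] [LieAlgebra ℝ 𝔥] [Group K] [TopologicalSpace K]
    {κ : HKPair 𝔥 K} {V : Type*} [AddCommGroup V] [Module ℝ V] (Φ : HKModule κ V)
    (W : Submodule ℝ V) : Prop :=
  (∀ X, ∀ x ∈ W, Φ.alg X x ∈ W) ∧ ∀ k, ∀ x ∈ W, Φ.grp k x ∈ W

/-- Every `(𝔥, K)`-submodule has a complementary `(𝔥, K)`-submodule. -/
def HKModule.IsSemisimple {𝔥 K : Type*} [LieRing 𝔥] [LieAlgebra ℝ 𝔥] [Group K]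
    [TopologicalSpace K] {κ : HKPair 𝔥 K} {V : Type*} [AddCommGroup V] [Module ℝ V]
    (Φ : HKModule κ V) : Prop :=
  ∀ W : Submodule ℝ V, Φ.Invariant W → ∃ W' : Submodule ℝ V, Φ.Invariant W' ∧ IsCompl W W'

/-- The structure of an `(𝔥, K)`-equivariant Lie algebra on `L`: a semisimple `(𝔥, K)`-module
structure for which `𝔥` acts by derivations and `K` by automorphisms. -/
structure EquivariantLie {𝔥 K : Type*} [LieRing 𝔥] [LieAlgebra ℝ 𝔥] [Group K]
    [TopologicalSpace K] (κ : HKPair 𝔥 K) (L : Type*) [LieRing L] [LieAlgebra ℝ L]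
    extends HKModule κ L where
  semisimple : toHKModule.IsSemisimple
  alg_lie : ∀ X x y, alg X ⁅x, y⁆ = ⁅alg X x, y⁆ + ⁅x, alg X y⁆
  grp_lie : ∀ k x y, grp k ⁅x, y⁆ = ⁅grp k x, grp k y⁆

/-- The structure of an `(𝔥, K)`-equivariant metric Lie algebra on `G`. -/
structure EquivariantMetricLie {𝔥 K : Type*} [LieRing 𝔥] [LieAlgebra ℝ 𝔥] [Group K]
    [TopologicalSpace K] (κ : HKPair 𝔥 K) (G : Type*) [LieRing G] [LieAlgebra ℝ G]
    extends EquivariantLie κ G where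
  form : LinearMap.BilinForm ℝ G
  symm : form.IsSymm
  nondegenerate : form.Nondegenerate
  invariant : form.lieInvariant G
  alg_skew : ∀ X x y, form (alg X x) y = -form x (alg X y)
  grp_isometry : ∀ k x y, form (grp k x) (grp k y) = form x y

/-- The structure of an orthogonal `(𝔩, Φ_𝔩)`-module on an `𝔩`-module `𝔞`; the representation `ρ`
is the given Lie module structure, `ρ(L) A = ⁅L, A⁆`, and `𝔞` is regarded as an abelian Lie
algebra. -/
structure OrthogonalModule {𝔥 K : Type*} [LieRing 𝔥] [LieAlgebra ℝ 𝔥] [Group K]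
    [TopologicalSpace K] {κ : HKPair 𝔥 K} {𝔩 : Type*} [LieRing 𝔩] [LieAlgebra ℝ 𝔩]
    (Φ : EquivariantLie κ 𝔩) (𝔞 : Type*) [AddCommGroup 𝔞] [Module ℝ 𝔞] [LieRingModule 𝔩 𝔞]
    [LieModule ℝ 𝔩 𝔞] extends HKModule κ 𝔞 where
  semisimple : toHKModule.IsSemisimple
  rep_grp : ∀ k (L : 𝔩) (A : 𝔞), ⁅Φ.grp k L, A⁆ = grp k ⁅L, grp k⁻¹ A⁆
  rep_alg : ∀ X (L : 𝔩) (A : 𝔞), ⁅Φ.alg X L, A⁆ = alg X ⁅L, A⁆ - ⁅L, alg X A⁆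
  form : LinearMap.BilinForm ℝ 𝔞
  symm : form.IsSymm
  nondegenerate : form.Nondegenerate
  alg_skew : ∀ X A B, form (alg X A) B = -form A (alg X B)
  grp_isometry : ∀ k A B, form (grp k A) (grp k B) = form A B
  rep_skew : ∀ (L : 𝔩) A B, form ⁅L, A⁆ B = -form A ⁅L, B⁆

/-! ### Semisimple modules, the ideals `R_k`, the canonical isotropic ideal, the socle -/

/-- A Lie module is semisimple if every submodule has a complementary submodule. -/
def IsSemisimpleLieModule (L M : Type*) [LieRing L] [LieAlgebra ℝ L] [AddCommGroup M] [Module ℝ M]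
    [LieRingModule L M] [LieModule ℝ L M] : Prop :=
  ComplementedLattice (LieSubmodule ℝ L M)

/-- The chain `L = R_0 ⊇ R_1 ⊇ …`, where `R_{k+1}` is the smallest ideal of `L` contained in `R_k`
such that the `L`-module `R_k / R_{k+1}` is semisimple. -/
def radicalChain (L : Type*) [LieRing L] [LieAlgebra ℝ L] : ℕ → LieIdeal ℝ L
  | 0 => ⊤
  | k + 1 => sInf {I : LieIdeal ℝ L | I ≤ radicalChain L k ∧
      IsSemisimpleLieModule L
        ((radicalChain L k) ⧸ (LieSubmodule.comap (LieSubmodule.incl (radicalChain L k)) I))}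

/-- The canonical isotropic ideal `∑_{k ≥ 1} R_k ∩ R_k^⊥` (as a subspace) of a Lie algebra with a
symmetric bilinear form. -/
def canonicalIsotropicIdeal {G : Type*} [LieRing G] [LieAlgebra ℝ G]
    (B : LinearMap.BilinForm ℝ G) : Submodule ℝ G :=
  ⨆ k : ℕ, (radicalChain G (k + 1)).toSubmodule ⊓
    B.orthogonal (radicalChain G (k + 1)).toSubmodule

/-- The socle of `L`: the maximal ideal of `L` on which `L` acts semisimply. -/
def lieSocle (L : Type*) [LieRing L] [LieAlgebra ℝ L] : LieIdeal ℝ L :=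
  sSup {I : LieIdeal ℝ L | IsSemisimpleLieModule L I}

/-! ### Quadratic extensions -/

section Extension

variable {𝔥 K : Type*} [LieRing 𝔥] [LieAlgebra ℝ 𝔥] [Group K] [TopologicalSpace K]
  {κ : HKPair 𝔥 K}
  {𝔩 : Type u} [LieRing 𝔩] [LieAlgebra ℝ 𝔩] {Φ : EquivariantLie κ 𝔩}
  {𝔞 : Type v} [AddCommGroup 𝔞] [Module ℝ 𝔞] [LieRingModule 𝔩 𝔞] [LieModule ℝ 𝔩 𝔞]

/-- A quadratic extension `(𝔤, 𝔦, i, p)` of `(𝔩, Φ_𝔩)` by the orthogonal `(𝔩, Φ_𝔩)`-module `𝔞`. The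
maps induced on `𝔤 ⧸ 𝔦` by the equivariant structure and by the inner product of `𝔤` are expressed
through representatives. -/
structure QuadraticExtension (ΦA : OrthogonalModule Φ 𝔞) where
  carrier : Type (max u v)
  [lieRing : LieRing carrier]
  [lieAlgebra : LieAlgebra ℝ carrier]
  [finite : Module.Finite ℝ carrier]
  metric : EquivariantMetricLie κ carrier
  ideal : LieIdeal ℝ carrier
  ideal_isotropic : ∀ x ∈ ideal, ∀ y ∈ ideal, metric.form x y = 0
  ideal_invariant : metric.Invariant ideal.toSubmodule
  /-- `i : 𝔞 → 𝔤 ⧸ 𝔦` -/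
  incl : 𝔞 →ₗ[ℝ] carrier ⧸ ideal
  /-- `p : 𝔤 ⧸ 𝔦 → 𝔩` -/
  proj : (carrier ⧸ ideal) →ₗ⁅ℝ⁆ 𝔩
  incl_lie : ∀ A B, ⁅incl A, incl B⁆ = 0
  incl_alg : ∀ X A x, LieSubmodule.Quotient.mk' ideal x = incl A →
    LieSubmodule.Quotient.mk' ideal (metric.alg X x) = incl (ΦA.alg X A)
  incl_grp : ∀ k A x, LieSubmodule.Quotient.mk' ideal x = incl A →
    LieSubmodule.Quotient.mk' ideal (metric.grp k x) = incl (ΦA.grp k A)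
  proj_alg : ∀ X x, proj (LieSubmodule.Quotient.mk' ideal (metric.alg X x)) =
    Φ.alg X (proj (LieSubmodule.Quotient.mk' ideal x))
  proj_grp : ∀ k x, proj (LieSubmodule.Quotient.mk' ideal (metric.grp k x)) =
    Φ.grp k (proj (LieSubmodule.Quotient.mk' ideal x))
  incl_injective : Function.Injective incl
  exact : Function.Exact incl proj
  proj_surjective : Function.Surjective proj
  /-- consistency with the representation of `𝔩` on `𝔞` -/
  lie_incl : ∀ (x : carrier ⧸ ideal) (A : 𝔞), ⁅x, incl A⁆ = incl ⁅proj x, A⁆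
  /-- `i` maps `𝔞` onto `𝔦^⊥ / 𝔦` … -/
  range_incl : LinearMap.range incl =
    (metric.form.orthogonal ideal.toSubmodule).map
      (LieSubmodule.Quotient.mk' ideal : carrier →ₗ[ℝ] carrier ⧸ ideal)
  /-- … and is isometric. -/
  incl_isometry : ∀ A B x y, LieSubmodule.Quotient.mk' ideal x = incl A →
    LieSubmodule.Quotient.mk' ideal y = incl B → metric.form x y = ΦA.form A B

attribute [instance] QuadraticExtension.lieRing QuadraticExtension.lieAlgebra
  QuadraticExtension.finite

namespace QuadraticExtension

variable {ΦA : OrthogonalModule Φ 𝔞}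

/-- The projection `𝔤 → 𝔤 ⧸ 𝔦`. -/
def quot (E : QuadraticExtension ΦA) : E.carrier →ₗ[ℝ] E.carrier ⧸ E.ideal :=
  (LieSubmodule.Quotient.mk' E.ideal : E.carrier →ₗ[ℝ] E.carrier ⧸ E.ideal)

/-- `(𝔤, 𝔦, i, p)` is balanced if `𝔦` is the canonical isotropic ideal of `𝔤`. -/
def IsBalanced (E : QuadraticExtension ΦA) : Prop :=
  E.ideal.toSubmodule = canonicalIsotropicIdeal E.metric.form

/-- Equivalences of quadratic extensions: isomorphisms `F : 𝔤₁ → 𝔤₂` of `(𝔥, K)`-equivariant metric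
Lie algebras with `F(𝔦₁) = 𝔦₂` whose induced map `F̄ : 𝔤₁ ⧸ 𝔦₁ → 𝔤₂ ⧸ 𝔦₂` satisfies `F̄ ∘ i₁ = i₂`
and `p₂ ∘ F̄ = p₁`. -/
structure IsEquivalence (E₁ E₂ : QuadraticExtension ΦA) (F : E₁.carrier ≃ₗ⁅ℝ⁆ E₂.carrier) :
    Prop where
  alg : ∀ X x, F (E₁.metric.alg X x) = E₂.metric.alg X (F x)
  grp : ∀ k x, F (E₁.metric.grp k x) = E₂.metric.grp k (F x)
  isometry : ∀ x y, E₂.metric.form (F x) (F y) = E₁.metric.form x y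
  map_ideal : ∀ x, F x ∈ E₂.ideal ↔ x ∈ E₁.ideal
  incl : ∀ A x, E₁.quot x = E₁.incl A → E₂.quot (F x) = E₂.incl A
  proj : ∀ x, E₂.proj (E₂.quot (F x)) = E₁.proj (E₁.quot x)

lemma quot_surjective (E : QuadraticExtension ΦA) : Function.Surjective E.quot :=
  LieSubmodule.Quotient.surjective_mk' E.ideal

lemma quot_eq_quot_iff (E : QuadraticExtension ΦA) (x y : E.carrier) :
    E.quot x = E.quot y ↔ x - y ∈ E.ideal := by
  rw [← sub_eq_zero, ← map_sub]
  exact LieSubmodule.Quotient.mk_eq_zero (N := E.ideal)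

/-- Equivalence of quadratic extensions of `(𝔩, Φ_𝔩)` by `𝔞`. -/
def equivalence (ΦA : OrthogonalModule Φ 𝔞) : Setoid (QuadraticExtension ΦA) where
  r E₁ E₂ := ∃ F : E₁.carrier ≃ₗ⁅ℝ⁆ E₂.carrier, IsEquivalence E₁ E₂ F
  iseqv :=
    { refl := fun E => ⟨LieEquiv.refl, ⟨fun _ _ => rfl, fun _ _ => rfl, fun _ _ => rfl,
        fun _ => Iff.rfl, fun _ _ h => h, fun _ => rfl⟩⟩
      symm := by
        rintro E₁ E₂ ⟨F, hF⟩
        refine ⟨F.symm, ⟨fun X x => ?_, fun k x => ?_, fun x y => ?_, fun x => ?_,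
          fun A x hx => ?_, fun x => ?_⟩⟩
        · have h := hF.alg X (F.symm x)
          rw [LieEquiv.apply_symm_apply] at h
          rw [← h, LieEquiv.symm_apply_apply]
        · have h := hF.grp k (F.symm x)
          rw [LieEquiv.apply_symm_apply] at h
          rw [← h, LieEquiv.symm_apply_apply]
        · rw [← hF.isometry]; simp
        · rw [← hF.map_ideal]; simp
        · obtain ⟨y, hy⟩ := E₁.quot_surjective (E₁.incl A)
          have h := hF.incl A y hy
          rw [← hy, quot_eq_quot_iff, ← hF.map_ideal, map_sub, ← quot_eq_quot_iff, h,
            LieEquiv.apply_symm_apply, hx]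
        · rw [← hF.proj]; simp
      trans := by
        rintro E₁ E₂ E₃ ⟨F, hF⟩ ⟨G, hG⟩
        refine ⟨F.trans G, ⟨fun X x => ?_, fun k x => ?_, fun x y => ?_, fun x => ?_,
          fun A x hx => ?_, fun x => ?_⟩⟩
        · simp [hF.alg, hG.alg]
        · simp [hF.grp, hG.grp]
        · simp [hF.isometry, hG.isometry]
        · simp [hF.map_ideal, hG.map_ideal]
        · exact hG.incl A _ (hF.incl A x hx)
        · simp [hF.proj, hG.proj] }

/-- The set of equivalence classes of quadratic extensions of `(𝔩, Φ_𝔩)` by `𝔞`. -/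
def Classes (ΦA : OrthogonalModule Φ 𝔞) : Type _ := Quotient (equivalence ΦA)

/-- The equivalence class of a quadratic extension. -/
def cls (E : QuadraticExtension ΦA) : Classes ΦA := Quotient.mk (equivalence ΦA) E

end QuadraticExtension

end Extension

/-! ### Quadratic cohomology -/

/-- The exponential `e^T` of an endomorphism of a finite-dimensional real vector space. -/
def endExp {V : Type*} [AddCommGroup V] [Module ℝ V] [Module.Finite ℝ V] (T : Module.End ℝ V) :
    Module.End ℝ V :=
  Matrix.toLin (Module.finBasis ℝ V) (Module.finBasis ℝ V)
    (NormedSpace.exp (LinearMap.toMatrix (Module.finBasis ℝ V) (Module.finBasis ℝ V) T))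

section Cochains

variable {𝔩 : Type*} {V : Type*} [AddCommGroup V] [Module ℝ V]

/-- The Chevalley–Eilenberg differential on cochains of degree `p + 1`, with respect to the action
`ρ` of `𝔩` on `V` (indices are counted from `0`; `i < j` are the two indices removed in the second
sum). -/
def ceDifferential [LieRing 𝔩] (ρ : 𝔩 → V → V) {p : ℕ} (τ : (Fin (p + 1) → 𝔩) → V) :
    (Fin (p + 2) → 𝔩) → V := fun v =>
  (∑ i : Fin (p + 2), (-1 : ℝ) ^ (i : ℕ) • ρ (v i) (τ (i.removeNth v))) +
  ∑ j : Fin (p + 2), ∑ i : Fin (p + 1),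
    if i.castSucc < j then
      (-1 : ℝ) ^ ((i : ℕ) + (j : ℕ)) • τ (Fin.cons ⁅v i.castSucc, v j⁆ (i.removeNth (j.removeNth v)))
    else 0

/-- The product `⟨α ∧ β⟩` of cochains of degree `p` and `q` with values in a space with a bilinear
form `B`. -/
def wedgeForm (B : LinearMap.BilinForm ℝ V) {p q : ℕ} (α : (Fin p → 𝔩) → V)
    (β : (Fin q → 𝔩) → V) : (Fin (p + q) → 𝔩) → ℝ := fun v =>
  ((p.factorial : ℝ) * (q.factorial : ℝ))⁻¹ *
    ∑ σ : Equiv.Perm (Fin (p + q)), ((Equiv.Perm.sign σ : ℤ) : ℝ) *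
      B (α fun i => v (σ (Fin.castAdd q i))) (β fun j => v (σ (Fin.natAdd p j)))

/-- The alternating map of degree `2` given by an alternating bilinear map. -/
def alternatingOfBilin [AddCommGroup 𝔩] [Module ℝ 𝔩] (f : 𝔩 →ₗ[ℝ] 𝔩 →ₗ[ℝ] V)
    (hf : ∀ x, f x x = 0) : 𝔩 [⋀^Fin 2]→ₗ[ℝ] V where
  toFun v := f (v 0) (v 1)
  map_update_add' := by
    intro inst v i x y
    obtain rfl : inst = instDecidableEqFin 2 := Subsingleton.elim _ _
    fin_cases i <;> simp
  map_update_smul' := by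
    intro inst v i c x
    obtain rfl : inst = instDecidableEqFin 2 := Subsingleton.elim _ _
    fin_cases i <;> simp
  map_eq_zero_of_eq' := by
    intro v i j h hij
    have h01 : v 0 = v 1 := by fin_cases i <;> fin_cases j <;> simp_all
    rw [h01, hf]

/-- The Lie bracket of `𝔩` as a bilinear map. -/
def lieBracketBilin (𝔩 : Type*) [LieRing 𝔩] [LieAlgebra ℝ 𝔩] : 𝔩 →ₗ[ℝ] 𝔩 →ₗ[ℝ] 𝔩 :=
  LinearMap.mk₂ ℝ (fun x y => ⁅x, y⁆) add_lie smul_lie lie_add (fun c x y => lie_smul c x y)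

/-- The pull back `(S, U)^* α = U ∘ α(S ·, …, S ·)`. -/
def cochainPullback [AddCommGroup 𝔩] [Module ℝ 𝔩] (S : Module.End ℝ 𝔩) (U : Module.End ℝ V)
    {p : ℕ} (α : 𝔩 [⋀^Fin p]→ₗ[ℝ] V) : 𝔩 [⋀^Fin p]→ₗ[ℝ] V :=
  U.compAlternatingMap (α.compLinearMap S)

end Cochains

section Cohomology

set_option linter.unusedSectionVars false

variable {𝔥 K : Type*} [LieRing 𝔥] [LieAlgebra ℝ 𝔥] [Group K] [TopologicalSpace K]
  {κ : HKPair 𝔥 K}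
  {𝔩 : Type u} [LieRing 𝔩] [LieAlgebra ℝ 𝔩] [Module.Finite ℝ 𝔩] {Φ : EquivariantLie κ 𝔩}
  {𝔞 : Type v} [AddCommGroup 𝔞] [Module ℝ 𝔞] [Module.Finite ℝ 𝔞] [LieRingModule 𝔩 𝔞]
  [LieModule ℝ 𝔩 𝔞]

/-- The space `C^p(𝔩, 𝔞)^{(𝔥, K)}` of cochains that are invariant under the morphisms of pairs
`(e^{Φ_𝔩(X)}, e^{-Φ_𝔞(X)})` and `(Φ_𝔩(k), Φ_𝔞(k)⁻¹)`. -/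
def invariantCochains (ΦA : OrthogonalModule Φ 𝔞) (p : ℕ) : Set (𝔩 [⋀^Fin p]→ₗ[ℝ] 𝔞) :=
  {α | (∀ X, cochainPullback (endExp (Φ.alg X)) (endExp (-ΦA.alg X)) α = α) ∧
    ∀ k, cochainPullback (Φ.grp k) (ΦA.grp k⁻¹) α = α}

/-- The space `C^p(𝔩)^{(𝔥, K)}` of invariant cochains with values in the trivial module `ℝ`. -/
def invariantScalarCochains (Φ : EquivariantLie κ 𝔩) (p : ℕ) : Set (𝔩 [⋀^Fin p]→ₗ[ℝ] ℝ) :=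
  {γ | (∀ X, cochainPullback (endExp (Φ.alg X)) LinearMap.id γ = γ) ∧
    ∀ k, cochainPullback (Φ.grp k) LinearMap.id γ = γ}

/-- The differential of `C^*(𝔩, 𝔞)`. -/
abbrev dRep {p : ℕ} (τ : (Fin (p + 1) → 𝔩) → 𝔞) : (Fin (p + 2) → 𝔩) → 𝔞 :=
  ceDifferential (fun L A => ⁅L, A⁆) τ

/-- The differential of `C^*(𝔩)`. -/
abbrev dTriv {p : ℕ} (σ : (Fin (p + 1) → 𝔩) → ℝ) : (Fin (p + 2) → 𝔩) → ℝ :=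
  ceDifferential (fun _ _ => 0) σ

/-- Quadratic `1`-cochains `(τ, σ) ∈ C^1(𝔩, 𝔞)^{(𝔥, K)} ⊕ C^2(𝔩)^{(𝔥, K)}`. -/
structure QuadraticCochain (ΦA : OrthogonalModule Φ 𝔞) where
  τ : 𝔩 [⋀^Fin 1]→ₗ[ℝ] 𝔞
  σ : 𝔩 [⋀^Fin 2]→ₗ[ℝ] ℝ
  τ_mem : τ ∈ invariantCochains ΦA 1
  σ_mem : σ ∈ invariantScalarCochains Φ 2

/-- Quadratic `2`-cocycles `(α, γ) ∈ C^2(𝔩, 𝔞)^{(𝔥, K)} ⊕ C^3(𝔩)^{(𝔥, K)}`, `dα = 0`,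
`dγ = ½ ⟨α ∧ α⟩`. -/
structure QuadraticCocycle (ΦA : OrthogonalModule Φ 𝔞) where
  α : 𝔩 [⋀^Fin 2]→ₗ[ℝ] 𝔞
  γ : 𝔩 [⋀^Fin 3]→ₗ[ℝ] ℝ
  α_mem : α ∈ invariantCochains ΦA 2
  γ_mem : γ ∈ invariantScalarCochains Φ 3
  d_α : dRep α = 0
  d_γ : dTriv γ = (1 / 2 : ℝ) • wedgeForm ΦA.form α α

/-- `z' = z (τ, σ)` for the right action
`(α, γ)(τ, σ) = (α + dτ, γ + dσ + ⟨(α + ½ dτ) ∧ τ⟩)` of quadratic `1`-cochains on quadratic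
`2`-cocycles. -/
def QuadraticCocycle.IsTranslate {ΦA : OrthogonalModule Φ 𝔞} (z : QuadraticCocycle ΦA)
    (c : QuadraticCochain ΦA) (z' : QuadraticCocycle ΦA) : Prop :=
  ⇑z'.α = ⇑z.α + dRep c.τ ∧
  ⇑z'.γ = ⇑z.γ + dTriv c.σ + wedgeForm ΦA.form (⇑z.α + (1 / 2 : ℝ) • dRep c.τ) c.τ


lemma dRep_one (τ : (Fin 1 → 𝔩) → 𝔞) (v : Fin 2 → 𝔩) :
    dRep τ v = ⁅v 0, τ ![v 1]⁆ - ⁅v 1, τ ![v 0]⁆ - τ ![⁅v 0, v 1⁆] := by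
  have h0 : Fin.removeNth (0 : Fin 2) v = ![v 1] := by ext i; fin_cases i; rfl
  have h1 : Fin.removeNth (1 : Fin 2) v = ![v 0] := by ext i; fin_cases i; rfl
  have h2 : ∀ (x : 𝔩) (w : Fin 0 → 𝔩), (Fin.cons x w : Fin 1 → 𝔩) = ![x] := by
    intro x w; ext i; fin_cases i; rfl
  simp [ceDifferential, Fin.sum_univ_two, h0, h1, h2]
  abel

lemma dTriv_two (σ : (Fin 2 → 𝔩) → ℝ) (v : Fin 3 → 𝔩) :
    dTriv σ v = -σ ![⁅v 0, v 1⁆, v 2] + σ ![⁅v 0, v 2⁆, v 1] - σ ![⁅v 1, v 2⁆, v 0] := by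
  have h2 : ∀ (x : 𝔩) (w : Fin 1 → 𝔩), (Fin.cons x w : Fin 2 → 𝔩) = ![x, w 0] := by
    intro x w; ext i; fin_cases i <;> rfl
  have e1 : (0 : Fin 2).removeNth ((1 : Fin 3).removeNth v) 0 = v 2 := rfl
  have e2 : (0 : Fin 2).removeNth ((2 : Fin 3).removeNth v) 0 = v 1 := rfl
  have e3 : (1 : Fin 2).removeNth ((2 : Fin 3).removeNth v) 0 = v 0 := rfl
  have e0 : (0 : Fin 2).removeNth ((0 : Fin 3).removeNth v) 0 = v 2 := rfl
  have e4 : (1 : Fin 2).removeNth ((0 : Fin 3).removeNth v) 0 = v 1 := rfl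
  have e5 : (1 : Fin 2).removeNth ((1 : Fin 3).removeNth v) 0 = v 0 := rfl
  change (∑ i : Fin 3, _) + ∑ j : Fin 3, ∑ i : Fin 2, _ = _
  simp only [Fin.sum_univ_three, Fin.sum_univ_two, h2, e0, e1, e2, e3, e4, e5]
  simp
  ring

lemma wedgeForm_one_one (B : LinearMap.BilinForm ℝ 𝔞) (τ₁ τ₂ : (Fin 1 → 𝔩) → 𝔞)
    (v : Fin 2 → 𝔩) :
    wedgeForm B τ₁ τ₂ v = B (τ₁ ![v 0]) (τ₂ ![v 1]) - B (τ₁ ![v 1]) (τ₂ ![v 0]) := by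
  have hu : (Finset.univ : Finset (Equiv.Perm (Fin (1 + 1)))) = {1, Equiv.swap 0 1} := by decide
  have h : ∀ w : Fin 1 → 𝔩, w = ![w 0] := by intro w; ext i; fin_cases i; rfl
  unfold wedgeForm
  rw [hu, Finset.sum_pair (by decide)]
  rw [h (fun i => v ((1 : Equiv.Perm (Fin (1 + 1))) (Fin.castAdd 1 i))),
    h (fun i => v ((1 : Equiv.Perm (Fin (1 + 1))) (Fin.natAdd 1 i))),
    h (fun i => v ((Equiv.swap 0 1 : Equiv.Perm (Fin (1 + 1))) (Fin.castAdd 1 i))),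
    h (fun i => v ((Equiv.swap 0 1 : Equiv.Perm (Fin (1 + 1))) (Fin.natAdd 1 i)))]
  simp
  rfl

lemma wedgeForm_two_one (B : LinearMap.BilinForm ℝ 𝔞) (α : (Fin 2 → 𝔩) → 𝔞)
    (hα : ∀ x y, α ![x, y] = - α ![y, x]) (τ : (Fin 1 → 𝔩) → 𝔞) (v : Fin 3 → 𝔩) :
    wedgeForm B α τ v = B (α ![v 0, v 1]) (τ ![v 2]) - B (α ![v 0, v 2]) (τ ![v 1])
      + B (α ![v 1, v 2]) (τ ![v 0]) := by
  have hu : (Finset.univ : Finset (Equiv.Perm (Fin (2 + 1)))) =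
    {1, Equiv.swap 0 1, Equiv.swap 0 2, Equiv.swap 1 2, Equiv.swap 0 1 * Equiv.swap 1 2,
      Equiv.swap 1 2 * Equiv.swap 0 1} := by decide
  have h : ∀ w : Fin 1 → 𝔩, w = ![w 0] := by intro w; ext i; fin_cases i; rfl
  have h' : ∀ w : Fin 2 → 𝔩, w = ![w 0, w 1] := by intro w; ext i; fin_cases i <;> rfl
  have key : ∀ σ : Equiv.Perm (Fin (2 + 1)),
      B (α fun i => v (σ (Fin.castAdd 1 i))) (τ fun j => v (σ (Fin.natAdd 2 j))) =
      B (α ![v (σ 0), v (σ 1)]) (τ ![v (σ 2)]) := by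
    intro σ
    rw [h' (fun i => v (σ (Fin.castAdd 1 i))), h (fun i => v (σ (Fin.natAdd 2 i)))]
    rfl
  unfold wedgeForm
  simp only [key]
  rw [hu, Finset.sum_insert (by decide), Finset.sum_insert (by decide),
    Finset.sum_insert (by decide), Finset.sum_insert (by decide), Finset.sum_pair (by decide)]
  have a1 : (Equiv.swap 0 1 * Equiv.swap 1 2 : Equiv.Perm (Fin (2 + 1))) 0 = 1 := by decide
  have a2 : (Equiv.swap 0 1 * Equiv.swap 1 2 : Equiv.Perm (Fin (2 + 1))) 1 = 2 := by decide
  have a3 : (Equiv.swap 0 1 * Equiv.swap 1 2 : Equiv.Perm (Fin (2 + 1))) 2 = 0 := by decide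
  have b1 : (Equiv.swap 1 2 * Equiv.swap 0 1 : Equiv.Perm (Fin (2 + 1))) 0 = 2 := by decide
  have b2 : (Equiv.swap 1 2 * Equiv.swap 0 1 : Equiv.Perm (Fin (2 + 1))) 1 = 0 := by decide
  have b3 : (Equiv.swap 1 2 * Equiv.swap 0 1 : Equiv.Perm (Fin (2 + 1))) 2 = 1 := by decide
  have c1 : (Equiv.swap 0 1 : Equiv.Perm (Fin (2 + 1))) 0 = 1 := by decide
  have c2 : (Equiv.swap 0 1 : Equiv.Perm (Fin (2 + 1))) 1 = 0 := by decide
  have c3 : (Equiv.swap 0 1 : Equiv.Perm (Fin (2 + 1))) 2 = 2 := by decide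
  have d1 : (Equiv.swap 0 2 : Equiv.Perm (Fin (2 + 1))) 0 = 2 := by decide
  have d2 : (Equiv.swap 0 2 : Equiv.Perm (Fin (2 + 1))) 1 = 1 := by decide
  have d3 : (Equiv.swap 0 2 : Equiv.Perm (Fin (2 + 1))) 2 = 0 := by decide
  have e1 : (Equiv.swap 1 2 : Equiv.Perm (Fin (2 + 1))) 0 = 0 := by decide
  have e2 : (Equiv.swap 1 2 : Equiv.Perm (Fin (2 + 1))) 1 = 2 := by decide
  have e3 : (Equiv.swap 1 2 : Equiv.Perm (Fin (2 + 1))) 2 = 1 := by decide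
  have s0 : Equiv.Perm.sign (1 : Equiv.Perm (Fin (2 + 1))) = 1 := by decide
  have s1 : Equiv.Perm.sign (Equiv.swap 0 1 : Equiv.Perm (Fin (2 + 1))) = -1 := by decide
  have s2 : Equiv.Perm.sign (Equiv.swap 0 2 : Equiv.Perm (Fin (2 + 1))) = -1 := by decide
  have s3 : Equiv.Perm.sign (Equiv.swap 1 2 : Equiv.Perm (Fin (2 + 1))) = -1 := by decide
  have s4 : Equiv.Perm.sign (Equiv.swap 0 1 * Equiv.swap 1 2 : Equiv.Perm (Fin (2 + 1))) = 1 := by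
    decide
  have s5 : Equiv.Perm.sign (Equiv.swap 1 2 * Equiv.swap 0 1 : Equiv.Perm (Fin (2 + 1))) = 1 := by
    decide
  rw [a1, a2, a3, b1, b2, b3, c1, c2, c3, d1, d2, d3, e1, e2, e3, s0, s1, s2, s3, s4, s5]
  rw [hα (v 1) (v 0), hα (v 2) (v 1), hα (v 2) (v 0)]
  simp [Nat.factorial]
  ring

lemma endExp_isometry {V : Type*} [AddCommGroup V] [Module ℝ V] [Module.Finite ℝ V]
    (B : LinearMap.BilinForm ℝ V) (hB : B.Nondegenerate) (T : Module.End ℝ V)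
    (hT : ∀ x y, B (T x) y = -B x (T y)) (x y : V) : B (endExp T x) (endExp T y) = B x y := by
  set b := Module.finBasis ℝ V with hb
  set M := LinearMap.toMatrix b b T with hM
  set G := LinearMap.BilinForm.toMatrix b B with hG
  have hGM : M.transpose * G = -(G * M) := by
    rw [hM, hG, ← LinearMap.BilinForm.toMatrix_compLeft, ← LinearMap.BilinForm.toMatrix_compRight,
      ← map_neg]
    congr 1
    ext u w
    simp [hT]
  have hdet : IsUnit G :=
    (Matrix.isUnit_iff_isUnit_det G).2
      (isUnit_iff_ne_zero.2 ((LinearMap.BilinForm.nondegenerate_iff_det_ne_zero b).1 hB))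
  have hdet' : IsUnit G.det := (Matrix.isUnit_iff_isUnit_det G).1 hdet
  have hT' : M.transpose = G * (-M) * G⁻¹ := by
    rw [Matrix.mul_neg, ← hGM, Matrix.mul_assoc, Matrix.mul_nonsing_inv _ hdet', Matrix.mul_one]
  have hexp : (NormedSpace.exp M).transpose * G * NormedSpace.exp M = G := by
    rw [← Matrix.exp_transpose, hT', Matrix.exp_conj _ _ hdet, Matrix.mul_assoc _ G⁻¹ G,
      Matrix.nonsing_inv_mul _ hdet', Matrix.mul_one, Matrix.exp_neg, Matrix.mul_assoc,
      Matrix.nonsing_inv_mul _ ((Matrix.isUnit_iff_isUnit_det _).1 (Matrix.isUnit_exp M)),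
      Matrix.mul_one]
  have hE : LinearMap.toMatrix b b (endExp T) = NormedSpace.exp M := by
    simp [endExp, hM, hb]
  have : B.comp (endExp T) (endExp T) = B := by
    apply (LinearMap.BilinForm.toMatrix b).injective
    rw [LinearMap.BilinForm.toMatrix_comp b b, hE, hexp]
  exact LinearMap.congr_fun₂ this x y

lemma endExp_zero {V : Type*} [AddCommGroup V] [Module ℝ V] [Module.Finite ℝ V] :
    endExp (0 : Module.End ℝ V) = LinearMap.id := by
  simp [endExp]


lemma alternating_one_neg (τ : 𝔩 [⋀^Fin 1]→ₗ[ℝ] 𝔞) (x : 𝔩) : τ ![-x] = -τ ![x] := by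
  have h := τ.map_update_neg ![x] 0 x
  have e : ∀ y : 𝔩, Function.update ![x] 0 y = ![y] := by intro y; ext i; fin_cases i; rfl
  rwa [e, e] at h

lemma alternating_one_add (τ : 𝔩 [⋀^Fin 1]→ₗ[ℝ] 𝔞) (x y : 𝔩) :
    τ ![x + y] = τ ![x] + τ ![y] := by
  have h := τ.map_update_add ![x] 0 x y
  have e : ∀ y : 𝔩, Function.update ![x] 0 y = ![y] := by intro y; ext i; fin_cases i; rfl
  rwa [e, e, e] at h

lemma alternating_one_smul (τ : 𝔩 [⋀^Fin 1]→ₗ[ℝ] 𝔞) (c : ℝ) (x : 𝔩) :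
    τ ![c • x] = c • τ ![x] := by
  have h := τ.map_update_smul ![x] 0 c x
  have e : ∀ y : 𝔩, Function.update ![x] 0 y = ![y] := by intro y; ext i; fin_cases i; rfl
  rwa [e, e] at h

/-- A cochain of degree `1` as a linear map. -/
def cochainOne (τ : 𝔩 [⋀^Fin 1]→ₗ[ℝ] 𝔞) : 𝔩 →ₗ[ℝ] 𝔞 where
  toFun x := τ ![x]
  map_add' := alternating_one_add τ
  map_smul' := alternating_one_smul τ

/-- The product of two cochains of degree `1` as a cochain of degree `2`. -/
def wedgeOneOne (B : LinearMap.BilinForm ℝ 𝔞) (τ₁ τ₂ : 𝔩 [⋀^Fin 1]→ₗ[ℝ] 𝔞) :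
    𝔩 [⋀^Fin 2]→ₗ[ℝ] ℝ :=
  alternatingOfBilin
    (B.compl₁₂ (cochainOne τ₁) (cochainOne τ₂) - (B.compl₁₂ (cochainOne τ₁) (cochainOne τ₂)).flip)
    (fun x => by simp)

lemma wedgeOneOne_apply (B : LinearMap.BilinForm ℝ 𝔞) (τ₁ τ₂ : 𝔩 [⋀^Fin 1]→ₗ[ℝ] 𝔞)
    (v : Fin 2 → 𝔩) :
    wedgeOneOne B τ₁ τ₂ v = B (τ₁ ![v 0]) (τ₂ ![v 1]) - B (τ₁ ![v 1]) (τ₂ ![v 0]) := rfl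

lemma dRep_one_antisymm (τ : 𝔩 [⋀^Fin 1]→ₗ[ℝ] 𝔞) (x y : 𝔩) :
    dRep τ ![x, y] = -dRep τ ![y, x] := by
  rw [dRep_one, dRep_one]
  simp only [Matrix.cons_val_zero, Matrix.cons_val_one]
  rw [← lie_skew x y, alternating_one_neg]
  abel

lemma alternating_two_antisymm (α : 𝔩 [⋀^Fin 2]→ₗ[ℝ] 𝔞) (x y : 𝔩) :
    α ![x, y] = -α ![y, x] := by
  have h := α.map_swap ![y, x] (show (0 : Fin 2) ≠ 1 by decide)
  rw [← h]
  congr 1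
  ext i; fin_cases i <;> rfl

lemma wedgeOneOne_mem (ΦA : OrthogonalModule Φ 𝔞) (τ₁ τ₂ : 𝔩 [⋀^Fin 1]→ₗ[ℝ] 𝔞)
    (h₁ : τ₁ ∈ invariantCochains ΦA 1) (h₂ : τ₂ ∈ invariantCochains ΦA 1) :
    wedgeOneOne ΦA.form τ₁ τ₂ ∈ invariantScalarCochains Φ 2 := by
  have key : ∀ (S : Module.End ℝ 𝔩) (U : Module.End ℝ 𝔞),
      (∀ A B, ΦA.form (U A) (U B) = ΦA.form A B) → cochainPullback S U τ₁ = τ₁ →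
      cochainPullback S U τ₂ = τ₂ →
      cochainPullback S LinearMap.id (wedgeOneOne ΦA.form τ₁ τ₂) = wedgeOneOne ΦA.form τ₁ τ₂ := by
    intro S U hU e₁ e₂
    have e : ∀ τ : 𝔩 [⋀^Fin 1]→ₗ[ℝ] 𝔞, cochainPullback S U τ = τ →
        ∀ x, τ ![x] = U (τ ![S x]) := by
      intro τ h x
      conv_lhs => rw [← h]
      simp only [cochainPullback, LinearMap.compAlternatingMap_apply,
        AlternatingMap.compLinearMap_apply]
      congr 2
      ext i; fin_cases i; rfl
    ext v
    rw [wedgeOneOne_apply, e τ₁ e₁ (v 0), e τ₁ e₁ (v 1), e τ₂ e₂ (v 0), e τ₂ e₂ (v 1), hU, hU]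
    rfl
  refine ⟨fun X => key _ _ (fun A B => ?_) (h₁.1 X) (h₂.1 X),
    fun k => key _ _ (ΦA.grp_isometry k⁻¹) (h₁.2 k) (h₂.2 k)⟩
  refine endExp_isometry _ ΦA.nondegenerate _ (fun A B => ?_) A B
  simp [ΦA.alg_skew]

lemma invariantCochains_zero (ΦA : OrthogonalModule Φ 𝔞) (p : ℕ) :
    0 ∈ invariantCochains ΦA p :=
  ⟨fun _ => by ext; simp [cochainPullback], fun _ => by ext; simp [cochainPullback]⟩

lemma invariantCochains_neg {ΦA : OrthogonalModule Φ 𝔞} {p : ℕ} {α : 𝔩 [⋀^Fin p]→ₗ[ℝ] 𝔞}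
    (h : α ∈ invariantCochains ΦA p) : -α ∈ invariantCochains ΦA p := by
  refine ⟨fun X => ?_, fun k => ?_⟩
  · conv_rhs => rw [← h.1 X]
    ext; simp [cochainPullback]
  · conv_rhs => rw [← h.2 k]
    ext; simp [cochainPullback]

lemma invariantCochains_add {ΦA : OrthogonalModule Φ 𝔞} {p : ℕ} {α β : 𝔩 [⋀^Fin p]→ₗ[ℝ] 𝔞}
    (h : α ∈ invariantCochains ΦA p) (h' : β ∈ invariantCochains ΦA p) :
    α + β ∈ invariantCochains ΦA p := by
  refine ⟨fun X => ?_, fun k => ?_⟩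
  · conv_rhs => rw [← h.1 X, ← h'.1 X]
    ext; simp [cochainPullback]
  · conv_rhs => rw [← h.2 k, ← h'.2 k]
    ext; simp [cochainPullback]

lemma invariantScalarCochains_smul {p : ℕ} {γ : 𝔩 [⋀^Fin p]→ₗ[ℝ] ℝ} (c : ℝ)
    (h : γ ∈ invariantScalarCochains Φ p) : c • γ ∈ invariantScalarCochains Φ p := by
  refine ⟨fun X => ?_, fun k => ?_⟩
  · conv_rhs => rw [← h.1 X]
    ext; simp [cochainPullback]
  · conv_rhs => rw [← h.2 k]
    ext; simp [cochainPullback]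

lemma invariantScalarCochains_add {p : ℕ} {γ δ : 𝔩 [⋀^Fin p]→ₗ[ℝ] ℝ}
    (h : γ ∈ invariantScalarCochains Φ p) (h' : δ ∈ invariantScalarCochains Φ p) :
    γ + δ ∈ invariantScalarCochains Φ p := by
  refine ⟨fun X => ?_, fun k => ?_⟩
  · conv_rhs => rw [← h.1 X, ← h'.1 X]
    ext; simp [cochainPullback]
  · conv_rhs => rw [← h.2 k, ← h'.2 k]
    ext; simp [cochainPullback]

lemma IsTranslate_iff {ΦA : OrthogonalModule Φ 𝔞} {z z' : QuadraticCocycle ΦA}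
    {c : QuadraticCochain ΦA} : z.IsTranslate c z' ↔
      (∀ x y, z'.α ![x, y] = z.α ![x, y] +
        (⁅x, c.τ ![y]⁆ - ⁅y, c.τ ![x]⁆ - c.τ ![⁅x, y⁆])) ∧
      ∀ x y w, z'.γ ![x, y, w] = z.γ ![x, y, w] +
        (-c.σ ![⁅x, y⁆, w] + c.σ ![⁅x, w⁆, y] - c.σ ![⁅y, w⁆, x]) +
        (ΦA.form (z.α ![x, y] + (1 / 2 : ℝ) • (⁅x, c.τ ![y]⁆ - ⁅y, c.τ ![x]⁆ - c.τ ![⁅x, y⁆]))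
            (c.τ ![w])
          - ΦA.form (z.α ![x, w] + (1 / 2 : ℝ) • (⁅x, c.τ ![w]⁆ - ⁅w, c.τ ![x]⁆ - c.τ ![⁅x, w⁆]))
            (c.τ ![y])
          + ΦA.form (z.α ![y, w] + (1 / 2 : ℝ) • (⁅y, c.τ ![w]⁆ - ⁅w, c.τ ![y]⁆ - c.τ ![⁅y, w⁆]))
            (c.τ ![x])) := by
  have e2 : ∀ v : Fin 2 → 𝔩, v = ![v 0, v 1] := by intro v; ext i; fin_cases i <;> rfl
  have e3 : ∀ v : Fin 3 → 𝔩, v = ![v 0, v 1, v 2] := by intro v; ext i; fin_cases i <;> rfl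
  have ha : ∀ x y, (⇑z.α + (1 / 2 : ℝ) • dRep c.τ) ![x, y] =
      -(⇑z.α + (1 / 2 : ℝ) • dRep c.τ) ![y, x] := by
    intro x y
    simp only [Pi.add_apply, Pi.smul_apply]
    rw [alternating_two_antisymm, dRep_one_antisymm, smul_neg, neg_add]
  refine and_congr ⟨fun h x y => ?_, fun h => ?_⟩ ⟨fun h x y w => ?_, fun h => ?_⟩
  · have := congrFun h ![x, y]
    rw [Pi.add_apply, dRep_one] at this
    exact this
  · funext v
    rw [e2 v, Pi.add_apply, dRep_one, h]
    rfl
  · have := congrFun h ![x, y, w]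
    rw [Pi.add_apply, Pi.add_apply, dTriv_two, wedgeForm_two_one _ _ ha] at this
    simp only [Pi.add_apply, Pi.smul_apply] at this
    rw [dRep_one, dRep_one, dRep_one] at this
    exact this
  · funext v
    rw [e3 v, Pi.add_apply, Pi.add_apply, dTriv_two, wedgeForm_two_one _ _ ha]
    simp only [Pi.add_apply, Pi.smul_apply]
    rw [dRep_one, dRep_one, dRep_one, h]
    rfl

/-- `z₂` lies in the orbit of `z₁` under the action of the quadratic `1`-cochains. -/
def quadraticCohomologous (ΦA : OrthogonalModule Φ 𝔞) : Setoid (QuadraticCocycle ΦA) where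
  r z z' := ∃ c : QuadraticCochain ΦA, z.IsTranslate c z'
  iseqv :=
    { refl := fun z => by
        refine ⟨⟨0, 0, invariantCochains_zero ΦA 1, ?_⟩, ?_⟩
        · exact ⟨fun _ => by ext; simp [cochainPullback], fun _ => by ext; simp [cochainPullback]⟩
        · rw [IsTranslate_iff]
          simp
      symm := by
        rintro z z' ⟨c, hc⟩
        refine ⟨⟨-c.τ, (-1 : ℝ) • c.σ, invariantCochains_neg c.τ_mem,
          invariantScalarCochains_smul _ c.σ_mem⟩, ?_⟩
        rw [IsTranslate_iff] at hc ⊢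
        refine ⟨fun x y => ?_, fun x y w => ?_⟩
        · rw [hc.1]
          simp only [AlternatingMap.neg_apply, lie_neg]
          abel
        · rw [hc.2, hc.1, hc.1, hc.1]
          simp only [AlternatingMap.neg_apply, AlternatingMap.smul_apply, lie_neg, map_add, map_sub,
            map_neg, map_smul, LinearMap.add_apply, LinearMap.sub_apply, LinearMap.neg_apply,
            LinearMap.smul_apply, smul_eq_mul]
          ring
      trans := by
        rintro z z' z'' ⟨c, hc⟩ ⟨c', hc'⟩
        refine ⟨⟨c.τ + c'.τ, c.σ + c'.σ + (1 / 2 : ℝ) • wedgeOneOne ΦA.form c.τ c'.τ,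
          invariantCochains_add c.τ_mem c'.τ_mem,
          invariantScalarCochains_add (invariantScalarCochains_add c.σ_mem c'.σ_mem)
            (invariantScalarCochains_smul _ (wedgeOneOne_mem ΦA _ _ c.τ_mem c'.τ_mem))⟩, ?_⟩
        rw [IsTranslate_iff] at hc hc' ⊢
        refine ⟨fun x y => ?_, fun x y w => ?_⟩
        · rw [hc'.1, hc.1]
          simp only [AlternatingMap.add_apply, lie_add]
          abel
        · rw [hc'.2, hc.2, hc.1, hc.1, hc.1]
          have sk := ΦA.rep_skew
          have sy : ∀ A B, ΦA.form A B = ΦA.form B A := fun A B => ΦA.symm.eq A B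
          have h : ∀ a b d, ΦA.form ⁅a, c'.τ ![b]⁆ (c.τ ![d]) =
              -ΦA.form ⁅a, c.τ ![d]⁆ (c'.τ ![b]) := fun a b d => by rw [sk, sy]
          have h' : ∀ a b, ΦA.form (c'.τ ![a]) (c.τ ![b]) = ΦA.form (c.τ ![b]) (c'.τ ![a]) :=
            fun a b => sy _ _
          simp only [AlternatingMap.add_apply, AlternatingMap.smul_apply, lie_add, map_add, map_sub,
            map_smul, LinearMap.add_apply, LinearMap.sub_apply,
            LinearMap.smul_apply, smul_eq_mul, wedgeOneOne_apply, Matrix.cons_val_zero,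
            Matrix.cons_val_one, h, h']
          ring }

/-- The quadratic cohomology set `H²_Q(𝔩, Φ_𝔩, 𝔞)`: the orbit space of the quadratic `2`-cocycles
under the quadratic `1`-cochains. -/
def QuadraticCohomology (ΦA : OrthogonalModule Φ 𝔞) : Type _ := Quotient (quadraticCohomologous ΦA)

/-- The class `[α, γ]` of a quadratic cocycle. -/
def QuadraticCocycle.cls {ΦA : OrthogonalModule Φ 𝔞} (z : QuadraticCocycle ΦA) :
    QuadraticCohomology ΦA := Quotient.mk (quadraticCohomologous ΦA) z

/-! ### Balanced classes -/

namespace QuadraticCocycle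

variable {ΦA : OrthogonalModule Φ 𝔞} (z : QuadraticCocycle ΦA)

/-- Condition `(A_0)`. -/
def CondA0 : Prop :=
  ∀ L₀ : 𝔩, L₀ ∈ LieAlgebra.center ℝ 𝔩 → L₀ ∈ LieModule.ker ℝ 𝔩 𝔞 →
    (∃ (A₀ : 𝔞) (Z₀ : Module.Dual ℝ 𝔩),
      (∀ L : 𝔩, z.α ![L, L₀] = ⁅L, A₀⁆) ∧
      (∀ L L' : 𝔩, z.γ ![L, L₀, L'] = -ΦA.form A₀ (z.α ![L, L']) + Z₀ ⁅L, L'⁆)) →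
    L₀ = 0

/-- Condition `(B_0)`: with respect to the decomposition `𝔞 = 𝔞^𝔩 ⊕ ρ(𝔩)𝔞` write `α = α₀ + α₁`; then
the image under `α₀ : ⋀² 𝔩 → 𝔞^𝔩` of the kernel of the bracket `⋀² 𝔩 → 𝔩` is non-degenerate. -/
def CondB0 : Prop :=
  ∃ α₀ α₁ : 𝔩 [⋀^Fin 2]→ₗ[ℝ] 𝔞,
    z.α = α₀ + α₁ ∧
    (∀ v, α₀ v ∈ LieModule.maxTrivSubmodule ℝ 𝔩 𝔞) ∧
    (∀ v, α₁ v ∈ ⁅(⊤ : LieIdeal ℝ 𝔩), (⊤ : LieSubmodule ℝ 𝔩 𝔞)⁆) ∧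
    (ΦA.form.restrict
      ((LinearMap.ker (exteriorPower.alternatingMapLinearEquiv
        (alternatingOfBilin (lieBracketBilin 𝔩) lie_self))).map
          (exteriorPower.alternatingMapLinearEquiv α₀))).Nondegenerate

/-- Condition `(A_k)`, `k ≥ 1`. -/
def CondA (k : ℕ) : Prop :=
  ∀ 𝔨 : LieIdeal ℝ 𝔩, 𝔨 ≤ lieSocle 𝔩 ⊓ radicalChain 𝔩 k →
    (∃ (Φ₁ : 𝔨 →ₗ[ℝ] 𝔞) (Φ₂ : 𝔨 →ₗ[ℝ] Module.Dual ℝ (radicalChain 𝔩 k)),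
      (∀ (L : 𝔩) (X : 𝔨), z.α ![L, X] = ⁅L, Φ₁ X⁆ - Φ₁ ⁅L, X⁆) ∧
      (∀ (L : 𝔩) (X : 𝔨) (Y : radicalChain 𝔩 k),
        z.γ ![L, X, Y] = -ΦA.form (Φ₁ X) (z.α ![L, Y]) + Φ₂ X ⁅L, Y⁆ + Φ₂ ⁅L, X⁆ Y)) →
    𝔨 = ⊥

/-- Condition `(B_k)`, `k ≥ 1`: the greatest submodule `𝔟_k ⊆ 𝔞` for which the given system of
equations has a solution is non-degenerate. -/
def CondB (k : ℕ) : Prop :=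
  ∃ 𝔟 : LieSubmodule ℝ 𝔩 𝔞,
    IsGreatest {𝔟 : LieSubmodule ℝ 𝔩 𝔞 | ∃ Ψ : radicalChain 𝔩 k →ₗ[ℝ] 𝔞,
      ∀ (L : 𝔩) (X : radicalChain 𝔩 k), ∀ B ∈ 𝔟,
        ΦA.form (z.α ![L, X]) B = ΦA.form (⁅L, Ψ X⁆ - Ψ ⁅L, X⁆) B} 𝔟 ∧
    (ΦA.form.restrict 𝔟.toSubmodule).Nondegenerate

/-- A quadratic cocycle `(α, γ)` is balanced if it satisfies `(A_k)` and `(B_k)` for `0 ≤ k ≤ m`,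
where `m` is such that `R_{m+1}(𝔩) = 0`. -/
def IsBalanced : Prop :=
  z.CondA0 ∧ z.CondB0 ∧
    ∃ m, radicalChain 𝔩 (m + 1) = ⊥ ∧ ∀ k, 1 ≤ k → k ≤ m → z.CondA k ∧ z.CondB k

end QuadraticCocycle

/-- The set `H²_Q(𝔩, Φ_𝔩, 𝔞)_b` of balanced classes; it is empty if `ρ` is not semisimple. -/
def balancedClasses (ΦA : OrthogonalModule Φ 𝔞) : Set (QuadraticCohomology ΦA) :=
  {c | IsSemisimpleLieModule 𝔩 𝔞 ∧ ∃ z : QuadraticCocycle ΦA, z.IsBalanced ∧ z.cls = c}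

/-! ### The cocycle of a quadratic extension with a section -/

namespace QuadraticExtension

variable {ΦA : OrthogonalModule Φ 𝔞}

/-- `s : 𝔩 → 𝔤` is an `(𝔥, K)`-equivariant section with isotropic image of the map `𝔤 → 𝔩` induced
by `p`. -/
structure IsIsotropicSection (E : QuadraticExtension ΦA) (s : 𝔩 →ₗ[ℝ] E.carrier) : Prop where
  proj : ∀ L, E.proj (E.quot (s L)) = L
  alg : ∀ X L, s (Φ.alg X L) = E.metric.alg X (s L)
  grp : ∀ k L, s (Φ.grp k L) = E.metric.grp k (s L)
  isotropic : ∀ L₁ L₂, E.metric.form (s L₁) (s L₂) = 0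

/-- `(α, γ)` is given by `i(α(L₁, L₂)) = [s L₁, s L₂] - s [L₁, L₂] + 𝔦` and
`γ(L₁, L₂, L₃) = ⟨[s L₁, s L₂], s L₃⟩`. -/
def IsCocycleOf (E : QuadraticExtension ΦA) (s : 𝔩 →ₗ[ℝ] E.carrier) (z : QuadraticCocycle ΦA) :
    Prop :=
  (∀ L₁ L₂, E.incl (z.α ![L₁, L₂]) = E.quot (⁅s L₁, s L₂⁆ - s ⁅L₁, L₂⁆)) ∧
  ∀ L₁ L₂ L₃, z.γ ![L₁, L₂, L₃] = E.metric.form ⁅s L₁, s L₂⁆ (s L₃)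

end QuadraticExtension

end Cohomology

end

noncomputable section

set_option linter.unusedSectionVars false

/-! Bijection. In a quadratic extension the metric identifies 𝔦 with 𝔩^*, and 𝔦^⊥/𝔦 is 𝔞.
Semisimplicity of the (𝔥, K)-action gives an equivariant section 𝔩 → 𝔤; subtracting half of its Gram
form, read as a map into 𝔦 ≅ 𝔩^*, makes it isotropic (`exists_isIsotropicSection`). In the resulting
coordinates 𝔩^* ⊕ 𝔞 ⊕ 𝔩 the metric is standard and the bracket is determined by ρ, α and γ. The
Jacobi identity and invariance amount to dα = 0 and dγ = ½⟨α ∧ α⟩. Hence every extension is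
equivalent to the `StandardModel` of its cocycle, and every cocycle has a model. The components of
one isotropic section relative to another form a quadratic cochain (τ, σ), whose action relates the
two cocycles (`IsCocycleOf.isTranslate`), and every (τ, σ) occurs for some section of a model
(`equivalence_extension_of_isTranslate`).

Balanced classes. It remains to decide when the canonical isotropic ideal of a standard model equals
𝔩^* (`canonicalIdeal_eq_iff`). Put S_k = R_k^⊥. This is an ascending chain, and S_{k+1} is the
largest ideal that is semisimple over S_k. The canonical ideal is the sum of the R_k ∩ S_k with k ≥
1, and an identity in modular lattices (`iInf_sup_eq_iSup_inf_succ`) shows that its orthogonal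
complement is the sum of the R_k ∩ S_{k+1} with k ≥ 0. Since (𝔩^*)^⊥ = 𝔩^* ⊕ 𝔞, equality with 𝔩^*
means R_k ∩ S_k ⊆ 𝔩^* for k ≥ 1 and R_k ∩ S_{k+1} ⊆ 𝔩^* ⊕ 𝔞 for k ≥ 0.

The conditions (A_k) and (B_k) encode these inclusions. A solution of the equations in (A_k)
describes an ideal of 𝔤 lying over 𝔨 and contained in S_{k+1}; a solution of those in (B_k)
describes an ideal in (𝔩^* ⊕ 𝔞) ∩ S_{k+1}, and 𝔟_k is the 𝔞-part of the whole intersection. (A_0)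
and (B_0) concern the centre of 𝔤. That these subspaces are ideals rests on the fact that R_1 acts
trivially on semisimple modules (`lie_eq_zero_of_mem_radicalChain_one`), which follows from Cartan's
criterion for trace forms. -/

/-! ### Complemented intervals of modular lattices -/

/-- The interval `[a, b]` is non-empty and complemented. For submodules `a ≤ b` this says that
`b / a` is semisimple. -/
def ComplementedIcc {α : Type*} [Lattice α] (a b : α) : Prop :=
  a ≤ b ∧ ∀ c, a ≤ c → c ≤ b → ∃ d, a ≤ d ∧ d ≤ b ∧ c ⊓ d = a ∧ c ⊔ d = b

namespace ComplementedIcc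

section ModularLattice

variable {α : Type*} [Lattice α] [IsModularLattice α] {a b c d x y : α}

lemma refl (a : α) : ComplementedIcc a a :=
  ⟨le_rfl, fun c h h' => ⟨a, le_rfl, le_rfl, by simp [h], by simp [h']⟩⟩

/-- Subquotients of semisimple modules are semisimple: a complement of `e` in the large interval is
pushed into the small one by joining with `c` and meeting with `d`. -/
lemma mono (h : ComplementedIcc a b) (hac : a ≤ c) (hcd : c ≤ d) (hdb : d ≤ b) :
    ComplementedIcc c d := by
  refine ⟨hcd, fun e hce hed => ?_⟩
  obtain ⟨f, haf, hfb, h1, h2⟩ := h.2 e (hac.trans hce) (hed.trans hdb)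
  refine ⟨(f ⊔ c) ⊓ d, le_inf le_sup_right hcd, inf_le_right, ?_, ?_⟩
  · rw [inf_comm (f ⊔ c), ← inf_assoc, inf_eq_left.2 hed, sup_comm, inf_comm,
      sup_inf_assoc_of_le f hce, inf_comm f, h1, sup_eq_left]
    exact hac
  · rw [← sup_inf_assoc_of_le _ hed, ← sup_assoc, h2, sup_eq_left.2 (hcd.trans hdb),
      inf_eq_right.2 hdb]

/-- One half of the isomorphism x / (x ∩ y) ≅ (x + y) / y; `inf_of_sup_right` is the other. -/
lemma sup_right_of_inf (h : ComplementedIcc (x ⊓ y) x) : ComplementedIcc y (x ⊔ y) := by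
  refine ⟨le_sup_right, fun e hye hex => ?_⟩
  obtain ⟨f, hf, hfx, h1, h2⟩ := h.2 (e ⊓ x) (by rw [inf_comm]; exact inf_le_inf_right x hye)
    inf_le_right
  refine ⟨f ⊔ y, le_sup_right, sup_le_sup_right hfx y, ?_, ?_⟩
  · rw [sup_comm, inf_comm, sup_inf_assoc_of_le f hye, sup_eq_left]
    calc f ⊓ e ≤ e ⊓ x ⊓ f := le_inf (le_inf inf_le_right (inf_le_left.trans hfx)) inf_le_left
      _ = x ⊓ y := h1
      _ ≤ y := inf_le_right
  · apply le_antisymm (sup_le hex (sup_le_sup_right hfx y))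
    refine sup_le ?_ (le_sup_of_le_right le_sup_right)
    rw [← h2]
    exact sup_le (inf_le_left.trans le_sup_left) (le_sup_of_le_right le_sup_left)

lemma inf_of_sup_right (h : ComplementedIcc y (x ⊔ y)) : ComplementedIcc (x ⊓ y) x := by
  refine ⟨inf_le_left, fun e hye hex => ?_⟩
  obtain ⟨f, hf, hfx, h1, h2⟩ := h.2 (e ⊔ y) le_sup_right (sup_le_sup_right hex y)
  refine ⟨f ⊓ x, le_inf (inf_le_right.trans hf) inf_le_left, inf_le_right, ?_, ?_⟩
  · apply le_antisymm
    · refine le_inf (inf_le_left.trans hex) ?_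
      rw [← h1]
      exact le_inf (inf_le_left.trans le_sup_left) (inf_le_right.trans inf_le_left)
    · exact le_inf hye (le_inf (inf_le_right.trans hf) inf_le_left)
  · rw [← sup_inf_assoc_of_le f hex]
    apply le_antisymm inf_le_right
    refine le_inf ?_ le_rfl
    calc x ≤ e ⊔ y ⊔ f := h2 ▸ le_sup_left
      _ ≤ e ⊔ f := sup_le (sup_le le_sup_left (hf.trans le_sup_right)) le_sup_right

lemma sup_right_of_le (h : ComplementedIcc a x) (hay : a ≤ y) : ComplementedIcc y (x ⊔ y) :=
  (h.mono (le_inf h.1 hay) inf_le_left le_rfl).sup_right_of_inf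

/-- Complements are found in two stages: `b'` complements the part of `x` in `b`, then `c'`
complements the part of `x ⊔ b'` in `c`, and `b' ⊔ c'` complements `x`. -/
lemma sup (hb : ComplementedIcc a b) (hc : ComplementedIcc a c) : ComplementedIcc a (b ⊔ c) := by
  refine ⟨hb.1.trans le_sup_left, fun x hax hx => ?_⟩
  obtain ⟨b', hab', hb', h1, h2⟩ := hb.2 (x ⊓ b) (le_inf hax hb.1) inf_le_right
  obtain ⟨c', hac', hc', h3, h4⟩ := hc.2 ((x ⊔ b') ⊓ c) (le_inf (hax.trans le_sup_left) hc.1)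
    inf_le_right
  refine ⟨b' ⊔ c', hab'.trans le_sup_left, sup_le_sup hb' hc', ?_, ?_⟩
  · apply le_antisymm _ (le_inf hax (hab'.trans le_sup_left))
    have key : (b' ⊔ c') ⊓ (x ⊔ b') ≤ b' := by
      rw [sup_inf_assoc_of_le c' (le_sup_right : b' ≤ x ⊔ b')]
      refine sup_le le_rfl (le_trans ?_ hab')
      rw [← h3]
      exact le_inf (le_inf inf_le_right (inf_le_left.trans hc')) inf_le_left
    have h5 : x ⊓ (b' ⊔ c') ≤ b' :=
      le_trans (le_inf inf_le_right (inf_le_left.trans le_sup_left)) key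
    rw [← h1]
    exact le_inf (le_inf inf_le_left (h5.trans hb')) h5
  · apply le_antisymm (sup_le hx (sup_le_sup hb' hc'))
    refine sup_le ?_ ?_
    · rw [← h2]
      exact sup_le (inf_le_left.trans le_sup_left) (le_sup_of_le_right le_sup_left)
    · rw [← h4]
      exact sup_le (inf_le_left.trans (sup_le le_sup_left (le_sup_of_le_right le_sup_left)))
        (le_sup_of_le_right le_sup_right)

lemma toDual (h : ComplementedIcc a b) :
    ComplementedIcc (OrderDual.toDual b) (OrderDual.toDual a) := by
  refine ⟨h.1, fun c hbc hca => ?_⟩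
  obtain ⟨d, h1, h2, h3, h4⟩ := h.2 (OrderDual.ofDual c) hca hbc
  exact ⟨OrderDual.toDual d, h2, h1, h4, h3⟩

lemma ofDual {a b : α} (h : ComplementedIcc (OrderDual.toDual b) (OrderDual.toDual a)) :
    ComplementedIcc a b := by
  refine ⟨h.1, fun c hac hcb => ?_⟩
  obtain ⟨d, h1, h2, h3, h4⟩ := h.2 (OrderDual.toDual c) hcb hac
  exact ⟨OrderDual.ofDual d, h2, h1, h4, h3⟩

lemma inf (ha : ComplementedIcc a c) (hb : ComplementedIcc b c) : ComplementedIcc (a ⊓ b) c :=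
  (ha.toDual.sup hb.toDual).ofDual

/-- A greatest `b` such that `b / a` is semisimple. -/
lemma exists_isGreatest [WellFoundedGT α] (a : α) :
    ∃ b, IsGreatest {b | ComplementedIcc a b} b := by
  obtain ⟨m, hm, hmax⟩ := WellFounded.has_min (wellFounded_gt (α := α))
    {b | ComplementedIcc a b} ⟨a, refl a⟩
  refine ⟨m, hm, fun b hb => ?_⟩
  have h := hmax _ (sup hm hb)
  rw [not_lt_iff_le_imp_ge] at h
  exact le_sup_right.trans (h le_sup_left)

/-- A least `a` such that `b / a` is semisimple. -/
lemma exists_isLeast [WellFoundedLT α] (b : α) : ∃ a, IsLeast {a | ComplementedIcc a b} a := by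
  obtain ⟨m, hm, hmin⟩ := WellFounded.has_min (wellFounded_lt (α := α))
    {a | ComplementedIcc a b} ⟨b, refl b⟩
  refine ⟨m, hm, fun a ha => ?_⟩
  have h := hmin _ (inf hm ha)
  rw [not_lt_iff_le_imp_ge] at h
  exact (h inf_le_left).trans inf_le_right

lemma _root_.complementedLattice_iff_complementedIcc [BoundedOrder α] :
    ComplementedLattice α ↔ ComplementedIcc (⊥ : α) ⊤ := by
  refine ⟨fun h => ⟨bot_le, fun c _ _ => ?_⟩, fun h => ⟨fun c => ?_⟩⟩
  · obtain ⟨d, hd⟩ := h.exists_isCompl c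
    exact ⟨d, bot_le, le_top, hd.inf_eq_bot, hd.sup_eq_top⟩
  · obtain ⟨d, -, -, h1, h2⟩ := h.2 c bot_le le_top
    exact ⟨d, disjoint_iff.2 h1, codisjoint_iff.2 h2⟩

end ModularLattice

/-- Only an order embedding that fills the target interval is needed: meets and joins of elements of
the interval are then preserved automatically. This serves for maps of submodules, preimages and
orthogonal complements alike. -/
lemma map_iff {α β : Type*} [Lattice α] [Lattice β] (f : α → β) (hf : ∀ x y, f x ≤ f y ↔ x ≤ y)
    {a b : α} (hsurj : ∀ y, f a ≤ y → y ≤ f b → ∃ x, f x = y) :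
    ComplementedIcc (f a) (f b) ↔ ComplementedIcc a b := by
  have hmem : ∀ {x}, a ≤ x → x ≤ b → f a ≤ f x ∧ f x ≤ f b :=
    fun h h' => ⟨(hf _ _).2 h, (hf _ _).2 h'⟩
  have hinf : ∀ {x y}, a ≤ x → x ≤ b → a ≤ y → y ≤ b → f (x ⊓ y) = f x ⊓ f y := by
    intro x y hx hx' hy hy'
    apply le_antisymm (le_inf ((hf _ _).2 inf_le_left) ((hf _ _).2 inf_le_right))
    obtain ⟨z, hz⟩ := hsurj (f x ⊓ f y) (le_inf (hmem hx hx').1 (hmem hy hy').1)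
      (inf_le_left.trans (hmem hx hx').2)
    rw [← hz, hf]
    exact le_inf ((hf _ _).1 (hz.le.trans inf_le_left)) ((hf _ _).1 (hz.le.trans inf_le_right))
  have hsup : ∀ {x y}, a ≤ x → x ≤ b → a ≤ y → y ≤ b → f (x ⊔ y) = f x ⊔ f y := by
    intro x y hx hx' hy hy'
    refine le_antisymm ?_ (sup_le ((hf _ _).2 le_sup_left) ((hf _ _).2 le_sup_right))
    obtain ⟨z, hz⟩ := hsurj (f x ⊔ f y) ((hmem hx hx').1.trans le_sup_left)
      (sup_le (hmem hx hx').2 (hmem hy hy').2)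
    rw [← hz, hf]
    exact sup_le ((hf _ _).1 (le_sup_left.trans hz.ge)) ((hf _ _).1 (le_sup_right.trans hz.ge))
  have hinj : Function.Injective f := fun x y h =>
    le_antisymm ((hf _ _).1 h.le) ((hf _ _).1 h.ge)
  constructor
  · refine fun h => ⟨(hf _ _).1 h.1, fun c hac hcb => ?_⟩
    obtain ⟨d, h1, h2, h3, h4⟩ := h.2 (f c) ((hf _ _).2 hac) ((hf _ _).2 hcb)
    obtain ⟨d, rfl⟩ := hsurj d h1 h2
    rw [hf] at h1 h2
    rw [← hinf hac hcb h1 h2] at h3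
    rw [← hsup hac hcb h1 h2] at h4
    exact ⟨d, h1, h2, hinj h3, hinj h4⟩
  · refine fun h => ⟨(hf _ _).2 h.1, fun c hac hcb => ?_⟩
    obtain ⟨c, rfl⟩ := hsurj c hac hcb
    rw [hf] at hac hcb
    obtain ⟨d, h1, h2, h3, h4⟩ := h.2 c hac hcb
    exact ⟨f d, (hf _ _).2 h1, (hf _ _).2 h2, by rw [← hinf hac hcb h1 h2, h3],
      by rw [← hsup hac hcb h1 h2, h4]⟩

end ComplementedIcc

/-! ### Two opposite chains in a modular lattice -/

section Chains

variable {α : Type*} [CompleteLattice α] [IsModularLattice α] {R S : ℕ → α}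

/-- For a descending chain `R` and an ascending chain `S`, the infimum of the `R k ⊔ S k` is the
supremum of the `R k ⊓ S (k + 1)`. -/
lemma iInf_sup_eq_iSup_inf_succ (hR : Antitone R) (hS : Monotone S) (hR0 : R 0 = ⊤)
    (hRN : ∃ N, R N = ⊥) : ⨅ k, (R k ⊔ S k) = ⨆ k, (R k ⊓ S (k + 1)) := by
  apply le_antisymm
  -- Peeling off one term at a time by the modular law: the terms found so far lie in `S (n + 1)`,
  -- and the remainder `R n` contributes `R n ⊓ S (n + 1)` and the next remainder. The remainder
  -- vanishes at `N`.
  · have key : ∀ n, ⨅ k, (R k ⊔ S k) ≤ (⨆ k : ℕ, ⨆ _ : k < n, R k ⊓ S (k + 1)) ⊔ R n := by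
      intro n
      induction n with
      | zero => simp [hR0]
      | succ n ih =>
        have h1 : (⨆ k : ℕ, ⨆ _ : k < n, R k ⊓ S (k + 1)) ≤ R (n + 1) ⊔ S (n + 1) :=
          iSup₂_le fun k hk => inf_le_right.trans ((hS (by omega)).trans le_sup_right)
        calc ⨅ k, (R k ⊔ S k)
            ≤ ((⨆ k : ℕ, ⨆ _ : k < n, R k ⊓ S (k + 1)) ⊔ R n) ⊓ (R (n + 1) ⊔ S (n + 1)) :=
              le_inf ih (iInf_le _ _)
          _ = (⨆ k : ℕ, ⨆ _ : k < n, R k ⊓ S (k + 1)) ⊔ (R n ⊓ (R (n + 1) ⊔ S (n + 1))) :=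
              sup_inf_assoc_of_le _ h1
          _ = (⨆ k : ℕ, ⨆ _ : k < n, R k ⊓ S (k + 1)) ⊔ (R (n + 1) ⊔ (S (n + 1) ⊓ R n)) := by
              rw [inf_comm, sup_inf_assoc_of_le _ (hR (Nat.le_succ n))]
          _ ≤ _ := by
              refine sup_le ?_ (sup_le le_sup_right ?_)
              · exact le_sup_of_le_left (iSup₂_le fun k hk =>
                  le_iSup₂_of_le k (by omega) le_rfl)
              · rw [inf_comm]
                exact le_sup_of_le_left (le_iSup₂_of_le n (by omega) le_rfl)
    obtain ⟨N, hN⟩ := hRN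
    refine (key N).trans ?_
    rw [hN, sup_bot_eq]
    exact iSup₂_le fun k _ => le_iSup (fun k => R k ⊓ S (k + 1)) k
  · refine iSup_le fun k => le_iInf fun l => ?_
    rcases le_or_gt l k with h | h
    · exact inf_le_left.trans ((hR h).trans le_sup_left)
    · exact inf_le_right.trans ((hS h).trans le_sup_right)

/-- Each summand lies in `R k` if its index is at least `k`, and in `S k` otherwise. -/
lemma iSup_inf_succ_le_sup (hR : Antitone R) (hS : Monotone S) (k : ℕ) :
    ⨆ n, (R n ⊓ S (n + 1)) ≤ R k ⊔ ((⨆ n, (R n ⊓ S (n + 1))) ⊓ S k) := by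
  refine iSup_le fun n => ?_
  rcases le_or_gt k n with h | h
  · exact inf_le_left.trans ((hR h).trans le_sup_left)
  · exact le_sup_of_le_right (le_inf (le_iSup (fun n => R n ⊓ S (n + 1)) n)
      (inf_le_right.trans (hS h)))

lemma iSup_inf_le_sup (hR : Antitone R) (hS : Monotone S) (k : ℕ) :
    ⨆ n, (R (n + 1) ⊓ S (n + 1)) ≤ R k ⊔ ((⨆ n, (R (n + 1) ⊓ S (n + 1))) ⊓ S k) := by
  refine iSup_le fun n => ?_
  rcases le_or_gt k (n + 1) with h | h
  · exact inf_le_left.trans ((hR h).trans le_sup_left)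
  · exact le_sup_of_le_right (le_inf (le_iSup (fun n => R (n + 1) ⊓ S (n + 1)) n)
      (inf_le_right.trans (hS h.le)))

end Chains

/-! ### Semisimple subquotients of Lie modules -/

section LieModules

variable {L M : Type*} [LieRing L] [LieAlgebra ℝ L] [AddCommGroup M] [Module ℝ M]
  [LieRingModule L M] [LieModule ℝ L M]

lemma isSemisimpleLieModule_iff :
    IsSemisimpleLieModule L M ↔ ComplementedIcc (⊥ : LieSubmodule ℝ L M) ⊤ :=
  complementedLattice_iff_complementedIcc

lemma isSemisimpleLieModule_coe_iff (N : LieSubmodule ℝ L M) :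
    IsSemisimpleLieModule L N ↔ ComplementedIcc ⊥ N := by
  rw [isSemisimpleLieModule_iff,
    ← ComplementedIcc.map_iff (fun X : LieSubmodule ℝ L N => X.map N.incl)]
  · simp
  · intro x y
    refine ⟨fun h v hv => ?_, fun h => LieSubmodule.map_mono h⟩
    obtain ⟨w, hw, hwv⟩ := h (LieSubmodule.mem_map_of_mem (f := N.incl) hv)
    rwa [← N.injective_incl hwv]
  · intro y _ hy
    refine ⟨y.comap N.incl, ?_⟩
    simpa using hy

/-- The correspondence theorem for submodules of a quotient. It turns the definition of the chain
R_k into a statement about intervals of ideals. -/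
lemma isSemisimpleLieModule_quotient_iff {I N : LieSubmodule ℝ L M} (hI : I ≤ N) :
    IsSemisimpleLieModule L (N ⧸ LieSubmodule.comap N.incl I) ↔ ComplementedIcc I N := by
  let q := LieSubmodule.Quotient.mk' (LieSubmodule.comap N.incl I)
  have hqs : Function.Surjective q := LieSubmodule.Quotient.surjective_mk' _
  have hq0 : ∀ n : N, q n = 0 ↔ (n : M) ∈ I := fun n =>
    LieSubmodule.Quotient.mk_eq_zero (N := LieSubmodule.comap N.incl I)
  let f : LieSubmodule ℝ L (N ⧸ LieSubmodule.comap N.incl I) → LieSubmodule ℝ L M :=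
    fun X => (X.comap q).map N.incl
  have hmem : ∀ X (n : N), (n : M) ∈ f X ↔ q n ∈ X := by
    intro X n
    simp [f]
  have hle : ∀ X, f X ≤ N := by
    intro X v hv
    simp only [f, LieSubmodule.mem_map] at hv
    obtain ⟨n, -, rfl⟩ := hv
    exact n.2
  have hbot : f ⊥ = I := by
    ext v
    constructor
    · intro hv
      have := (hmem ⊥ ⟨v, hle _ hv⟩).1 hv
      rwa [LieSubmodule.mem_bot, hq0] at this
    · intro hv
      refine (hmem ⊥ ⟨v, hI hv⟩).2 ?_
      rwa [LieSubmodule.mem_bot, hq0]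
  have htop : f ⊤ = N := le_antisymm (hle _) fun v hv => (hmem ⊤ ⟨v, hv⟩).2 trivial
  rw [isSemisimpleLieModule_iff, ← ComplementedIcc.map_iff f, hbot, htop]
  · intro X Y
    constructor
    · intro h v hv
      obtain ⟨n, rfl⟩ := hqs v
      exact (hmem _ _).1 (h ((hmem _ _).2 hv))
    · intro h v hv
      exact (hmem Y ⟨v, hle _ hv⟩).2 (h ((hmem X ⟨v, hle _ hv⟩).1 hv))
  · intro Y hY hYN
    rw [hbot] at hY
    rw [htop] at hYN
    refine ⟨(Y.comap N.incl).map q, ?_⟩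
    ext v
    constructor
    · intro hv
      have h := (hmem _ ⟨v, hle _ hv⟩).1 hv
      obtain ⟨n, hn, hnv⟩ := LieSubmodule.mem_map _ |>.1 h
      rw [← sub_eq_zero, ← map_sub, hq0] at hnv
      have h1 : (n : M) - v ∈ Y := hY hnv
      have h2 : (n : M) ∈ Y := hn
      simpa using Y.sub_mem h2 h1
    · intro hv
      exact (hmem _ ⟨v, hYN hv⟩).2 (LieSubmodule.mem_map_of_mem (N := Y.comap N.incl)
        (show (⟨v, hYN hv⟩ : N) ∈ Y.comap N.incl from hv))

/-- Trivial modules are semisimple. -/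
lemma complementedIcc_bot_of_trivial (N : LieSubmodule ℝ L M)
    (hN : ∀ (x : L), ∀ m ∈ N, ⁅x, m⁆ = 0) : ComplementedIcc ⊥ N := by
  refine ⟨bot_le, fun c _ hc => ?_⟩
  obtain ⟨d, hd⟩ := Submodule.exists_isCompl (c.toSubmodule)
  refine ⟨⟨d ⊓ N.toSubmodule, fun {x m} hm => ?_⟩, bot_le, fun m hm => hm.2, ?_, ?_⟩
  · have h : ⁅x, m⁆ = 0 := hN x m hm.2
    rw [h]
    exact Submodule.zero_mem _
  · rw [eq_bot_iff]
    rintro m ⟨h1, h2⟩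
    exact hd.disjoint.le_bot ⟨h1, h2.1⟩
  · refine le_antisymm (sup_le hc fun m hm => hm.2) fun m hm => ?_
    have : m ∈ c.toSubmodule ⊔ d := by rw [hd.sup_eq_top]; trivial
    obtain ⟨y, hy, z, hz, rfl⟩ := Submodule.mem_sup.1 this
    rw [LieSubmodule.mem_sup]
    exact ⟨y, hy, z, ⟨hz, by simpa using N.sub_mem hm (hc hy)⟩, rfl⟩

end LieModules

/-! ### The chain R_k and the socle, and their behaviour under quotients. -/

section RadicalChain

variable {L : Type*} [LieRing L] [LieAlgebra ℝ L] [Module.Finite ℝ L]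

instance LieIdeal.wellFoundedLT_of_finite : WellFoundedLT (LieIdeal ℝ L) :=
  LieSubmodule.wellFoundedLT_of_isArtinian ℝ L L

/-- The infimum in the definition is attained, because semisimplicity of quotients is stable under
intersecting two ideals and descending chains of ideals stop. -/
lemma isLeast_radicalChain_succ (k : ℕ) :
    IsLeast {I | ComplementedIcc I (radicalChain L k)} (radicalChain L (k + 1)) := by
  obtain ⟨m, hm⟩ := ComplementedIcc.exists_isLeast (radicalChain L k)
  have h : {I : LieIdeal ℝ L | I ≤ radicalChain L k ∧ IsSemisimpleLieModule L
      (radicalChain L k ⧸ LieSubmodule.comap (LieSubmodule.incl (radicalChain L k)) I)} =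
      {I | ComplementedIcc I (radicalChain L k)} := by
    ext I
    exact ⟨fun h => (isSemisimpleLieModule_quotient_iff h.1).1 h.2,
      fun h => ⟨h.1, (isSemisimpleLieModule_quotient_iff h.1).2 h⟩⟩
  have : radicalChain L (k + 1) = m := by
    rw [radicalChain, h]
    exact le_antisymm (sInf_le hm.1) (le_sInf hm.2)
  rwa [this]

lemma complementedIcc_radicalChain (k : ℕ) :
    ComplementedIcc (radicalChain L (k + 1)) (radicalChain L k) :=
  (isLeast_radicalChain_succ k).1

lemma radicalChain_succ_le_of {k : ℕ} {I : LieIdeal ℝ L}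
    (h : ComplementedIcc I (radicalChain L k)) : radicalChain L (k + 1) ≤ I :=
  (isLeast_radicalChain_succ k).2 h

lemma radicalChain_antitone : Antitone (radicalChain L) :=
  antitone_nat_of_succ_le fun k => (complementedIcc_radicalChain k).1

lemma isGreatest_lieSocle : IsGreatest {I | ComplementedIcc ⊥ I} (lieSocle L) := by
  obtain ⟨m, hm⟩ := ComplementedIcc.exists_isGreatest (⊥ : LieIdeal ℝ L)
  have h : {I : LieIdeal ℝ L | IsSemisimpleLieModule L I} = {I | ComplementedIcc ⊥ I} := by
    ext I
    exact isSemisimpleLieModule_coe_iff I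
  have : lieSocle L = m := by
    rw [lieSocle, h]
    exact le_antisymm (sSup_le hm.2) (le_sSup hm.1)
  rwa [this]

/-- An ideal maximal among those strictly below R_k has simple, hence semisimple, quotient. -/
lemma radicalChain_succ_lt {k : ℕ} (h : radicalChain L k ≠ ⊥) :
    radicalChain L (k + 1) < radicalChain L k := by
  obtain ⟨m, hm, hmax⟩ := WellFounded.has_min (wellFounded_gt (α := LieIdeal ℝ L))
    {I | I < radicalChain L k} ⟨⊥, bot_lt_iff_ne_bot.2 h⟩
  refine lt_of_le_of_lt (radicalChain_succ_le_of (I := m) ⟨hm.le, fun c hmc hc => ?_⟩) hm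
  rcases hmc.eq_or_lt with rfl | hmc
  · exact ⟨radicalChain L k, hc, le_rfl, inf_eq_left.2 hc, sup_eq_right.2 hc⟩
  · have : c = radicalChain L k := by
      by_contra hne
      exact hmax c (lt_of_le_of_ne hc hne) hmc
    exact ⟨m, le_rfl, hm.le, inf_eq_right.2 hmc.le, by rw [this, sup_eq_left]; exact hm.le⟩

lemma exists_radicalChain_eq_bot (L : Type*) [LieRing L] [LieAlgebra ℝ L] [Module.Finite ℝ L] :
    ∃ n, radicalChain L n = ⊥ := by
  by_contra! h
  obtain ⟨m, ⟨k, rfl⟩, hmin⟩ := WellFounded.has_min (wellFounded_lt (α := LieIdeal ℝ L))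
    (Set.range (radicalChain L)) (Set.range_nonempty _)
  exact hmin _ ⟨k + 1, rfl⟩ (radicalChain_succ_lt (h k))

section Quotient

variable {G : Type*} [LieRing G] [LieAlgebra ℝ G]

lemma LieIdeal.comap_le_comap_iff (π : G →ₗ⁅ℝ⁆ L) (hπ : Function.Surjective π)
    (I J : LieIdeal ℝ L) :
    I.comap π ≤ J.comap π ↔ I ≤ J := by
  refine ⟨fun h x hx => ?_, fun h x hx => ?_⟩
  · obtain ⟨y, rfl⟩ := hπ x
    exact LieIdeal.mem_comap.1 (h (LieIdeal.mem_comap.2 hx))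
  · exact LieIdeal.mem_comap.2 (h (LieIdeal.mem_comap.1 hx))

lemma LieIdeal.exists_comap_eq (π : G →ₗ⁅ℝ⁆ L) (hπ : Function.Surjective π) {Y : LieIdeal ℝ G}
    (hY : π.ker ≤ Y) : ∃ X : LieIdeal ℝ L, X.comap π = Y := by
  refine ⟨Y.map π, ?_⟩
  ext y
  rw [LieIdeal.mem_comap]
  refine ⟨fun h => ?_, fun h => LieIdeal.mem_map h⟩
  obtain ⟨⟨z, hz⟩, h⟩ := LieIdeal.mem_map_of_surjective hπ h
  have h1 : y - z ∈ π.ker := by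
    rw [LieHom.mem_ker, map_sub, sub_eq_zero, h]
  simpa using Y.add_mem (hY h1) hz

lemma LieIdeal.comap_bot_eq_ker (π : G →ₗ⁅ℝ⁆ L) : (⊥ : LieIdeal ℝ L).comap π = π.ker := rfl

lemma complementedIcc_comap_iff (π : G →ₗ⁅ℝ⁆ L) (hπ : Function.Surjective π) {I J : LieIdeal ℝ L} :
    ComplementedIcc (I.comap π) (J.comap π) ↔ ComplementedIcc I J := by
  refine ComplementedIcc.map_iff (LieIdeal.comap π) (LieIdeal.comap_le_comap_iff π hπ)
    fun Y hY _ => LieIdeal.exists_comap_eq π hπ (le_trans ?_ hY)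
  rw [← LieIdeal.comap_bot_eq_ker]
  exact (LieIdeal.comap_le_comap_iff π hπ _ _).2 bot_le

/-- The radical chain of a quotient. -/
lemma comap_radicalChain [Module.Finite ℝ G]
    (π : G →ₗ⁅ℝ⁆ L) (hπ : Function.Surjective π) (k : ℕ) :
    (radicalChain L k).comap π = radicalChain G k ⊔ π.ker := by
  have hker : ∀ I : LieIdeal ℝ L, π.ker ≤ I.comap π := fun I => by
    rw [← LieIdeal.comap_bot_eq_ker]
    exact (LieIdeal.comap_le_comap_iff π hπ _ _).2 bot_le
  induction k with
  | zero =>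
    ext x
    simp [radicalChain]
  | succ k ih =>
    apply le_antisymm
    -- The image of R_{k+1}(G) has semisimple quotient in R_k(L), so it contains R_{k+1}(L).
    · obtain ⟨X, hX⟩ := LieIdeal.exists_comap_eq π hπ (Y := radicalChain G (k + 1) ⊔ π.ker)
        le_sup_right
      rw [← hX, LieIdeal.comap_le_comap_iff π hπ]
      apply radicalChain_succ_le_of
      rw [← complementedIcc_comap_iff π hπ, hX, ih]
      have h := (complementedIcc_radicalChain (L := G) k).sup_right_of_le
        (le_sup_left : _ ≤ radicalChain G (k + 1) ⊔ π.ker)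
      rwa [← sup_assoc, sup_eq_left.2 (radicalChain_antitone (Nat.le_succ k))] at h
    · refine sup_le ?_ (hker _)
      -- Conversely, R_k(G) is semisimple modulo its intersection with the preimage of R_{k+1}(L),
      -- so this intersection contains R_{k+1}(G).
      have h := (complementedIcc_comap_iff π hπ).2 (complementedIcc_radicalChain (L := L) k)
      rw [ih] at h
      have h1 : radicalChain G k ⊔ (radicalChain L (k + 1)).comap π = radicalChain G k ⊔ π.ker :=
        le_antisymm (sup_le le_sup_left h.1) (sup_le le_sup_left (le_sup_of_le_right (hker _)))
      rw [← h1] at h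
      exact (radicalChain_succ_le_of h.inf_of_sup_right).trans inf_le_right

end Quotient

end RadicalChain

/-! ### The ideal `R_1` acts trivially on semisimple modules -/

section TraceForm

open LieModule

lemma trace_aeval_X_mul_eq_zero {V : Type*} [AddCommGroup V] [Module ℝ V] (f : Module.End ℝ V)
    (hf : ∀ k, LinearMap.trace ℝ V (f ^ (k + 1)) = 0) (p : Polynomial ℝ) :
    LinearMap.trace ℝ V (Polynomial.aeval f (Polynomial.X * p)) = 0 := by
  induction p using Polynomial.induction_on' with
  | add p q hp hq => rw [mul_add, map_add, map_add, hp, hq, add_zero]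
  | monomial n a =>
    rw [← Polynomial.C_mul_X_pow_eq_monomial, mul_left_comm, ← pow_succ', map_mul,
      Polynomial.aeval_C, map_pow, Polynomial.aeval_X, ← Algebra.smul_def, map_smul, hf, smul_zero]

/-- An endomorphism all of whose powers are traceless is nilpotent. -/
lemma isNilpotent_of_trace_pow_eq_zero {V : Type*} [AddCommGroup V] [Module ℝ V]
    [Module.Finite ℝ V] (f : Module.End ℝ V)
    (hf : ∀ k, LinearMap.trace ℝ V (f ^ (k + 1)) = 0) : IsNilpotent f := by
  -- The minimal polynomial is X^r q with q prime to X, and a X^(r+1) + b q = 1. At `f` the first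
  -- summand is an idempotent, the projection to the part where `f` is invertible. The exponent r +
  -- 1 leaves a factor X even for r = 0, so the idempotent is traceless and therefore zero.
  obtain ⟨q, hq, hXq⟩ := Polynomial.exists_eq_pow_rootMultiplicity_mul_and_not_dvd (minpoly ℝ f)
    (minpoly.ne_zero (Algebra.IsIntegral.isIntegral f)) 0
  rw [Polynomial.C_0, sub_zero] at hq hXq
  set r := Polynomial.rootMultiplicity 0 (minpoly ℝ f)
  have hcop : IsCoprime (Polynomial.X ^ (r + 1)) q :=
    ((Polynomial.prime_X.irreducible.coprime_iff_not_dvd).2 hXq).pow_left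
  obtain ⟨a, b, hab⟩ := hcop
  have hmin : Polynomial.aeval f (Polynomial.X ^ r * q) = 0 := by
    rw [← hq]
    exact minpoly.aeval ℝ f
  set e := Polynomial.aeval f (a * Polynomial.X ^ (r + 1)) with he
  have hidem : IsIdempotentElem e := by
    rw [IsIdempotentElem, ← sub_eq_zero, he, ← map_mul, ← map_sub]
    have : a * Polynomial.X ^ (r + 1) * (a * Polynomial.X ^ (r + 1)) - a * Polynomial.X ^ (r + 1) =
        (Polynomial.X ^ r * q) * (-(a * b * Polynomial.X)) := by
      have h : a * Polynomial.X ^ (r + 1) = 1 - b * q := by rw [← hab]; ring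
      calc _ = a * Polynomial.X ^ (r + 1) * (a * Polynomial.X ^ (r + 1) - 1) := by ring
        _ = a * Polynomial.X ^ (r + 1) * (1 - b * q - 1) := by rw [← h]
        _ = _ := by ring
    rw [this, map_mul, hmin, zero_mul]
  have h0 : e = 0 := by
    apply LinearMap.IsIdempotentElem.eq_zero_of_trace_eq_zero hidem
    have : a * Polynomial.X ^ (r + 1) = Polynomial.X * (a * Polynomial.X ^ r) := by ring
    rw [he, this]
    exact trace_aeval_X_mul_eq_zero f hf _
  refine ⟨r, ?_⟩
  have h1 : Polynomial.aeval f (b * q) = 1 := by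
    have h := congrArg (Polynomial.aeval f) hab
    rwa [map_add, ← he, h0, zero_add, map_one] at h
  have h2 : Polynomial.aeval f (Polynomial.X ^ r * (b * q)) = 0 := by
    have : Polynomial.X ^ r * (b * q) = Polynomial.X ^ r * q * b := by ring
    rw [this, map_mul, hmin, zero_mul]
  rwa [map_mul, h1, mul_one, map_pow, Polynomial.aeval_X] at h2

variable {L V : Type*} [LieRing L] [LieAlgebra ℝ L] [Module.Finite ℝ L] [AddCommGroup V]
  [Module ℝ V] [Module.Finite ℝ V] [LieRingModule L V] [LieModule ℝ L V]

/-- An ideal acting by nilpotent endomorphisms acts trivially on semisimple modules. -/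
lemma le_ker_of_forall_isNilpotent (hV : IsSemisimpleLieModule L V) (m : LieIdeal ℝ L)
    (hm : ∀ x ∈ m, IsNilpotent (toEnd ℝ L V x)) : m ≤ LieModule.ker ℝ L V := by
  -- The vectors killed by `m`, a submodule because `m` is an ideal. By Engel's theorem a non-zero
  -- complement would contain such a vector.
  let W : LieSubmodule ℝ L V :=
    { carrier := {v | ∀ x ∈ m, ⁅x, v⁆ = 0}
      add_mem' := fun {v w} hv hw x hx => by rw [lie_add, hv x hx, hw x hx, add_zero]
      zero_mem' := fun x _ => lie_zero x
      smul_mem' := fun c v hv x hx => by rw [lie_smul, hv x hx, smul_zero]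
      lie_mem := fun {y v} hv x hx => by
        rw [leibniz_lie, hv x hx, lie_zero, add_zero]
        exact hv _ (lie_mem_left ℝ L m x y hx) }
  obtain ⟨W', hW'⟩ := hV.exists_isCompl W
  have hbot : W' = ⊥ := by
    by_contra hne
    have : Nontrivial W' := (LieSubmodule.nontrivial_iff_ne_bot ℝ L V).2 hne
    have : LieModule.IsNilpotent m W' := by
      rw [isNilpotent_iff_forall' (R := ℝ)]
      rintro ⟨x, hx⟩
      obtain ⟨n, hn⟩ := hm x hx
      refine ⟨n, ?_⟩
      ext w
      have key : ∀ (n : ℕ) (w : W'), (((toEnd ℝ m W' ⟨x, hx⟩ ^ n) w : W') : V) =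
          (toEnd ℝ L V x ^ n) w := by
        intro n
        induction n with
        | zero => intro w; rfl
        | succ n ih => intro w; rw [pow_succ, pow_succ, Module.End.mul_apply, ih]; rfl
      rw [key, hn]
      rfl
    have := nontrivial_max_triv_of_isNilpotent ℝ m W'
    obtain ⟨w, hw⟩ := exists_ne (0 : maxTrivSubmodule ℝ m W')
    have h1 : ((w : W') : V) ∈ W := by
      intro x hx
      have := (mem_maxTrivSubmodule ℝ m W' w).1 w.2 ⟨x, hx⟩
      exact congrArg Subtype.val this
    have h2 : ((w : W') : V) = 0 := by
      have : ((w : W') : V) ∈ W ⊓ W' := ⟨h1, (w : W').2⟩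
      rwa [hW'.inf_eq_bot] at this
    exact hw (Subtype.ext (Subtype.ext h2))
  have htop : W = ⊤ := by
    have := hW'.sup_eq_top
    rwa [hbot, sup_bot_eq] at this
  intro x hx
  rw [LieModule.mem_ker]
  intro v
  have : v ∈ W := by rw [htop]; trivial
  exact this x hx

lemma toEnd_lie_eq (x y : L) :
    toEnd ℝ L V ⁅x, y⁆ = toEnd ℝ L V x * toEnd ℝ L V y - toEnd ℝ L V y * toEnd ℝ L V x := by
  ext v
  simp

/-- For b commuting with P, the operator [a, b] P is the commutator of a P with b. -/
lemma trace_toEnd_mul_eq_zero_of_commute (I J : LieIdeal ℝ L) (P : Module.End ℝ V)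
    (hP : ∀ y ∈ J, Commute (toEnd ℝ L V y) P) {x : L} (hx : x ∈ ⁅I, J⁆) :
    LinearMap.trace ℝ V (toEnd ℝ L V x * P) = 0 := by
  rw [← LieSubmodule.mem_toSubmodule, LieSubmodule.lieIdeal_oper_eq_linear_span] at hx
  induction hx using Submodule.span_induction with
  | mem u hu =>
    obtain ⟨a, b, rfl⟩ := hu
    have h : toEnd ℝ L V ⁅(a : L), (b : L)⁆ * P = toEnd ℝ L V a * P * toEnd ℝ L V b -
        toEnd ℝ L V b * (toEnd ℝ L V a * P) := by
      rw [toEnd_lie_eq, sub_mul, mul_assoc, (hP b b.2).eq, mul_assoc, mul_assoc]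
    rw [h, map_sub, LinearMap.trace_mul_comm, sub_self]
  | zero => simp
  | add u w _ _ hu hw => rw [map_add, add_mul, map_add, hu, hw, add_zero]
  | smul t u _ hu => rw [map_smul, smul_mul_assoc, map_smul, hu, smul_zero]

/-- An ideal contained in `[L, L]` on which the trace form of a semisimple module vanishes acts
trivially on this module. -/
lemma le_ker_of_traceForm_eq_zero (hV : IsSemisimpleLieModule L V) (m : LieIdeal ℝ L)
    (hm : m ≤ ⁅(⊤ : LieIdeal ℝ L), (⊤ : LieIdeal ℝ L)⁆)
    (hT : ∀ x ∈ m, ∀ y ∈ m, traceForm ℝ L V x y = 0) : m ≤ LieModule.ker ℝ L V := by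
  have hker : ∀ {x}, x ∈ LieModule.ker ℝ L V → toEnd ℝ L V x = 0 := fun h => h
  have hcomm : ∀ {x y}, ⁅x, y⁆ ∈ LieModule.ker ℝ L V →
      Commute (toEnd ℝ L V x) (toEnd ℝ L V y) := fun {x y} h => by
    rw [commute_iff_eq, ← sub_eq_zero, ← toEnd_lie_eq]
    exact hker h
  -- Cartan's criterion: `[m, m]` acts nilpotently, hence by zero on a semisimple module.
  have h1 : ⁅m, m⁆ ≤ LieModule.ker ℝ L V := by
    have hn : LieModule.IsNilpotent (LieAlgebra.derivedSeries ℝ m 1) V :=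
      isNilpotent_derivedSeries_of_traceForm_eq_zero (by
        ext ⟨x, hx⟩ ⟨y, hy⟩
        exact hT x hx y hy)
    refine le_ker_of_forall_isNilpotent hV _ fun x hx => ?_
    have hxm : x ∈ m := LieSubmodule.lie_le_left m m hx
    have hx' : (⟨x, hxm⟩ : m) ∈ LieAlgebra.derivedSeries ℝ m 1 := by
      rw [LieIdeal.derivedSeries_eq_derivedSeriesOfIdeal_comap, LieIdeal.mem_comap]
      simpa using hx
    exact (isNilpotent_iff_forall' (R := ℝ)).1 hn ⟨⟨x, hxm⟩, hx'⟩
  -- By `h1` the operators of `x ∈ [L, m]` and of all of `m` commute, so every power of `x` is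
  -- traceless.
  have h2 : ⁅(⊤ : LieIdeal ℝ L), m⁆ ≤ LieModule.ker ℝ L V := by
    refine le_ker_of_forall_isNilpotent hV _ fun x hx => ?_
    refine isNilpotent_of_trace_pow_eq_zero _ fun k => ?_
    rw [pow_succ']
    refine trace_toEnd_mul_eq_zero_of_commute ⊤ m _ (fun y hy => Commute.pow_right ?_ k) hx
    exact hcomm (h1 (LieSubmodule.lie_mem_lie hy (LieSubmodule.lie_le_right m ⊤ hx)))
  -- The same once more: by `h2` the operator of `x ∈ m` commutes with all of `L`, and `x` lies in
  -- `[L, L]`.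
  refine le_ker_of_forall_isNilpotent hV _ fun x hx => ?_
  refine isNilpotent_of_trace_pow_eq_zero _ fun k => ?_
  rw [pow_succ']
  refine trace_toEnd_mul_eq_zero_of_commute ⊤ ⊤ _ (fun y hy => Commute.pow_right ?_ k) (hm hx)
  exact hcomm (h2 (LieSubmodule.lie_mem_lie hy hx))

/-- If `V` is a semisimple `L`-module with kernel `K`, then the `L`-module `L / K` is semisimple. -/
lemma complementedIcc_ker_top (hV : IsSemisimpleLieModule L V) :
    ComplementedIcc (LieModule.ker ℝ L V) ⊤ := by
  set K := LieModule.ker ℝ L V with hK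
  refine ⟨le_top, fun I hKI _ => ?_⟩
  set T := traceForm ℝ L V
  have hTinv : T.lieInvariant L := traceForm_lieInvariant ℝ L V
  have hrefl : T.IsRefl := fun x y h => by rw [← h]; exact traceForm_comm ℝ L V y x
  let perp : LieIdeal ℝ L → LieIdeal ℝ L := fun I => LieAlgebra.InvariantForm.orthogonal T hTinv I
  have hmem : ∀ I y, y ∈ perp I ↔ ∀ x ∈ I, T x y = 0 := fun I y =>
    LieAlgebra.InvariantForm.mem_orthogonal T hTinv I y
  have hTK : ∀ x, ∀ y ∈ K, T x y = 0 := by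
    intro x y hy
    have : toEnd ℝ L V y = 0 := hy
    rw [traceForm_apply_apply, this]
    simp
  have hKperp : ∀ I, K ≤ perp I := fun I y hy => (hmem I y).2 fun x _ => hTK x y hy
  set D : LieIdeal ℝ L := ⁅(⊤ : LieIdeal ℝ L), (⊤ : LieIdeal ℝ L)⁆ with hD
  -- Cartan's criterion requires an ideal inside `[L, L]`, so `I` is first cut down to `[L, L] + K`.
  set I₁ := I ⊓ (D ⊔ K) with hI₁
  have hKI₁ : K ≤ I₁ := le_inf hKI le_sup_right
  have h1 : I₁ ⊓ perp I₁ ≤ K := by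
    have hm : D ⊓ (I₁ ⊓ perp I₁) ≤ K := by
      refine le_ker_of_traceForm_eq_zero hV _ inf_le_left fun x hx y hy => ?_
      exact (hmem _ _).1 hy.2.2 x hx.2.1
    calc I₁ ⊓ perp I₁ ≤ (K ⊔ D) ⊓ (I₁ ⊓ perp I₁) := by
          refine le_inf (inf_le_left.trans (inf_le_right.trans ?_)) le_rfl
          rw [sup_comm]
      _ = K ⊔ D ⊓ (I₁ ⊓ perp I₁) := sup_inf_assoc_of_le _ (le_inf hKI₁ (hKperp _))
      _ ≤ K := sup_le le_rfl hm
  -- Dimension count: K lies in the radical of the trace form, so the dimensions of `I₁` and `perp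
  -- I₁` add up to at least dim L + dim K, while their intersection has dimension at most dim K.
  have h2 : I₁ ⊔ perp I₁ = ⊤ := by
    rw [← LieSubmodule.toSubmodule_inj, LieSubmodule.sup_toSubmodule, LieSubmodule.top_toSubmodule]
    apply Submodule.eq_top_of_finrank_eq
    apply le_antisymm (Submodule.finrank_le _)
    have e1 := LinearMap.BilinForm.finrank_add_finrank_orthogonal hrefl I₁.toSubmodule
    have e2 := Submodule.finrank_sup_add_finrank_inf_eq I₁.toSubmodule (perp I₁).toSubmodule
    have e3 : Module.finrank ℝ K.toSubmodule ≤
        Module.finrank ℝ ↥(I₁.toSubmodule ⊓ T.orthogonal ⊤) :=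
      Submodule.finrank_mono fun y hy => ⟨hKI₁ hy, fun x _ => hTK x y hy⟩
    have e4 : Module.finrank ℝ ↥(I₁.toSubmodule ⊓ (perp I₁).toSubmodule) ≤
        Module.finrank ℝ K.toSubmodule := Submodule.finrank_mono h1
    have e5 : (perp I₁).toSubmodule = T.orthogonal I₁.toSubmodule := rfl
    rw [e5] at e2 e4 ⊢
    omega
  set c := I ⊓ perp I₁ with hc
  set D₂ := (D ⊔ K) ⊓ perp I₁ with hD₂
  have hcD₂ : c ⊓ D₂ ≤ K := by
    refine le_trans (le_inf (le_inf ?_ ?_) ?_) h1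
    · exact inf_le_left.trans inf_le_left
    · exact inf_le_right.trans inf_le_left
    · exact inf_le_left.trans inf_le_right
  have hKD₂ : K ≤ D₂ := le_inf le_sup_right (hKperp _)
  -- A merely linear complement suffices: `[L, perp I₁]` lies in `D₂`, so every subspace between
  -- `D₂` and `perp I₁` is an ideal.
  obtain ⟨e, hKe, he, he1, he2⟩ := ((complementedLattice_iff_complementedIcc
    (α := Submodule ℝ L)).1 inferInstance |>.mono bot_le (hKperp I₁) le_top).2
    (c.toSubmodule ⊔ D₂.toSubmodule) (le_trans hKD₂ le_sup_right) (sup_le inf_le_right inf_le_right)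
  have hU : e ⊔ D₂.toSubmodule ≤ (perp I₁).toSubmodule := sup_le he inf_le_right
  have hUc : c.toSubmodule ⊓ (e ⊔ D₂.toSubmodule) ≤ K.toSubmodule := by
    refine le_trans (le_inf inf_le_left ?_) hcD₂
    calc c.toSubmodule ⊓ (e ⊔ D₂.toSubmodule)
        ≤ (D₂.toSubmodule ⊔ e) ⊓ (c.toSubmodule ⊔ D₂.toSubmodule) := by
          rw [sup_comm e]
          exact le_inf inf_le_right (inf_le_left.trans le_sup_left)
      _ = D₂.toSubmodule ⊔ e ⊓ (c.toSubmodule ⊔ D₂.toSubmodule) :=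
          sup_inf_assoc_of_le _ le_sup_right
      _ ≤ D₂.toSubmodule := by
          rw [inf_comm, he1]
          exact sup_le le_rfl hKD₂
  let J : LieIdeal ℝ L :=
    { toSubmodule := e ⊔ D₂.toSubmodule
      lie_mem := fun {x u} hu => by
        refine Submodule.mem_sup_right ⟨?_, (perp I₁).lie_mem (hU hu)⟩
        exact LieSubmodule.mem_toSubmodule _ |>.1 ((le_sup_left : D ≤ D ⊔ K)
          (LieSubmodule.lie_mem_lie (LieSubmodule.mem_top x) (LieSubmodule.mem_top u))) }
  have hKJ : K ≤ J := le_trans hKD₂ (le_sup_right : D₂.toSubmodule ≤ e ⊔ D₂.toSubmodule)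
  refine ⟨J, hKJ, le_top, le_antisymm ?_ (le_inf hKI hKJ), ?_⟩
  · intro x hx
    exact hUc ⟨⟨hx.1, hU hx.2⟩, hx.2⟩
  · rw [eq_top_iff, ← h2]
    refine sup_le (inf_le_left.trans le_sup_left) ?_
    have h3 : (perp I₁).toSubmodule ≤ I.toSubmodule ⊔ J.toSubmodule := by
      rw [← he2]
      refine sup_le (sup_le ?_ ?_) ?_
      · exact le_sup_of_le_left inf_le_left
      · exact le_sup_of_le_right (le_sup_right : D₂.toSubmodule ≤ e ⊔ D₂.toSubmodule)
      · exact le_sup_of_le_right (le_sup_left : e ≤ e ⊔ D₂.toSubmodule)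
    rwa [← LieSubmodule.sup_toSubmodule] at h3

/-- `R_1` acts trivially on semisimple modules. -/
lemma lie_eq_zero_of_mem_radicalChain_one (hV : IsSemisimpleLieModule L V) {x : L}
    (hx : x ∈ radicalChain L 1) (v : V) : ⁅x, v⁆ = 0 :=
  (LieModule.mem_ker ℝ L V x).1 (radicalChain_succ_le_of (complementedIcc_ker_top hV) hx) v

end TraceForm

/-! ### Infinitesimal characterization of invariant cochains -/

section Exponential

/-- Taking matrices is a continuous ring homomorphism and commutes with the exponential series. The
operator exponential makes calculus available. -/
lemma endExp_apply_eq {V : Type*} [NormedAddCommGroup V] [NormedSpace ℝ V] [FiniteDimensional ℝ V]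
    (T : Module.End ℝ V) (v : V) :
    endExp T v = NormedSpace.exp (LinearMap.toContinuousLinearMap T) v := by
  let b := Module.finBasis ℝ V
  let f : (V →L[ℝ] V) →+* Matrix (Fin (Module.finrank ℝ V)) (Fin (Module.finrank ℝ V)) ℝ :=
    ((LinearMap.toMatrixAlgEquiv b).toAlgHom.toRingHom).comp
      (ContinuousLinearMap.toLinearMapRingHom (R₁ := ℝ) (M₁ := V))
  have hsmul : ∀ (c : ℝ) (x : V →L[ℝ] V), f (c • x) = c • f x := fun c x => by
    ext i j
    change LinearMap.toMatrix b b (c • (x : V →ₗ[ℝ] V)) i j = _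
    rw [map_smul]
    rfl
  have hf : Continuous f := by
    let g : (V →L[ℝ] V) →ₗ[ℝ] Matrix (Fin (Module.finrank ℝ V)) (Fin (Module.finrank ℝ V)) ℝ :=
      { toFun := f
        map_add' := map_add f
        map_smul' := hsmul }
    exact g.continuous_of_finiteDimensional
  have h : f (NormedSpace.exp (LinearMap.toContinuousLinearMap T)) =
      NormedSpace.exp (f (LinearMap.toContinuousLinearMap T)) := by
    rw [NormedSpace.exp_eq_tsum ℝ, NormedSpace.exp_eq_tsum ℝ]
    refine ((NormedSpace.expSeries_summable' (𝕂 := ℝ)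
      (LinearMap.toContinuousLinearMap T)).hasSum.map f hf).tsum_eq.symm.trans ?_
    simp only [Function.comp_def, hsmul, map_pow]
  have h1 : f (LinearMap.toContinuousLinearMap T) = LinearMap.toMatrix b b T := rfl
  have h2 : Matrix.toLin b b (f (NormedSpace.exp (LinearMap.toContinuousLinearMap T))) =
      (NormedSpace.exp (LinearMap.toContinuousLinearMap T) : V →L[ℝ] V) := by
    change Matrix.toLin b b (LinearMap.toMatrix b b _) = _
    rw [Matrix.toLin_toMatrix]
    rfl
  unfold endExp
  rw [← h1, ← h, h2]
  rfl

lemma hasDerivAt_exp_neg_smul_multilinear {V W : Type*} [NormedAddCommGroup V] [NormedSpace ℝ V]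
    [FiniteDimensional ℝ V] [NormedAddCommGroup W] [NormedSpace ℝ W] [FiniteDimensional ℝ W] {p : ℕ}
    (S : V →L[ℝ] V) (U : W →L[ℝ] W) (α : ContinuousMultilinearMap ℝ (fun _ : Fin p => V) W)
    (v : Fin p → V) (t : ℝ) :
    HasDerivAt (fun t : ℝ => NormedSpace.exp (t • -U) (α fun i => NormedSpace.exp (t • S) (v i)))
      (NormedSpace.exp (t • -U)
        (∑ i, α (Function.update (fun i => NormedSpace.exp (t • S) (v i)) i
          (S (NormedSpace.exp (t • S) (v i)))) - U (α fun i => NormedSpace.exp (t • S) (v i)))) t :=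
    by
  have h1 : HasDerivAt (fun t : ℝ => NormedSpace.exp (t • -U)) _ t :=
    hasDerivAt_exp_smul_const (-U) t
  have h2 : HasDerivAt (fun t : ℝ => (fun i => NormedSpace.exp (t • S) (v i) : Fin p → V))
      (fun i => S (NormedSpace.exp (t • S) (v i))) t := by
    rw [hasDerivAt_pi]
    intro i
    have h := (hasDerivAt_exp_smul_const' S t).clm_apply (hasDerivAt_const t (v i))
    simpa using h
  have h3 := (α.hasFDerivAt (fun i => NormedSpace.exp (t • S) (v i))).comp_hasDerivAt t h2
  have h4 := h1.clm_apply h3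
  refine h4.congr_deriv ?_
  rw [ContinuousMultilinearMap.linearDeriv_apply]
  simp [sub_eq_neg_add]

lemma multilinearMap_continuous_of_finiteDimensional {V W : Type*} [NormedAddCommGroup V]
    [NormedSpace ℝ V] [FiniteDimensional ℝ V] [NormedAddCommGroup W] [NormedSpace ℝ W] {p : ℕ}
    (α : MultilinearMap ℝ (fun _ : Fin p => V) W) : Continuous α := by
  classical
  let b := Module.finBasis ℝ V
  have h : ∀ v : Fin p → V, α v = ∑ r : Fin p → Fin (Module.finrank ℝ V),
      (∏ i, b.repr (v i) (r i)) • α fun i => b (r i) := by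
    intro v
    conv_lhs => rw [show v = fun i => ∑ j, b.repr (v i) j • b j from
      funext fun i => (b.sum_repr (v i)).symm]
    rw [MultilinearMap.map_sum]
    exact Finset.sum_congr rfl fun r _ => MultilinearMap.map_smul_univ _ _ _
  rw [show ⇑α = _ from funext h]
  refine continuous_finsetSum _ fun r _ => Continuous.smul ?_ continuous_const
  refine continuous_finsetProd _ fun i _ => ?_
  exact (LinearMap.continuous_of_finiteDimensional (b.coord (r i))).comp (continuous_apply i)

/-- The curve t ↦ e^(-tU) α(e^(tS) v) has as derivative e^(-tU) of the infinitesimal defect of α at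
e^(tS) v. Constancy kills the defect at t = 0, and a vanishing defect makes the curve constant. -/
lemma multilinear_exp_invariant {V W : Type*} [NormedAddCommGroup V] [NormedSpace ℝ V]
    [FiniteDimensional ℝ V] [NormedAddCommGroup W] [NormedSpace ℝ W] [FiniteDimensional ℝ W] {p : ℕ}
    (S : Module.End ℝ V) (U : Module.End ℝ W) (α : MultilinearMap ℝ (fun _ : Fin p => V) W) :
    (∀ t : ℝ, ∀ v, endExp (t • -U) (α fun i => endExp (t • S) (v i)) = α v) ↔
      ∀ v, U (α v) = ∑ i, α (Function.update v i (S (v i))) := by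
  let α' : ContinuousMultilinearMap ℝ (fun _ : Fin p => V) W :=
    ⟨α, multilinearMap_continuous_of_finiteDimensional α⟩
  let S' := LinearMap.toContinuousLinearMap S
  let U' := LinearMap.toContinuousLinearMap U
  have hφ : ∀ (t : ℝ) (v : Fin p → V), endExp (t • -U) (α fun i => endExp (t • S) (v i)) =
      NormedSpace.exp (t • -U') (α' fun i => NormedSpace.exp (t • S') (v i)) := by
    intro t v
    simp only [endExp_apply_eq, map_smul, map_neg]
    rfl
  have hd := fun v => hasDerivAt_exp_neg_smul_multilinear S' U' α' v
  simp only [hφ]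
  constructor
  · intro h v
    have h0 := hd v 0
    have hc : (fun t : ℝ => NormedSpace.exp (t • -U')
        (α' fun i => NormedSpace.exp (t • S') (v i))) = fun _ => α v := funext fun t => h t v
    rw [hc] at h0
    have h1 := h0.unique (hasDerivAt_const 0 (α v))
    simp only [zero_smul, NormedSpace.exp_zero, one_apply_eq_self] at h1
    exact (sub_eq_zero.1 h1).symm
  · intro h t v
    have hder : ∀ t, HasDerivAt (fun t : ℝ => NormedSpace.exp (t • -U')
        (α' fun i => NormedSpace.exp (t • S') (v i))) 0 t := by
      intro t
      convert hd v t using 1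
      have : U' (α' fun i => NormedSpace.exp (t • S') (v i)) = _ :=
        h fun i => NormedSpace.exp (t • S') (v i)
      rw [this]
      exact (((NormedSpace.exp (t • -U')).congr_arg (sub_self _)).trans (map_zero _)).symm
    have := is_const_of_deriv_eq_zero (fun t => (hder t).differentiableAt)
      (fun t => (hder t).deriv) t 0
    rw [this]
    simp only [zero_smul, NormedSpace.exp_zero, one_apply_eq_self]
    rfl

/-- A multilinear map is invariant under the one-parameter groups of `S` and `U` if and only if it
is infinitesimally invariant. -/
lemma endExp_invariant_iff {V W : Type*} [AddCommGroup V] [Module ℝ V] [Module.Finite ℝ V]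
    [AddCommGroup W] [Module ℝ W] [Module.Finite ℝ W] {p : ℕ}
    (S : Module.End ℝ V) (U : Module.End ℝ W) (α : MultilinearMap ℝ (fun _ : Fin p => V) W) :
    (∀ t : ℝ, ∀ v, endExp (t • -U) (α fun i => endExp (t • S) (v i)) = α v) ↔
      ∀ v, U (α v) = ∑ i, α (Function.update v i (S (v i))) := by
  -- Auxiliary norms are borrowed from coordinates; the statement does not involve them.
  let : NormedAddCommGroup V := NormedAddCommGroup.induced V (Fin (Module.finrank ℝ V) → ℝ)
    (Module.finBasis ℝ V).equivFun (Module.finBasis ℝ V).equivFun.injective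
  let : NormedSpace ℝ V := NormedSpace.induced ℝ V (Fin (Module.finrank ℝ V) → ℝ)
    (Module.finBasis ℝ V).equivFun
  let : NormedAddCommGroup W := NormedAddCommGroup.induced W (Fin (Module.finrank ℝ W) → ℝ)
    (Module.finBasis ℝ W).equivFun (Module.finBasis ℝ W).equivFun.injective
  let : NormedSpace ℝ W := NormedSpace.induced ℝ W (Fin (Module.finrank ℝ W) → ℝ)
    (Module.finBasis ℝ W).equivFun
  exact multilinear_exp_invariant S U α

end Exponential

section InvariantCochains

variable {𝔥 K : Type*} [LieRing 𝔥] [LieAlgebra ℝ 𝔥] [Group K] [TopologicalSpace K]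
  {κ : HKPair 𝔥 K}
  {𝔩 : Type u} [LieRing 𝔩] [LieAlgebra ℝ 𝔩] [Module.Finite ℝ 𝔩] {Φ : EquivariantLie κ 𝔩}
  {𝔞 : Type v} [AddCommGroup 𝔞] [Module ℝ 𝔞] [Module.Finite ℝ 𝔞] [LieRingModule 𝔩 𝔞]
  [LieModule ℝ 𝔩 𝔞]

/-- Invariance under e^X for all X contains, through the multiples t • X, the whole one-parameter
group of each X, so it is an infinitesimal condition. In this form it can be compared with
derivations of the bracket. -/
lemma mem_invariantCochains_iff {ΦA : OrthogonalModule Φ 𝔞} {p : ℕ} {α : 𝔩 [⋀^Fin p]→ₗ[ℝ] 𝔞} :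
    α ∈ invariantCochains ΦA p ↔
      (∀ X v, ΦA.alg X (α v) = ∑ i, α (Function.update v i (Φ.alg X (v i)))) ∧
      ∀ k v, α (fun i => Φ.grp k (v i)) = ΦA.grp k (α v) := by
  refine and_congr ⟨fun h X => ?_, fun h X => ?_⟩ ⟨fun h k v => ?_, fun h k => ?_⟩
  · refine (endExp_invariant_iff (Φ.alg X) (ΦA.alg X) α.toMultilinearMap).1 fun t v => ?_
    have := congrArg (fun β => β v) (h (t • X))
    simp only [cochainPullback, map_smul] at this
    rw [smul_neg]
    exact this
  · ext v
    have := (endExp_invariant_iff (Φ.alg X) (ΦA.alg X) α.toMultilinearMap).2 (h X) 1 v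
    simp only [one_smul] at this
    exact this
  · have h1 := congrArg (fun β => ΦA.grp k (β v)) (h k)
    have h2 : ΦA.grp k (ΦA.grp k⁻¹ (α fun i => Φ.grp k (v i))) = α fun i => Φ.grp k (v i) := by
      rw [← Module.End.mul_apply, ← map_mul, mul_inv_cancel, map_one, Module.End.one_apply]
    rw [← h2]
    exact h1
  · ext v
    change ΦA.grp k⁻¹ (α fun i => Φ.grp k (v i)) = α v
    rw [h, ← Module.End.mul_apply, ← map_mul, inv_mul_cancel, map_one, Module.End.one_apply]

lemma mem_invariantScalarCochains_iff {p : ℕ} {γ : 𝔩 [⋀^Fin p]→ₗ[ℝ] ℝ} :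
    γ ∈ invariantScalarCochains Φ p ↔
      (∀ X v, ∑ i, γ (Function.update v i (Φ.alg X (v i))) = 0) ∧
      ∀ k v, γ (fun i => Φ.grp k (v i)) = γ v := by
  refine and_congr ⟨fun h X => ?_, fun h X => ?_⟩ ⟨fun h k v => ?_, fun h k => ?_⟩
  · intro v
    refine ((endExp_invariant_iff (Φ.alg X) 0 γ.toMultilinearMap).1 (fun t v => ?_) v).symm
    have := congrArg (fun β => β v) (h (t • X))
    simp only [cochainPullback, map_smul] at this
    rw [neg_zero, smul_zero, endExp_zero]
    exact this
  · ext v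
    have := (endExp_invariant_iff (Φ.alg X) 0 γ.toMultilinearMap).2 (fun v => (h X v).symm) 1 v
    simp only [one_smul, neg_zero, endExp_zero] at this
    exact this
  · exact congrArg (fun β => β v) (h k)
  · ext v
    exact h k v

end InvariantCochains

/-! ### The differential and the product in low degrees -/

section LowDegree

lemma Fin.eq_vec_two {β : Type*} (v : Fin 2 → β) : v = ![v 0, v 1] := by
  ext i; fin_cases i <;> rfl

lemma Fin.eq_vec_three {β : Type*} (v : Fin 3 → β) : v = ![v 0, v 1, v 2] := by
  ext i; fin_cases i <;> rfl

variable {𝔩 : Type*} [LieRing 𝔩] [LieAlgebra ℝ 𝔩]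
  {V : Type*} [AddCommGroup V] [Module ℝ V]

lemma dRep_two [LieRingModule 𝔩 V] (α : (Fin 2 → 𝔩) → V) (v : Fin 3 → 𝔩) :
    dRep α v = ⁅v 0, α ![v 1, v 2]⁆ - ⁅v 1, α ![v 0, v 2]⁆ + ⁅v 2, α ![v 0, v 1]⁆
      - α ![⁅v 0, v 1⁆, v 2] + α ![⁅v 0, v 2⁆, v 1] - α ![⁅v 1, v 2⁆, v 0] := by
  have h2 : ∀ (x : 𝔩) (w : Fin 1 → 𝔩), (Fin.cons x w : Fin 2 → 𝔩) = ![x, w 0] := by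
    intro x w; ext i; fin_cases i <;> rfl
  have f0 : (0 : Fin 3).removeNth v = ![v 1, v 2] := by ext i; fin_cases i <;> rfl
  have f1 : (1 : Fin 3).removeNth v = ![v 0, v 2] := by ext i; fin_cases i <;> rfl
  have f2 : (2 : Fin 3).removeNth v = ![v 0, v 1] := by ext i; fin_cases i <;> rfl
  change (∑ i : Fin 3, _) + ∑ j : Fin 3, ∑ i : Fin 2, _ = _
  simp only [Fin.sum_univ_three, Fin.sum_univ_two, h2, f0, f1, f2]
  have p3 : (-1 : ℝ) ^ 3 = -1 := by norm_num
  simp [Fin.removeNth, Fin.succAbove, p3]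
  abel

lemma dTriv_three (γ : (Fin 3 → 𝔩) → ℝ) (v : Fin 4 → 𝔩) :
    dTriv γ v = -γ ![⁅v 0, v 1⁆, v 2, v 3] + γ ![⁅v 0, v 2⁆, v 1, v 3] - γ ![⁅v 0, v 3⁆, v 1, v 2]
      - γ ![⁅v 1, v 2⁆, v 0, v 3] + γ ![⁅v 1, v 3⁆, v 0, v 2] - γ ![⁅v 2, v 3⁆, v 0, v 1] := by
  have h2 : ∀ (x : 𝔩) (w : Fin 2 → 𝔩), (Fin.cons x w : Fin 3 → 𝔩) = ![x, w 0, w 1] := by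
    intro x w; ext i; fin_cases i <;> rfl
  have f0 : (0 : Fin 4).removeNth v = ![v 1, v 2, v 3] := by ext i; fin_cases i <;> rfl
  have f1 : (1 : Fin 4).removeNth v = ![v 0, v 2, v 3] := by ext i; fin_cases i <;> rfl
  have f2 : (2 : Fin 4).removeNth v = ![v 0, v 1, v 3] := by ext i; fin_cases i <;> rfl
  have f3 : (3 : Fin 4).removeNth v = ![v 0, v 1, v 2] := by ext i; fin_cases i <;> rfl
  have g0 : ∀ a b c : 𝔩, (0 : Fin 3).removeNth ![a, b, c] = ![b, c] := by
    intro a b c; ext i; fin_cases i <;> rfl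
  have g1 : ∀ a b c : 𝔩, (1 : Fin 3).removeNth ![a, b, c] = ![a, c] := by
    intro a b c; ext i; fin_cases i <;> rfl
  have g2 : ∀ a b c : 𝔩, (2 : Fin 3).removeNth ![a, b, c] = ![a, b] := by
    intro a b c; ext i; fin_cases i <;> rfl
  change (∑ i : Fin 4, _) + ∑ j : Fin 4, ∑ i : Fin 3, _ = _
  simp only [Fin.sum_univ_four, Fin.sum_univ_three, h2, f0, f1, f2, f3, g0, g1, g2]
  have c0 : (0 : Fin 3).castSucc = 0 := rfl
  have c1 : (1 : Fin 3).castSucc = 1 := rfl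
  have c2 : (2 : Fin 3).castSucc = 2 := rfl
  have d1 : (1 : Fin 4) < 2 := by decide
  have d2 : (1 : Fin 4) < 3 := by decide
  have d3 : (2 : Fin 4) < 3 := by decide
  have d4 : ¬(2 : Fin 4) < 1 := by decide
  have d5 : (0 : Fin 4) < 1 := by decide
  have d6 : (0 : Fin 4) < 2 := by decide
  have d7 : (0 : Fin 4) < 3 := by decide
  simp [c0, c1, c2, d1, d2, d3, d4, d5, d6, d7]
  norm_num
  ring

/-- Used repeatedly to expand the sum over the permutations of four letters. -/
lemma sum_perm_fin_succ (n : ℕ) (f : Equiv.Perm (Fin (n + 1)) → ℝ) :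
    ∑ σ, f σ = ∑ p : Fin (n + 1), ∑ τ : Equiv.Perm (Fin n),
      f (Equiv.Perm.decomposeFin.symm (p, τ)) := by
  rw [← Fintype.sum_prod_type', ← Equiv.sum_comp Equiv.Perm.decomposeFin.symm]

/-- The 24 terms form three groups of eight equal ones, by antisymmetry of α in each factor and
symmetry of `B`; the factor 1/4 of the product and the ½ cancel the eight. -/
lemma wedgeForm_two_two (B : LinearMap.BilinForm ℝ V) (hB : ∀ x y, B x y = B y x)
    (α : 𝔩 [⋀^Fin 2]→ₗ[ℝ] V) (v : Fin 4 → 𝔩) :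
    (1 / 2 : ℝ) * wedgeForm B α α v = B (α ![v 0, v 1]) (α ![v 2, v 3])
      - B (α ![v 0, v 2]) (α ![v 1, v 3]) + B (α ![v 0, v 3]) (α ![v 1, v 2]) := by
  have key : ∀ σ : Equiv.Perm (Fin (2 + 2)),
      B (α fun i => v (σ (Fin.castAdd 2 i))) (α fun j => v (σ (Fin.natAdd 2 j))) =
      B (α ![v (σ 0), v (σ (Fin.succ 0))])
        (α ![v (σ (Fin.succ (Fin.succ 0))), v (σ (Fin.succ (Fin.succ (Fin.succ 0))))]) := by
    intro σ
    rw [Fin.eq_vec_two (fun i => v (σ (Fin.castAdd 2 i))),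
      Fin.eq_vec_two (fun i => v (σ (Fin.natAdd 2 i)))]
    rfl
  have sk : ∀ x y, α ![x, y] = -α ![y, x] := fun x y => by
    have h := α.map_swap ![y, x] (show (0 : Fin 2) ≠ 1 by decide)
    rw [← h]
    congr 1
    ext i; fin_cases i <;> rfl
  unfold wedgeForm
  simp only [key]
  rw [sum_perm_fin_succ]
  simp only [sum_perm_fin_succ, Equiv.Perm.decomposeFin_symm_apply_succ,
    Equiv.Perm.decomposeFin_symm_apply_zero, Equiv.Perm.decomposeFin.symm_sign]
  simp only [Fin.sum_univ_succ, Fin.sum_univ_zero, Finset.univ_unique, Finset.sum_singleton]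
  simp [Equiv.swap_apply_def]
  rw [sk (v 1) (v 0), sk (v 2) (v 0), sk (v 3) (v 0), sk (v 2) (v 1), sk (v 3) (v 1),
    sk (v 3) (v 2)]
  simp only [map_neg, LinearMap.neg_apply, hB (α ![v 2, v 3]), hB (α ![v 1, v 3]),
    hB (α ![v 1, v 2])]
  ring

end LowDegree

/-! ### The standard model of a quadratic extension -/

/-! ### Alternating maps of degrees two and three as iterated linear maps. -/

section Multilinear

variable {V W : Type*} [AddCommGroup V] [Module ℝ V] [AddCommGroup W] [Module ℝ W]

/-- An alternating map of degree `2` as a bilinear map. -/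
def AlternatingMap.toBilin : (V [⋀^Fin 2]→ₗ[ℝ] W) →ₗ[ℝ] V →ₗ[ℝ] V →ₗ[ℝ] W where
  toFun α := LinearMap.mk₂ ℝ (fun x y => α ![x, y])
    (fun x x' y => congrArg (fun β => β ![y]) (α.curryLeft.map_add x x'))
    (fun c x y => congrArg (fun β => β ![y]) (α.curryLeft.map_smul c x))
    (fun x y y' => congrArg (fun β => β ![]) ((α.curryLeft x).curryLeft.map_add y y'))
    (fun c x y => congrArg (fun β => β ![]) ((α.curryLeft x).curryLeft.map_smul c y))
  map_add' _ _ := rfl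
  map_smul' _ _ := rfl

/-- An alternating map of degree `3` as a trilinear map. -/
def AlternatingMap.toTrilin (γ : V [⋀^Fin 3]→ₗ[ℝ] W) : V →ₗ[ℝ] V →ₗ[ℝ] V →ₗ[ℝ] W :=
  AlternatingMap.toBilin ∘ₗ γ.curryLeft

lemma AlternatingMap.toBilin_apply (α : V [⋀^Fin 2]→ₗ[ℝ] W) (x y : V) :
    α.toBilin x y = α ![x, y] := rfl

lemma AlternatingMap.toTrilin_apply (γ : V [⋀^Fin 3]→ₗ[ℝ] W) (x y w : V) :
    γ.toTrilin x y w = γ ![x, y, w] := rfl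

lemma AlternatingMap.toBilin_self (α : V [⋀^Fin 2]→ₗ[ℝ] W) (x : V) : α.toBilin x x = 0 :=
  α.map_eq_zero_of_eq ![x, x] (i := 0) (j := 1) rfl (by decide)

lemma AlternatingMap.toBilin_swap (α : V [⋀^Fin 2]→ₗ[ℝ] W) (x y : V) :
    α.toBilin x y = -α.toBilin y x := by
  have h := α.toBilin_self (x + y)
  simp only [map_add, LinearMap.add_apply, toBilin_self, zero_add, add_zero] at h
  exact eq_neg_of_add_eq_zero_right h

lemma AlternatingMap.toTrilin_swap_right (γ : V [⋀^Fin 3]→ₗ[ℝ] W) (x y w : V) :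
    γ.toTrilin x y w = -γ.toTrilin x w y :=
  (γ.curryLeft x).toBilin_swap y w

lemma AlternatingMap.toTrilin_self_left (γ : V [⋀^Fin 3]→ₗ[ℝ] W) (x w : V) :
    γ.toTrilin x x w = 0 :=
  γ.map_eq_zero_of_eq ![x, x, w] (i := 0) (j := 1) rfl (by decide)

lemma AlternatingMap.toTrilin_swap_left (γ : V [⋀^Fin 3]→ₗ[ℝ] W) (x y w : V) :
    γ.toTrilin x y w = -γ.toTrilin y x w := by
  have h := γ.toTrilin_self_left (x + y) w
  simp only [map_add, LinearMap.add_apply, toTrilin_self_left, zero_add, add_zero] at h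
  exact eq_neg_of_add_eq_zero_right h

lemma AlternatingMap.toTrilin_rotate (γ : V [⋀^Fin 3]→ₗ[ℝ] W) (x y w : V) :
    γ.toTrilin x y w = γ.toTrilin w x y := by
  rw [γ.toTrilin_swap_right, γ.toTrilin_swap_left, neg_neg]

/-- The alternating map of degree `3` given by a trilinear map. -/
def alternatingOfTrilin (f : V →ₗ[ℝ] V →ₗ[ℝ] V →ₗ[ℝ] W) (h₁ : ∀ x w, f x x w = 0)
    (h₂ : ∀ x y, f x y y = 0) : V [⋀^Fin 3]→ₗ[ℝ] W where
  toFun v := f (v 0) (v 1) (v 2)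
  map_update_add' := by
    intro inst v i x y
    obtain rfl : inst = instDecidableEqFin 3 := Subsingleton.elim _ _
    fin_cases i <;> simp
  map_update_smul' := by
    intro inst v i c x
    obtain rfl : inst = instDecidableEqFin 3 := Subsingleton.elim _ _
    fin_cases i <;> simp
  map_eq_zero_of_eq' := by
    intro v i j h hij
    have h₃ : ∀ x y, f x y x = 0 := fun x y => by
      have := h₂ x (x + y)
      simpa [h₁, h₂] using this
    have : v 0 = v 1 ∨ v 1 = v 2 ∨ v 0 = v 2 := by
      fin_cases i <;> fin_cases j <;> simp_all
    rcases this with h | h | h <;> simp [h, h₁, h₂, h₃]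

lemma sum_update_two {U : Type*} [AddCommMonoid U] (α : (Fin 2 → V) → U) (S : V → V)
    (v : Fin 2 → V) : ∑ i, α (Function.update v i (S (v i))) =
      α ![S (v 0), v 1] + α ![v 0, S (v 1)] := by
  rw [Fin.sum_univ_two]
  congr 2
  · ext i; fin_cases i <;> rfl
  · ext i; fin_cases i <;> rfl

lemma sum_update_three {U : Type*} [AddCommMonoid U] (α : (Fin 3 → V) → U) (S : V → V)
    (v : Fin 3 → V) : ∑ i, α (Function.update v i (S (v i))) =
      α ![S (v 0), v 1, v 2] + α ![v 0, S (v 1), v 2] + α ![v 0, v 1, S (v 2)] := by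
  rw [Fin.sum_univ_three]
  congr 2
  · congr 1
    ext i; fin_cases i <;> rfl
  · congr 1
    ext i; fin_cases i <;> rfl
  · ext i; fin_cases i <;> rfl

end Multilinear

/-! ### Invariance and cocycle equations on explicit arguments. -/

section Cocycles

variable {𝔥 K : Type*} [LieRing 𝔥] [LieAlgebra ℝ 𝔥] [Group K] [TopologicalSpace K]
  {κ : HKPair 𝔥 K}
  {𝔩 : Type u} [LieRing 𝔩] [LieAlgebra ℝ 𝔩] [Module.Finite ℝ 𝔩] {Φ : EquivariantLie κ 𝔩}
  {𝔞 : Type v} [AddCommGroup 𝔞] [Module ℝ 𝔞] [Module.Finite ℝ 𝔞] [LieRingModule 𝔩 𝔞]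
  [LieModule ℝ 𝔩 𝔞] {ΦA : OrthogonalModule Φ 𝔞}

lemma OrthogonalModule.form_comm (ΦA : OrthogonalModule Φ 𝔞) (A B : 𝔞) :
    ΦA.form A B = ΦA.form B A := ΦA.symm.eq A B

lemma mem_invariantCochains_one_iff {τ : 𝔩 [⋀^Fin 1]→ₗ[ℝ] 𝔞} : τ ∈ invariantCochains ΦA 1 ↔
    (∀ X x, ΦA.alg X (τ ![x]) = τ ![Φ.alg X x]) ∧
      ∀ k x, τ ![Φ.grp k x] = ΦA.grp k (τ ![x]) := by
  have e : ∀ v : Fin 1 → 𝔩, v = ![v 0] := by intro v; ext i; fin_cases i; rfl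
  rw [mem_invariantCochains_iff]
  refine and_congr ⟨fun h X x => ?_, fun h X v => ?_⟩ ⟨fun h k x => ?_, fun h k v => ?_⟩
  · rw [h, Fin.sum_univ_one]
    congr 1
    ext i; fin_cases i; rfl
  · rw [e v, h, Fin.sum_univ_one]
    congr 1
    ext i; fin_cases i; rfl
  · rw [← h]
    congr 1
    ext i; fin_cases i; rfl
  · rw [e v, ← h]
    congr 1
    ext i; fin_cases i; rfl

lemma mem_invariantCochains_two_iff {α : 𝔩 [⋀^Fin 2]→ₗ[ℝ] 𝔞} : α ∈ invariantCochains ΦA 2 ↔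
    (∀ X x y, ΦA.alg X (α ![x, y]) = α ![Φ.alg X x, y] + α ![x, Φ.alg X y]) ∧
      ∀ k x y, α ![Φ.grp k x, Φ.grp k y] = ΦA.grp k (α ![x, y]) := by
  rw [mem_invariantCochains_iff]
  refine and_congr ⟨fun h X x y => ?_, fun h X v => ?_⟩ ⟨fun h k x y => ?_, fun h k v => ?_⟩
  · rw [h, sum_update_two α]
    rfl
  · rw [sum_update_two α, ← h, ← Fin.eq_vec_two]
  · rw [← h, Fin.eq_vec_two (fun i => _)]
    rfl
  · rw [Fin.eq_vec_two v, ← h, Fin.eq_vec_two (fun i => _)]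
    rfl

lemma mem_invariantScalarCochains_two_iff {σ : 𝔩 [⋀^Fin 2]→ₗ[ℝ] ℝ} :
    σ ∈ invariantScalarCochains Φ 2 ↔
    (∀ X x y, σ ![Φ.alg X x, y] + σ ![x, Φ.alg X y] = 0) ∧
      ∀ k x y, σ ![Φ.grp k x, Φ.grp k y] = σ ![x, y] := by
  rw [mem_invariantScalarCochains_iff]
  refine and_congr ⟨fun h X x y => ?_, fun h X v => ?_⟩ ⟨fun h k x y => ?_, fun h k v => ?_⟩
  · have := h X ![x, y]
    rwa [sum_update_two σ] at this
  · rw [sum_update_two σ, h]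
  · rw [← h k ![x, y], Fin.eq_vec_two (fun i => Φ.grp k (![x, y] i))]
    rfl
  · rw [Fin.eq_vec_two v, ← h k, Fin.eq_vec_two (fun i => _)]
    rfl

lemma mem_invariantScalarCochains_three_iff {γ : 𝔩 [⋀^Fin 3]→ₗ[ℝ] ℝ} :
    γ ∈ invariantScalarCochains Φ 3 ↔
    (∀ X x y w, γ ![Φ.alg X x, y, w] + γ ![x, Φ.alg X y, w] + γ ![x, y, Φ.alg X w] = 0) ∧
      ∀ k x y w, γ ![Φ.grp k x, Φ.grp k y, Φ.grp k w] = γ ![x, y, w] := by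
  rw [mem_invariantScalarCochains_iff]
  refine and_congr ⟨fun h X x y w => ?_, fun h X v => ?_⟩ ⟨fun h k x y w => ?_, fun h k v => ?_⟩
  · have := h X ![x, y, w]
    rwa [sum_update_three γ] at this
  · rw [sum_update_three γ, h]
  · rw [← h k ![x, y, w], Fin.eq_vec_three (fun i => Φ.grp k (![x, y, w] i))]
    rfl
  · rw [Fin.eq_vec_three v, ← h k, Fin.eq_vec_three (fun i => _)]
    rfl

/-- The shape in which this equation appears as the 𝔞-component of the Jacobi identity. -/
lemma dRep_two_eq_zero_iff (α : 𝔩 [⋀^Fin 2]→ₗ[ℝ] 𝔞) : dRep α = 0 ↔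
    ∀ x y w, ⁅x, α.toBilin y w⁆ - ⁅y, α.toBilin x w⁆ + ⁅w, α.toBilin x y⁆ - α.toBilin ⁅x, y⁆ w
      + α.toBilin ⁅x, w⁆ y - α.toBilin ⁅y, w⁆ x = 0 := by
  constructor
  · intro h x y w
    have := congrFun h ![x, y, w]
    rw [dRep_two] at this
    exact this
  · intro h
    funext v
    rw [dRep_two]
    exact h (v 0) (v 1) (v 2)

/-- The shape in which this equation appears as the 𝔩^*-component of the Jacobi identity, with the
last argument as test vector. -/
lemma dTriv_three_eq_iff (α : 𝔩 [⋀^Fin 2]→ₗ[ℝ] 𝔞) (γ : 𝔩 [⋀^Fin 3]→ₗ[ℝ] ℝ) :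
    dTriv γ = (1 / 2 : ℝ) • wedgeForm ΦA.form α α ↔
    ∀ x y w t, -γ.toTrilin ⁅x, y⁆ w t + γ.toTrilin ⁅x, w⁆ y t - γ.toTrilin ⁅x, t⁆ y w
      - γ.toTrilin ⁅y, w⁆ x t + γ.toTrilin ⁅y, t⁆ x w - γ.toTrilin ⁅w, t⁆ x y =
      ΦA.form (α.toBilin x y) (α.toBilin w t) - ΦA.form (α.toBilin x w) (α.toBilin y t)
        + ΦA.form (α.toBilin x t) (α.toBilin y w) := by
  constructor
  · intro h x y w t
    have := congrFun h ![x, y, w, t]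
    rw [dTriv_three, Pi.smul_apply, smul_eq_mul, wedgeForm_two_two _ ΦA.form_comm] at this
    exact this
  · intro h
    funext v
    rw [dTriv_three, Pi.smul_apply, smul_eq_mul, wedgeForm_two_two _ ΦA.form_comm]
    exact h (v 0) (v 1) (v 2) (v 3)

end Cocycles

/-! ### The standard model as a metric Lie algebra. -/

section Model

variable {𝔥 K : Type*} [LieRing 𝔥] [LieAlgebra ℝ 𝔥] [Group K] [TopologicalSpace K]
  {κ : HKPair 𝔥 K}
  {𝔩 : Type u} [LieRing 𝔩] [LieAlgebra ℝ 𝔩] [Module.Finite ℝ 𝔩] {Φ : EquivariantLie κ 𝔩}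
  {𝔞 : Type v} [AddCommGroup 𝔞] [Module ℝ 𝔞] [Module.Finite ℝ 𝔞] [LieRingModule 𝔩 𝔞]
  [LieModule ℝ 𝔩 𝔞] {ΦA : OrthogonalModule Φ 𝔞}

/-- The vector space `𝔩^* ⊕ 𝔞 ⊕ 𝔩` underlying the standard model of the quadratic extension given
by a quadratic cocycle. -/
@[ext]
structure StandardModel (z : QuadraticCocycle ΦA) where
  dual : Module.Dual ℝ 𝔩
  mid : 𝔞
  base : 𝔩

namespace StandardModel

variable {z : QuadraticCocycle ΦA}

/-- The standard model as a product. -/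
def equivProd : StandardModel z ≃ Module.Dual ℝ 𝔩 × 𝔞 × 𝔩 where
  toFun x := (x.dual, x.mid, x.base)
  invFun p := ⟨p.1, p.2.1, p.2.2⟩
  left_inv _ := rfl
  right_inv _ := rfl

instance : AddCommGroup (StandardModel z) := equivProd.addCommGroup

instance : Module ℝ (StandardModel z) := equivProd.module ℝ

/-- The standard model as a product of vector spaces. -/
def linearEquivProd : StandardModel z ≃ₗ[ℝ] Module.Dual ℝ 𝔩 × 𝔞 × 𝔩 := equivProd.linearEquiv ℝ

instance : Module.Finite ℝ (StandardModel z) := Module.Finite.equiv linearEquivProd.symm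

@[simp] lemma dual_zero : (0 : StandardModel z).dual = 0 := rfl
@[simp] lemma mid_zero : (0 : StandardModel z).mid = 0 := rfl
@[simp] lemma base_zero : (0 : StandardModel z).base = 0 := rfl
@[simp] lemma dual_add (x y : StandardModel z) : (x + y).dual = x.dual + y.dual := rfl
@[simp] lemma mid_add (x y : StandardModel z) : (x + y).mid = x.mid + y.mid := rfl
@[simp] lemma base_add (x y : StandardModel z) : (x + y).base = x.base + y.base := rfl
@[simp] lemma dual_sub (x y : StandardModel z) : (x - y).dual = x.dual - y.dual := rfl
@[simp] lemma mid_sub (x y : StandardModel z) : (x - y).mid = x.mid - y.mid := rfl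
@[simp] lemma base_sub (x y : StandardModel z) : (x - y).base = x.base - y.base := rfl
@[simp] lemma dual_smul (c : ℝ) (x : StandardModel z) : (c • x).dual = c • x.dual := rfl
@[simp] lemma mid_smul (c : ℝ) (x : StandardModel z) : (c • x).mid = c • x.mid := rfl
@[simp] lemma base_smul (c : ℝ) (x : StandardModel z) : (c • x).base = c • x.base := rfl

/-- Two elements of the standard model with the same components are equal. -/
lemma ext_apply {x y : StandardModel z} (h₁ : ∀ W, x.dual W = y.dual W) (h₂ : x.mid = y.mid)
    (h₃ : x.base = y.base) : x = y :=
  StandardModel.ext (LinearMap.ext h₁) h₂ h₃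

/-- On 𝔩 the bracket is γ + α + [·, ·], and 𝔩 acts on 𝔞 by ρ up to 𝔩^*. Invariance of the pairing
forces the remaining terms: the duals of α and ρ and the coadjoint action. -/
instance : Bracket (StandardModel z) (StandardModel z) where
  bracket x y :=
    ⟨z.γ.toTrilin x.base y.base - (ΦA.form y.mid ∘ₗ z.α.toBilin x.base)
      + (ΦA.form x.mid ∘ₗ z.α.toBilin y.base) - (y.dual ∘ₗ lieBracketBilin 𝔩 x.base)
      + (x.dual ∘ₗ lieBracketBilin 𝔩 y.base)
      + (ΦA.form y.mid ∘ₗ (LieModule.toEnd ℝ 𝔩 𝔞 : 𝔩 →ₗ[ℝ] Module.End ℝ 𝔞).flip x.mid),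
      z.α.toBilin x.base y.base + ⁅x.base, y.mid⁆ - ⁅y.base, x.mid⁆,
      ⁅x.base, y.base⁆⟩

lemma dual_lie (x y : StandardModel z) (W : 𝔩) : ⁅x, y⁆.dual W =
    z.γ.toTrilin x.base y.base W - ΦA.form y.mid (z.α.toBilin x.base W)
      + ΦA.form x.mid (z.α.toBilin y.base W) - y.dual ⁅x.base, W⁆ + x.dual ⁅y.base, W⁆
      + ΦA.form y.mid ⁅W, x.mid⁆ := rfl

lemma mid_lie (x y : StandardModel z) : ⁅x, y⁆.mid =
    z.α.toBilin x.base y.base + ⁅x.base, y.mid⁆ - ⁅y.base, x.mid⁆ := rfl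

@[simp] lemma base_lie (x y : StandardModel z) : ⁅x, y⁆.base = ⁅x.base, y.base⁆ := rfl

lemma form_lie_right (ΦA : OrthogonalModule Φ 𝔞) (L : 𝔩) (A B : 𝔞) :
    ΦA.form A ⁅L, B⁆ = -ΦA.form ⁅L, A⁆ B := by rw [ΦA.rep_skew, neg_neg]

instance : LieRing (StandardModel z) where
  add_lie x y w := by
    refine ext_apply (fun W => ?_) ?_ ?_
    · simp only [dual_lie, base_add, mid_add, dual_add, map_add, LinearMap.add_apply, add_lie,
        lie_add]
      ring
    · simp only [mid_lie, base_add, mid_add, map_add, LinearMap.add_apply, add_lie, lie_add]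
      abel
    · simp
  lie_add x y w := by
    refine ext_apply (fun W => ?_) ?_ ?_
    · simp only [dual_lie, base_add, mid_add, dual_add, map_add, LinearMap.add_apply, add_lie]
      ring
    · simp only [mid_lie, base_add, mid_add, map_add, add_lie, lie_add]
      abel
    · simp
  lie_self x := by
    refine ext_apply (fun W => ?_) ?_ ?_
    -- Skewness of ρ gives ⟨A, ρ(W)A⟩ = 0.
    · have h := form_lie_right ΦA W x.mid x.mid
      rw [ΦA.form_comm ⁅W, x.mid⁆] at h
      have h' : z.γ.toTrilin x.base x.base W = 0 := z.γ.toTrilin_self_left _ _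
      rw [dual_lie, h', dual_zero, LinearMap.zero_apply]
      linarith
    · simp [mid_lie, AlternatingMap.toBilin_self]
    · simp
  leibniz_lie x y w := by
    refine ext_apply (fun W => ?_) ?_ ?_
    · have hγ := (dTriv_three_eq_iff z.α z.γ).1 z.d_γ x.base y.base w.base W
      have hα := (dRep_two_eq_zero_iff z.α).1 z.d_α
      -- Besides dγ = ½⟨α ∧ α⟩ on the three 𝔩-components and `W`, one needs dα = 0 paired with each
      -- 𝔞-component, evaluated on the other two 𝔩-components and `W`. The rest is reordering of
      -- arguments and skewness of ρ.
      have h₁ := congrArg (ΦA.form w.mid) (hα x.base y.base W)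
      have h₂ := congrArg (ΦA.form y.mid) (hα x.base w.base W)
      have h₃ := congrArg (ΦA.form x.mid) (hα y.base w.base W)
      simp only [map_zero, map_add, map_sub, form_lie_right] at h₁ h₂ h₃
      have e₁ := z.γ.toTrilin_swap_left x.base ⁅y.base, w.base⁆ W
      have e₂ := z.γ.toTrilin_swap_left y.base ⁅x.base, w.base⁆ W
      have e₃ := z.γ.toTrilin_rotate y.base w.base ⁅x.base, W⁆
      have e₄ := z.γ.toTrilin_rotate x.base w.base ⁅y.base, W⁆
      have e₅ := z.γ.toTrilin_rotate x.base y.base ⁅w.base, W⁆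
      simp only [dual_lie, mid_lie, base_lie, dual_add, LinearMap.add_apply, map_add, map_sub,
        lie_add, lie_sub, LinearMap.sub_apply, form_lie_right, lie_lie]
      have hs : ∀ A u v, ΦA.form A (z.α.toBilin u v) = -ΦA.form A (z.α.toBilin v u) :=
        fun A u v => by rw [z.α.toBilin_swap u v, map_neg]
      have hq : ∀ L A B, ΦA.form ⁅L, A⁆ B = -ΦA.form ⁅L, B⁆ A :=
        fun L A B => by rw [ΦA.rep_skew, ΦA.form_comm]
      have hq' : ΦA.form ⁅w.base, ⁅W, y.mid⁆⁆ x.mid = ΦA.form ⁅W, ⁅w.base, x.mid⁆⁆ y.mid := by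
        rw [ΦA.rep_skew, ΦA.rep_skew, neg_neg, ΦA.form_comm]
      linear_combination hγ + e₁ - e₂ - e₃ + e₄ - e₅ - h₁ + h₂ - h₃
        - ΦA.form_comm (z.α.toBilin y.base w.base) (z.α.toBilin x.base W)
        + hs w.mid y.base ⁅x.base, W⁆ - hs w.mid x.base ⁅y.base, W⁆
        - hs y.mid w.base ⁅x.base, W⁆ + hs y.mid x.base ⁅w.base, W⁆
        + hs x.mid w.base ⁅y.base, W⁆ - hs x.mid y.base ⁅w.base, W⁆
        - hq W (z.α.toBilin y.base w.base) x.mid + hq W (z.α.toBilin x.base w.base) y.mid + hq'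
    · have h := (dRep_two_eq_zero_iff z.α).1 z.d_α x.base y.base w.base
      have e := z.α.toBilin_swap x.base ⁅y.base, w.base⁆
      have e' := z.α.toBilin_swap y.base ⁅x.base, w.base⁆
      simp only [mid_lie, base_lie, mid_add, lie_add, lie_sub, lie_lie]
      rw [e, e']
      rw [← sub_eq_zero, ← h]
      abel
    · simp

instance : LieAlgebra ℝ (StandardModel z) where
  lie_smul c x y := by
    refine ext_apply (fun W => ?_) ?_ ?_
    · simp only [dual_lie, base_smul, mid_smul, dual_smul, map_smul, LinearMap.smul_apply,
        smul_lie, smul_eq_mul]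
      ring
    · simp only [mid_lie, base_smul, mid_smul, map_smul, lie_smul, smul_lie, smul_sub, smul_add]
    · simp

/-- The component in `𝔩^*` as a linear map. -/
def dualLinear : StandardModel z →ₗ[ℝ] Module.Dual ℝ 𝔩 where
  toFun := dual
  map_add' _ _ := rfl
  map_smul' _ _ := rfl

/-- The component in `𝔞` as a linear map. -/
def midLinear : StandardModel z →ₗ[ℝ] 𝔞 where
  toFun := mid
  map_add' _ _ := rfl
  map_smul' _ _ := rfl

/-- The component in `𝔩` as a homomorphism of Lie algebras. -/
def baseHom : StandardModel z →ₗ⁅ℝ⁆ 𝔩 where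
  toFun := base
  map_add' _ _ := rfl
  map_smul' _ _ := rfl
  map_lie' := rfl

/-- The inner product of the standard model. -/
def form (z : QuadraticCocycle ΦA) : LinearMap.BilinForm ℝ (StandardModel z) :=
  LinearMap.mk₂ ℝ (fun x y => x.dual y.base + y.dual x.base + ΦA.form x.mid y.mid)
    (fun x y w => by simp; ring) (fun c x y => by simp; ring) (fun x y w => by simp; ring)
    (fun c x y => by simp; ring)

lemma form_apply (x y : StandardModel z) :
    form z x y = x.dual y.base + y.dual x.base + ΦA.form x.mid y.mid := rfl

lemma form_isSymm : (form z).IsSymm :=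
  ⟨fun x y => by simp only [form_apply, ΦA.form_comm x.mid]; ring⟩

lemma eq_zero_of_forall_form_eq_zero (x : StandardModel z) (h : ∀ y, form z x y = 0) : x = 0 := by
  have hb : x.base = 0 := by
    refine (Module.forall_dual_apply_eq_zero_iff ℝ _).1 fun f => ?_
    simpa [form_apply] using h ⟨f, 0, 0⟩
  have hm : x.mid = 0 := by
    refine ΦA.nondegenerate.1 _ fun A => ?_
    simpa [form_apply] using h ⟨0, A, 0⟩
  refine ext_apply (fun W => ?_) hm hb
  simpa [form_apply] using h ⟨0, 0, W⟩

lemma form_nondegenerate : (form z).Nondegenerate :=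
  ⟨fun x h => eq_zero_of_forall_form_eq_zero x h,
    fun x h => eq_zero_of_forall_form_eq_zero x fun y => by rw [form_isSymm.eq_iff, h]⟩

lemma form_lieInvariant : (form z).lieInvariant (StandardModel z) := by
  intro x y w
  simp only [form_apply, dual_lie, mid_lie, base_lie, map_add, map_sub, LinearMap.add_apply,
    LinearMap.sub_apply]
  have h : ΦA.form x.mid (z.α.toBilin y.base w.base) = -ΦA.form x.mid (z.α.toBilin w.base y.base) :=
    by rw [z.α.toBilin_swap y.base, map_neg]
  have h' : x.dual ⁅y.base, w.base⁆ = -x.dual ⁅w.base, y.base⁆ := by rw [← lie_skew, map_neg]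
  linear_combination z.γ.toTrilin_swap_right x.base y.base w.base + h + h'
    + ΦA.form_comm (z.α.toBilin x.base y.base) w.mid + ΦA.rep_skew x.base y.mid w.mid
    - ΦA.form_comm ⁅y.base, x.mid⁆ w.mid

end StandardModel
end Model

/-! ### Semisimple (𝔥, K)-modules: images and duals. -/

section HKModules

variable {𝔥 K : Type*} [LieRing 𝔥] [LieAlgebra ℝ 𝔥] [Group K] [TopologicalSpace K]
  {κ : HKPair 𝔥 K} {V V' : Type*} [AddCommGroup V] [Module ℝ V] [AddCommGroup V'] [Module ℝ V']

namespace HKModule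

lemma grp_inv_apply (Φ : HKModule κ V) (k : K) (x : V) : Φ.grp k⁻¹ (Φ.grp k x) = x := by
  rw [← Module.End.mul_apply, ← map_mul, inv_mul_cancel, map_one, Module.End.one_apply]

lemma grp_apply_inv (Φ : HKModule κ V) (k : K) (x : V) : Φ.grp k (Φ.grp k⁻¹ x) = x := by
  rw [← Module.End.mul_apply, ← map_mul, mul_inv_cancel, map_one, Module.End.one_apply]

/-- The lattice of `(𝔥, K)`-submodules. -/
def invariantLattice (Φ : HKModule κ V) : Sublattice (Submodule ℝ V) where
  carrier := {W | Φ.Invariant W}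
  supClosed' := by
    have key : ∀ (T : V →ₗ[ℝ] V) (W W' : Submodule ℝ V), (∀ x ∈ W, T x ∈ W) →
        (∀ x ∈ W', T x ∈ W') → ∀ x ∈ W ⊔ W', T x ∈ W ⊔ W' := by
      intro T W W' h h' x hx
      obtain ⟨y, hy, y', hy', rfl⟩ := Submodule.mem_sup.1 hx
      rw [map_add]
      exact Submodule.add_mem_sup (h y hy) (h' y' hy')
    exact fun W hW W' hW' => ⟨fun X => key _ W W' (hW.1 X) (hW'.1 X),
      fun k => key _ W W' (hW.2 k) (hW'.2 k)⟩
  infClosed' := fun W hW W' hW' => ⟨fun X x hx => ⟨hW.1 X x hx.1, hW'.1 X x hx.2⟩,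
    fun k x hx => ⟨hW.2 k x hx.1, hW'.2 k x hx.2⟩⟩

instance (Φ : HKModule κ V) : IsModularLattice Φ.invariantLattice where
  sup_inf_le_assoc_of_le {x} y {w} h :=
    IsModularLattice.sup_inf_le_assoc_of_le (x := x.1) (y := y.1) (z := w.1) h

lemma invariant_bot (Φ : HKModule κ V) : Φ.Invariant ⊥ := by
  constructor <;> simp

lemma isSemisimple_of_complementedIcc {Φ : HKModule κ V} {b : Φ.invariantLattice}
    (h : ComplementedIcc (⟨⊥, Φ.invariant_bot⟩ : Φ.invariantLattice) b)
    (hb : (b : Submodule ℝ V) = ⊤) : Φ.IsSemisimple := by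
  intro W hW
  obtain ⟨d, -, -, h₁, h₂⟩ := h.2 ⟨W, hW⟩ (bot_le (a := W)) (by
    rw [← Subtype.coe_le_coe, hb]; exact le_top)
  refine ⟨d, d.2, disjoint_iff.2 (congrArg Subtype.val h₁), codisjoint_iff.2 ?_⟩
  exact (congrArg Subtype.val h₂).trans hb

lemma invariant_range (Φ : HKModule κ V) (Φ' : HKModule κ V') (i : V →ₗ[ℝ] V')
    (halg : ∀ X x, i (Φ.alg X x) = Φ'.alg X (i x))
    (hgrp : ∀ k x, i (Φ.grp k x) = Φ'.grp k (i x)) : Φ'.Invariant (LinearMap.range i) := by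
  constructor
  · rintro X _ ⟨x, rfl⟩
    exact ⟨_, halg X x⟩
  · rintro k _ ⟨x, rfl⟩
    exact ⟨_, hgrp k x⟩

/-- Phrased as an interval in the target, so that sums of images are handled by
`ComplementedIcc.sup`. -/
lemma IsSemisimple.complementedIcc_range {Φ : HKModule κ V} {Φ' : HKModule κ V'}
    (h : Φ.IsSemisimple) (i : V →ₗ[ℝ] V')
    (halg : ∀ X x, i (Φ.alg X x) = Φ'.alg X (i x)) (hgrp : ∀ k x, i (Φ.grp k x) = Φ'.grp k (i x)) :
    ComplementedIcc (⟨⊥, Φ'.invariant_bot⟩ : Φ'.invariantLattice)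
      ⟨LinearMap.range i, Φ.invariant_range Φ' i halg hgrp⟩ := by
  refine ⟨bot_le (a := LinearMap.range i), fun c _ hc => ?_⟩
  obtain ⟨W, hW, hc'⟩ := h (c.1.comap i) ⟨fun X x hx => by
      rw [Submodule.mem_comap, halg]; exact c.2.1 X _ hx, fun k x hx => by
      rw [Submodule.mem_comap, hgrp]; exact c.2.2 k _ hx⟩
  have hcle : c.1 ≤ LinearMap.range i := hc
  refine ⟨⟨W.map i, ?_, ?_⟩, bot_le (a := W.map i), LinearMap.map_le_range, ?_, ?_⟩
  · rintro X _ ⟨x, hx, rfl⟩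
    exact ⟨_, hW.1 X x hx, halg X x⟩
  · rintro k _ ⟨x, hx, rfl⟩
    exact ⟨_, hW.2 k x hx, hgrp k x⟩
  · refine Subtype.ext (eq_bot_iff.2 ?_)
    rintro _ ⟨hx, x, hx', rfl⟩
    have : x ∈ c.1.comap i ⊓ W := ⟨hx, hx'⟩
    rw [hc'.inf_eq_bot, Submodule.mem_bot] at this
    rw [this, map_zero]
    exact zero_mem _
  · refine Subtype.ext ?_
    change c.1 ⊔ W.map i = LinearMap.range i
    rw [← inf_eq_right.2 hcle, ← Submodule.map_comap_eq, ← Submodule.map_sup, hc'.sup_eq_top,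
      Submodule.map_top]

/-- The dual of an `(𝔥, K)`-module. -/
def dual [ContinuousInv K] [Module.Finite ℝ V] (Φ : HKModule κ V) :
    HKModule κ (Module.Dual ℝ V) where
  alg :=
    { toFun := fun X => -(Φ.alg X).dualMap
      map_add' := fun X Y => by
        ext Z x; simp only [map_add, LinearMap.neg_apply, LinearMap.dualMap_apply,
          LinearMap.add_apply, neg_add]
      map_smul' := fun c X => by
        ext Z x; simp }
  alg_bracket X Y := by
    ext Z x
    simp [Φ.alg_bracket]
  grp :=
    { toFun := fun k => (Φ.grp k⁻¹).dualMap
      map_one' := by ext Z x; simp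
      map_mul' := fun k l => by ext Z x; simp }
  continuous_grp f Z := by
    -- By reflexivity a matrix coefficient of the dual is one of `V`, evaluated at k⁻¹.
    obtain ⟨x, rfl⟩ := (Module.evalEquiv ℝ V).surjective f
    exact (Φ.continuous_grp Z x).comp continuous_inv
  alg_act k X := by
    ext Z x
    have h := Φ.alg_act k X
    simp [h]

lemma dual_alg_apply [ContinuousInv K] [Module.Finite ℝ V] (Φ : HKModule κ V) (X : 𝔥)
    (Z : Module.Dual ℝ V) (x : V) : Φ.dual.alg X Z x = -Z (Φ.alg X x) := rfl

lemma dual_grp_apply [ContinuousInv K] [Module.Finite ℝ V] (Φ : HKModule κ V) (k : K)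
    (Z : Module.Dual ℝ V) (x : V) : Φ.dual.grp k Z x = Z (Φ.grp k⁻¹ x) := rfl

/-- Annihilators exchange submodules of `V` and of its dual: the annihilator of a complement of the
coannihilator of `W` is a complement of `W`. -/
lemma IsSemisimple.dual [ContinuousInv K] [Module.Finite ℝ V] {Φ : HKModule κ V}
    (h : Φ.IsSemisimple) : Φ.dual.IsSemisimple := by
  intro W hW
  have hW' : Φ.Invariant W.dualCoannihilator := by
    refine ⟨fun X x hx => ?_, fun k x hx => ?_⟩
    · rw [Submodule.mem_dualCoannihilator] at hx ⊢
      intro Z hZ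
      have := hx _ (hW.1 X Z hZ)
      rwa [dual_alg_apply, neg_eq_zero] at this
    · rw [Submodule.mem_dualCoannihilator] at hx ⊢
      intro Z hZ
      have := hx _ (hW.2 k⁻¹ Z hZ)
      rwa [dual_grp_apply, inv_inv] at this
  obtain ⟨U, hU, hc⟩ := h _ hW'
  refine ⟨U.dualAnnihilator, ⟨fun X Z hZ => ?_, fun k Z hZ => ?_⟩, ?_⟩
  · rw [Submodule.mem_dualAnnihilator] at hZ ⊢
    intro x hx
    rw [dual_alg_apply, hZ _ (hU.1 X x hx), neg_zero]
  · rw [Submodule.mem_dualAnnihilator] at hZ ⊢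
    intro x hx
    rw [dual_grp_apply, hZ _ (hU.2 _ x hx)]
  · have := Subspace.isCompl_dualAnnihilator hc
    rwa [Subspace.dualCoannihilator_dualAnnihilator_eq] at this

end HKModule

end HKModules

/-! ### The equivariant structure of the standard model. -/

section Model

variable {𝔥 K : Type*} [LieRing 𝔥] [LieAlgebra ℝ 𝔥] [Group K] [TopologicalSpace K]
  {κ : HKPair 𝔥 K}
  {𝔩 : Type u} [LieRing 𝔩] [LieAlgebra ℝ 𝔩] [Module.Finite ℝ 𝔩] {Φ : EquivariantLie κ 𝔩}
  {𝔞 : Type v} [AddCommGroup 𝔞] [Module ℝ 𝔞] [Module.Finite ℝ 𝔞] [LieRingModule 𝔩 𝔞]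
  [LieModule ℝ 𝔩 𝔞] {ΦA : OrthogonalModule Φ 𝔞} [ContinuousInv K]

namespace StandardModel

/-- The inclusion of `𝔩^*`. -/
def ofDual (z : QuadraticCocycle ΦA) : Module.Dual ℝ 𝔩 →ₗ[ℝ] StandardModel z where
  toFun Z := ⟨Z, 0, 0⟩
  map_add' _ _ := by ext <;> simp
  map_smul' _ _ := by ext <;> simp

/-- The inclusion of `𝔞`. -/
def ofMid (z : QuadraticCocycle ΦA) : 𝔞 →ₗ[ℝ] StandardModel z where
  toFun A := ⟨0, A, 0⟩
  map_add' _ _ := by ext <;> simp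
  map_smul' _ _ := by ext <;> simp

/-- The inclusion of `𝔩`. -/
def ofBase (z : QuadraticCocycle ΦA) : 𝔩 →ₗ[ℝ] StandardModel z where
  toFun L := ⟨0, 0, L⟩
  map_add' _ _ := by ext <;> simp
  map_smul' _ _ := by ext <;> simp

variable {z : QuadraticCocycle ΦA}

lemma eq_add (x : StandardModel z) :
    x = ofDual z x.dual + ofMid z x.mid + ofBase z x.base := by
  ext <;> simp [ofDual, ofMid, ofBase]

/-- The `(𝔥, K)`-module structure of the standard model. -/
def hkModule (z : QuadraticCocycle ΦA) : HKModule κ (StandardModel z) where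
  alg :=
    { toFun := fun X =>
        { toFun := fun x => ⟨Φ.toHKModule.dual.alg X x.dual, ΦA.alg X x.mid, Φ.alg X x.base⟩
          map_add' := fun x y => by ext <;> simp
          map_smul' := fun c x => by ext <;> simp }
      map_add' := fun X Y => by
        refine LinearMap.ext fun x => StandardModel.ext ?_ ?_ ?_ <;>
          simp only [LinearMap.coe_mk, AddHom.coe_mk, map_add, LinearMap.add_apply, dual_add,
            mid_add, base_add]
      map_smul' := fun c X => by
        refine LinearMap.ext fun x => StandardModel.ext ?_ ?_ ?_ <;>
          simp only [LinearMap.coe_mk, AddHom.coe_mk, map_smul, LinearMap.smul_apply, dual_smul,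
            mid_smul, base_smul, RingHom.id_apply] }
  alg_bracket X Y := by
    refine LinearMap.ext fun x => StandardModel.ext ?_ ?_ ?_
    · exact LinearMap.congr_fun (Φ.toHKModule.dual.alg_bracket X Y) x.dual
    · exact LinearMap.congr_fun (ΦA.alg_bracket X Y) x.mid
    · exact LinearMap.congr_fun (Φ.alg_bracket X Y) x.base
  grp :=
    { toFun := fun k =>
        { toFun := fun x => ⟨Φ.toHKModule.dual.grp k x.dual, ΦA.grp k x.mid, Φ.grp k x.base⟩
          map_add' := fun x y => by ext <;> simp
          map_smul' := fun c x => by ext <;> simp }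
      map_one' := by
        refine LinearMap.ext fun x => StandardModel.ext ?_ ?_ ?_ <;> simp
      map_mul' := fun k l => by
        refine LinearMap.ext fun x => StandardModel.ext ?_ ?_ ?_ <;> simp }
  continuous_grp f x := by
    have h : ∀ y : StandardModel z, f y = (f ∘ₗ ofDual z) y.dual + (f ∘ₗ ofMid z) y.mid
        + (f ∘ₗ ofBase z) y.base := fun y => by
      conv_lhs => rw [eq_add y, map_add, map_add]
      rfl
    simp only [h]
    exact ((Φ.toHKModule.dual.continuous_grp _ _).add (ΦA.continuous_grp _ _)).add
      (Φ.continuous_grp _ _)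
  alg_act k X := by
    refine LinearMap.ext fun x => StandardModel.ext ?_ ?_ ?_
    · exact LinearMap.congr_fun (Φ.toHKModule.dual.alg_act k X) x.dual
    · exact LinearMap.congr_fun (ΦA.alg_act k X) x.mid
    · exact LinearMap.congr_fun (Φ.alg_act k X) x.base

lemma hkModule_alg (X : 𝔥) (x : StandardModel z) : (hkModule z).alg X x =
    ⟨Φ.toHKModule.dual.alg X x.dual, ΦA.alg X x.mid, Φ.alg X x.base⟩ := rfl

lemma hkModule_grp (k : K) (x : StandardModel z) : (hkModule z).grp k x =
    ⟨Φ.toHKModule.dual.grp k x.dual, ΦA.grp k x.mid, Φ.grp k x.base⟩ := rfl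

/-- The model is the sum of the images of 𝔩^*, 𝔞 and 𝔩, each of which is semisimple. -/
lemma hkModule_isSemisimple (z : QuadraticCocycle ΦA) : (hkModule z).IsSemisimple := by
  have h₁ := Φ.semisimple.dual.complementedIcc_range (Φ' := hkModule z) (ofDual z)
    (fun X x => by ext <;> simp [hkModule_alg, ofDual])
    (fun X x => by ext <;> simp [hkModule_grp, ofDual])
  have h₂ := ΦA.semisimple.complementedIcc_range (Φ' := hkModule z) (ofMid z)
    (fun X x => by ext <;> simp [hkModule_alg, ofMid])
    (fun X x => by ext <;> simp [hkModule_grp, ofMid])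
  have h₃ := Φ.semisimple.complementedIcc_range (Φ' := hkModule z) (ofBase z)
    (fun X x => by ext <;> simp [hkModule_alg, ofBase])
    (fun X x => by ext <;> simp [hkModule_grp, ofBase])
  refine HKModule.isSemisimple_of_complementedIcc ((h₁.sup h₂).sup h₃) (eq_top_iff.2 fun x _ => ?_)
  rw [eq_add x]
  exact Submodule.add_mem_sup (Submodule.add_mem_sup ⟨_, rfl⟩ ⟨_, rfl⟩) ⟨_, rfl⟩

/-- The standard model as an `(𝔥, K)`-equivariant metric Lie algebra. -/
def metric (z : QuadraticCocycle ΦA) : EquivariantMetricLie κ (StandardModel z) where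
  toHKModule := hkModule z
  semisimple := hkModule_isSemisimple z
  alg_lie X x y := by
    have hα := (mem_invariantCochains_two_iff.1 z.α_mem).1 X
    simp only [← AlternatingMap.toBilin_apply] at hα
    refine ext_apply (fun W => ?_) ?_ (Φ.alg_lie X _ _)
    · have hγ := (mem_invariantScalarCochains_three_iff.1 z.γ_mem).1 X x.base y.base W
      simp only [← AlternatingMap.toTrilin_apply] at hγ
      have h₁ := ΦA.alg_skew X y.mid (z.α.toBilin x.base W)
      have h₂ := ΦA.alg_skew X x.mid (z.α.toBilin y.base W)
      have h₃ := ΦA.alg_skew X y.mid ⁅W, x.mid⁆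
      have h₄ := congrArg (ΦA.form y.mid) (ΦA.rep_alg X W x.mid)
      rw [hα, map_add] at h₁ h₂
      rw [map_sub] at h₄
      simp only [hkModule_alg, dual_add, LinearMap.add_apply, dual_lie, HKModule.dual_alg_apply,
        Φ.alg_lie, map_add]
      linear_combination -hγ + h₁ - h₂ - h₃ - h₄
    · simp only [hkModule_alg, mid_add, mid_lie, map_add, map_sub, hα, ΦA.rep_alg]
      abel
  grp_lie k x y := by
    have hα := (mem_invariantCochains_two_iff.1 z.α_mem).2 k
    simp only [← AlternatingMap.toBilin_apply] at hα
    have hρ : ∀ L A, ⁅Φ.grp k L, ΦA.grp k A⁆ = ΦA.grp k ⁅L, A⁆ := fun L A => by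
      rw [ΦA.rep_grp, HKModule.grp_inv_apply]
    refine ext_apply (fun W => ?_) ?_ (Φ.grp_lie k _ _)
    · obtain ⟨W, rfl⟩ : ∃ W', W = Φ.grp k W' := ⟨_, (Φ.grp_apply_inv k W).symm⟩
      have hγ := (mem_invariantScalarCochains_three_iff.1 z.γ_mem).2 k x.base y.base W
      simp only [← AlternatingMap.toTrilin_apply] at hγ
      simp only [hkModule_grp, dual_lie, HKModule.dual_grp_apply, HKModule.grp_inv_apply, hγ, hα,
        ΦA.grp_isometry, ← Φ.grp_lie, hρ]
    · simp only [hkModule_grp, mid_lie, map_add, map_sub, hα, hρ]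
  form := form z
  symm := form_isSymm
  nondegenerate := form_nondegenerate
  invariant := form_lieInvariant
  alg_skew X x y := by
    simp only [form_apply, hkModule_alg, HKModule.dual_alg_apply, ΦA.alg_skew]
    ring
  grp_isometry k x y := by
    simp only [form_apply, hkModule_grp, HKModule.dual_grp_apply, HKModule.grp_inv_apply,
      ΦA.grp_isometry]

end StandardModel

end Model

/-! ### The standard model as a quadratic extension with its evident section. -/

section Model

variable {𝔥 K : Type*} [LieRing 𝔥] [LieAlgebra ℝ 𝔥] [Group K] [TopologicalSpace K]
  {κ : HKPair 𝔥 K}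
  {𝔩 : Type u} [LieRing 𝔩] [LieAlgebra ℝ 𝔩] [Module.Finite ℝ 𝔩] {Φ : EquivariantLie κ 𝔩}
  {𝔞 : Type v} [AddCommGroup 𝔞] [Module ℝ 𝔞] [Module.Finite ℝ 𝔞] [LieRingModule 𝔩 𝔞]
  [LieModule ℝ 𝔩 𝔞] {ΦA : OrthogonalModule Φ 𝔞} [ContinuousInv K]

namespace StandardModel

/-- The ideal `𝔩^*` of the standard model. -/
def dualIdeal (z : QuadraticCocycle ΦA) : LieIdeal ℝ (StandardModel z) where
  carrier := {x | x.mid = 0 ∧ x.base = 0}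
  add_mem' := by
    rintro x y ⟨h, h'⟩ ⟨k, k'⟩
    exact ⟨by simp [h, k], by simp [h', k']⟩
  zero_mem' := ⟨rfl, rfl⟩
  smul_mem' := by
    rintro c x ⟨h, h'⟩
    exact ⟨by simp [h], by simp [h']⟩
  lie_mem := by
    rintro x y ⟨h, h'⟩
    exact ⟨by simp [mid_lie, h, h'], by simp [h']⟩

variable {z : QuadraticCocycle ΦA}

lemma mem_dualIdeal {x : StandardModel z} : x ∈ dualIdeal z ↔ x.mid = 0 ∧ x.base = 0 := Iff.rfl

lemma mk_eq_mk_iff {x y : StandardModel z} : LieSubmodule.Quotient.mk' (dualIdeal z) x =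
    LieSubmodule.Quotient.mk' (dualIdeal z) y ↔ x.mid = y.mid ∧ x.base = y.base := by
  rw [← sub_eq_zero, ← map_sub]
  refine (LieSubmodule.Quotient.mk_eq_zero (N := dualIdeal z)).trans ?_
  rw [mem_dualIdeal, mid_sub, base_sub, sub_eq_zero, sub_eq_zero]

/-- The map `𝔤 ⧸ 𝔩^* → 𝔩`. -/
def quotBase (z : QuadraticCocycle ΦA) : (StandardModel z ⧸ dualIdeal z) →ₗ⁅ℝ⁆ 𝔩 where
  toLinearMap := (dualIdeal z).toSubmodule.liftQ (baseHom : StandardModel z →ₗ⁅ℝ⁆ 𝔩).toLinearMap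
    (fun _ hx => hx.2)
  map_lie' := by
    intro x y
    obtain ⟨x, rfl⟩ := LieSubmodule.Quotient.surjective_mk' (dualIdeal z) x
    obtain ⟨y, rfl⟩ := LieSubmodule.Quotient.surjective_mk' (dualIdeal z) y
    rfl

lemma quotBase_mk (x : StandardModel z) :
    quotBase z (LieSubmodule.Quotient.mk' (dualIdeal z) x) = x.base := rfl

/-- The standard model as a quadratic extension. -/
def extension (z : QuadraticCocycle ΦA) : QuadraticExtension ΦA where
  carrier := StandardModel z
  metric := metric z
  ideal := dualIdeal z
  ideal_isotropic x hx y hy := by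
    change form z x y = 0
    rw [form_apply, hx.1, hx.2, hy.2]
    simp
  ideal_invariant := ⟨fun X x hx => ⟨by
      change ΦA.alg X x.mid = 0
      rw [hx.1, map_zero], by
      change Φ.alg X x.base = 0
      rw [hx.2, map_zero]⟩, fun k x hx => ⟨by
      change ΦA.grp k x.mid = 0
      rw [hx.1, map_zero], by
      change Φ.grp k x.base = 0
      rw [hx.2, map_zero]⟩⟩
  incl := (LieSubmodule.Quotient.mk' (dualIdeal z) :
    StandardModel z →ₗ[ℝ] StandardModel z ⧸ dualIdeal z) ∘ₗ ofMid z
  proj := quotBase z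
  incl_lie A B := by
    change LieSubmodule.Quotient.mk' (dualIdeal z) ⁅ofMid z A, ofMid z B⁆ =
      LieSubmodule.Quotient.mk' (dualIdeal z) 0
    rw [mk_eq_mk_iff]
    simp [mid_lie, ofMid]
  incl_alg X A x h := mk_eq_mk_iff.2 ⟨congrArg (ΦA.alg X) (mk_eq_mk_iff.1 h).1,
    (congrArg (Φ.alg X) (mk_eq_mk_iff.1 h).2).trans (map_zero _)⟩
  incl_grp k A x h := mk_eq_mk_iff.2 ⟨congrArg (ΦA.grp k) (mk_eq_mk_iff.1 h).1,
    (congrArg (Φ.grp k) (mk_eq_mk_iff.1 h).2).trans (map_zero _)⟩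
  proj_alg X x := rfl
  proj_grp k x := rfl
  incl_injective A B h := (mk_eq_mk_iff.1 h).1
  exact x := by
    obtain ⟨x, rfl⟩ := LieSubmodule.Quotient.surjective_mk' (dualIdeal z) x
    rw [quotBase_mk]
    constructor
    · intro h
      exact ⟨x.mid, mk_eq_mk_iff.2 ⟨rfl, h.symm⟩⟩
    · rintro ⟨A, h⟩
      exact (mk_eq_mk_iff.1 h).2.symm
  proj_surjective L := ⟨LieSubmodule.Quotient.mk' (dualIdeal z) (ofBase z L), rfl⟩
  lie_incl x A := by
    obtain ⟨x, rfl⟩ := LieSubmodule.Quotient.surjective_mk' (dualIdeal z) x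
    refine (mk_eq_mk_iff (x := ⁅x, ofMid z A⁆) (y := ofMid z ⁅x.base, A⁆)).2 ?_
    simp [mid_lie, ofMid]
  range_incl := by
    ext x
    obtain ⟨x, rfl⟩ := LieSubmodule.Quotient.surjective_mk' (dualIdeal z) x
    constructor
    · rintro ⟨A, h⟩
      refine ⟨ofMid z A, ?_, h⟩
      rintro y hy
      change form z y (ofMid z A) = 0
      rw [form_apply, hy.1, hy.2]
      simp [ofMid]
    · rintro ⟨y, hy, h⟩
      have h' := mk_eq_mk_iff.1 h
      refine ⟨y.mid, (show LieSubmodule.Quotient.mk' (dualIdeal z) (ofMid z y.mid) =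
        LieSubmodule.Quotient.mk' (dualIdeal z) y from mk_eq_mk_iff.2 ⟨rfl, ?_⟩).trans h⟩
      change 0 = y.base
      refine ((Module.forall_dual_apply_eq_zero_iff ℝ _).1 fun f => ?_).symm
      have := hy ⟨f, 0, 0⟩ ⟨rfl, rfl⟩
      change form z _ _ = 0 at this
      simpa [form_apply] using this
  incl_isometry A B x y hx hy := by
    change form z x y = _
    have h := mk_eq_mk_iff.1 hx
    have h' := mk_eq_mk_iff.1 hy
    rw [form_apply, h.1, h.2, h'.1, h'.2]
    simp [ofMid]

lemma isIsotropicSection_ofBase (z : QuadraticCocycle ΦA) :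
    (extension z).IsIsotropicSection (ofBase z) where
  proj _ := rfl
  alg X L := by
    change ofBase z _ = (hkModule z).alg X (ofBase z L)
    rw [hkModule_alg]
    ext <;> simp [ofBase]
  grp k L := by
    change ofBase z _ = (hkModule z).grp k (ofBase z L)
    rw [hkModule_grp]
    ext <;> simp [ofBase]
  isotropic L L' := by
    exact (form_apply (ofBase z L) (ofBase z L')).trans (by simp [ofBase])

lemma isCocycleOf_ofBase (z : QuadraticCocycle ΦA) : (extension z).IsCocycleOf (ofBase z) z := by
  constructor
  · intro L L'
    refine (mk_eq_mk_iff (x := ofMid z (z.α ![L, L']))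
      (y := ⁅ofBase z L, ofBase z L'⁆ - ofBase z ⁅L, L'⁆)).2 ?_
    simp [mid_lie, ofMid, ofBase, AlternatingMap.toBilin_apply]
  · intro L L' W
    refine Eq.trans ?_ (form_apply ⁅ofBase z L, ofBase z L'⁆ (ofBase z W)).symm
    rw [dual_lie, mid_lie]
    simp [ofBase, AlternatingMap.toTrilin_apply]

end StandardModel

end Model

/-! ### Isotropic sections and the decomposition of an extension. -/

section Extensions

variable {𝔥 K : Type*} [LieRing 𝔥] [LieAlgebra ℝ 𝔥] [Group K] [TopologicalSpace K]
  {κ : HKPair 𝔥 K}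
  {𝔩 : Type u} [LieRing 𝔩] [LieAlgebra ℝ 𝔩] [Module.Finite ℝ 𝔩] {Φ : EquivariantLie κ 𝔩}
  {𝔞 : Type v} [AddCommGroup 𝔞] [Module ℝ 𝔞] [Module.Finite ℝ 𝔞] [LieRingModule 𝔩 𝔞]
  [LieModule ℝ 𝔩 𝔞] {ΦA : OrthogonalModule Φ 𝔞}

namespace EquivariantMetricLie

variable {G : Type*} [LieRing G] [LieAlgebra ℝ G] (m : EquivariantMetricLie κ G)

lemma form_comm (x y : G) : m.form x y = m.form y x := m.symm.eq x y

lemma form_lie_left (x y w : G) : m.form ⁅x, y⁆ w = -m.form y ⁅x, w⁆ := m.invariant x y w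

lemma form_lie_assoc (x y w : G) : m.form ⁅x, y⁆ w = m.form x ⁅y, w⁆ := by
  rw [← lie_skew, map_neg, LinearMap.neg_apply, m.form_lie_left, neg_neg]

lemma eq_of_forall_form_eq {x y : G} (h : ∀ w, m.form x w = m.form y w) : x = y := by
  rw [← sub_eq_zero]
  refine m.nondegenerate.1 _ fun w => ?_
  rw [map_sub, LinearMap.sub_apply, h, sub_self]

end EquivariantMetricLie

namespace QuadraticExtension

variable (E : QuadraticExtension ΦA)

/-- The homomorphism `𝔤 → 𝔩` induced by `p`. -/
def pr : E.carrier →ₗ⁅ℝ⁆ 𝔩 where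
  toLinearMap := E.proj.toLinearMap ∘ₗ E.quot
  map_lie' {x y} := E.proj.map_lie (LieSubmodule.Quotient.mk' E.ideal x)
    (LieSubmodule.Quotient.mk' E.ideal y)

lemma pr_apply (x : E.carrier) : E.pr x = E.proj (E.quot x) := rfl

lemma pr_alg (X : 𝔥) (x : E.carrier) : E.pr (E.metric.alg X x) = Φ.alg X (E.pr x) :=
  E.proj_alg X x

lemma pr_grp (k : K) (x : E.carrier) : E.pr (E.metric.grp k x) = Φ.grp k (E.pr x) :=
  E.proj_grp k x

lemma pr_surjective : Function.Surjective E.pr :=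
  E.proj_surjective.comp E.quot_surjective

lemma quot_lie (x y : E.carrier) : E.quot ⁅x, y⁆ = ⁅E.quot x, E.quot y⁆ := rfl

lemma quot_eq_zero_iff {x : E.carrier} : E.quot x = 0 ↔ x ∈ E.ideal := by
  rw [← map_zero E.quot, quot_eq_quot_iff, sub_zero]

lemma pr_eq_zero_iff_exists {x : E.carrier} : E.pr x = 0 ↔ ∃ A, E.incl A = E.quot x :=
  E.exact (E.quot x)

lemma pr_eq_zero_of_mem_ideal {x : E.carrier} (h : x ∈ E.ideal) : E.pr x = 0 := by
  rw [pr_apply, E.quot_eq_zero_iff.2 h, map_zero]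

/-- The kernel of 𝔤 → 𝔩 is 𝔦^⊥: exactness identifies its image in 𝔤/𝔦 with that of 𝔦^⊥, and 𝔦 ⊆ 𝔦^⊥
makes the choice of representative irrelevant. -/
lemma pr_eq_zero_iff {x : E.carrier} : E.pr x = 0 ↔ ∀ y ∈ E.ideal, E.metric.form y x = 0 := by
  have h : E.pr x = 0 ↔ E.quot x ∈ LinearMap.range E.incl := E.pr_eq_zero_iff_exists
  rw [h, E.range_incl]
  constructor
  · rintro ⟨w, hw, hwx⟩ y hy
    have : x - w ∈ E.ideal := (E.quot_eq_quot_iff x w).1 hwx.symm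
    rw [← sub_add_cancel x w, map_add, E.ideal_isotropic y hy _ this, zero_add]
    exact hw y hy
  · intro h
    exact ⟨x, fun y hy => h y hy, rfl⟩

lemma mem_ideal_iff {x : E.carrier} :
    x ∈ E.ideal ↔ ∀ y, E.pr y = 0 → E.metric.form x y = 0 := by
  refine ⟨fun h y hy => E.pr_eq_zero_iff.1 hy x h, fun h => ?_⟩
  have h' := LinearMap.BilinForm.orthogonal_orthogonal E.metric.nondegenerate
    (LinearMap.BilinForm.IsSymm.isRefl E.metric.symm) E.ideal.toSubmodule
  rw [← LieSubmodule.mem_toSubmodule, ← h']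
  intro y hy
  have := h y (E.pr_eq_zero_iff.2 fun w hw => hy w hw)
  rwa [E.metric.form_comm] at this

/-- The embedding of `𝔩^*` onto the ideal, dual to the projection onto `𝔩`. -/
def ofDual : Module.Dual ℝ 𝔩 →ₗ[ℝ] E.carrier :=
  (LinearMap.BilinForm.toDual E.metric.form E.metric.nondegenerate).symm.toLinearMap ∘ₗ
    E.pr.toLinearMap.dualMap

lemma form_ofDual (Z : Module.Dual ℝ 𝔩) (x : E.carrier) :
    E.metric.form (E.ofDual Z) x = Z (E.pr x) :=
  LinearMap.BilinForm.apply_toDual_symm_apply (hB := E.metric.nondegenerate) _ _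

lemma ofDual_mem (Z : Module.Dual ℝ 𝔩) : E.ofDual Z ∈ E.ideal := by
  rw [mem_ideal_iff]
  intro y hy
  rw [form_ofDual, hy, map_zero]

lemma pr_ofDual (Z : Module.Dual ℝ 𝔩) : E.pr (E.ofDual Z) = 0 :=
  E.pr_eq_zero_of_mem_ideal (E.ofDual_mem Z)

lemma ofDual_alg (X : 𝔥) (Z Z' : Module.Dual ℝ 𝔩) (h : ∀ L, Z' L = -Z (Φ.alg X L)) :
    E.ofDual Z' = E.metric.alg X (E.ofDual Z) := by
  refine E.metric.eq_of_forall_form_eq fun w => ?_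
  rw [form_ofDual, E.metric.alg_skew, form_ofDual, h, pr_alg]

lemma ofDual_grp (k : K) (Z Z' : Module.Dual ℝ 𝔩) (h : ∀ L, Z' (Φ.grp k L) = Z L) :
    E.ofDual Z' = E.metric.grp k (E.ofDual Z) := by
  refine E.metric.eq_of_forall_form_eq fun w => ?_
  obtain ⟨w, rfl⟩ : ∃ w', w = E.metric.grp k w' := ⟨_, (E.metric.grp_apply_inv k w).symm⟩
  rw [form_ofDual, E.metric.grp_isometry, form_ofDual, pr_grp, h]

/-- The kernel of 𝔤 → 𝔩 has an invariant complement, which projects isomorphically onto 𝔩. -/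
lemma exists_equivariant_section : ∃ s : 𝔩 →ₗ[ℝ] E.carrier, (∀ L, E.pr (s L) = L) ∧
    (∀ X L, s (Φ.alg X L) = E.metric.alg X (s L)) ∧
    ∀ k L, s (Φ.grp k L) = E.metric.grp k (s L) := by
  obtain ⟨U, hU, hc⟩ := E.metric.semisimple (LinearMap.ker E.pr.toLinearMap)
    ⟨fun X x hx => by
      have hx' : E.pr x = 0 := hx
      change E.pr _ = 0
      rw [pr_alg, hx', map_zero],
    fun k x hx => by
      have hx' : E.pr x = 0 := hx
      change E.pr _ = 0
      rw [pr_grp, hx', map_zero]⟩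
  have hinj : ∀ x ∈ U, ∀ y ∈ U, E.pr x = E.pr y → x = y := by
    intro x hx y hy h
    have : x - y ∈ LinearMap.ker E.pr.toLinearMap ⊓ U :=
      ⟨by change E.pr (x - y) = 0; rw [map_sub, h, sub_self], U.sub_mem hx hy⟩
    rw [hc.inf_eq_bot, Submodule.mem_bot, sub_eq_zero] at this
    exact this
  have hsurj : ∀ L, ∃ x ∈ U, E.pr x = L := by
    intro L
    obtain ⟨x, rfl⟩ := E.pr_surjective L
    obtain ⟨y, hy, w, hw, rfl⟩ : ∃ y ∈ LinearMap.ker E.pr.toLinearMap, ∃ w ∈ U, y + w = x := by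
      rw [← Submodule.mem_sup, hc.sup_eq_top]
      trivial
    have hy' : E.pr y = 0 := hy
    exact ⟨w, hw, by rw [map_add, hy', zero_add]⟩
  let e : U ≃ₗ[ℝ] 𝔩 := LinearEquiv.ofBijective (E.pr.toLinearMap ∘ₗ U.subtype)
    ⟨fun x y h => Subtype.ext (hinj x x.2 y y.2 h), fun L => by
      obtain ⟨x, hx, h⟩ := hsurj L
      exact ⟨⟨x, hx⟩, h⟩⟩
  have he : ∀ L, E.pr (e.symm L : E.carrier) = L := e.apply_symm_apply
  refine ⟨U.subtype ∘ₗ e.symm.toLinearMap, he, fun X L => ?_, fun k L => ?_⟩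
  · refine hinj _ (e.symm _).2 _ (hU.1 X _ (e.symm L).2) ?_
    rw [pr_alg]
    exact (he _).trans (congrArg _ (he L)).symm
  · refine hinj _ (e.symm _).2 _ (hU.2 k _ (e.symm L).2) ?_
    rw [pr_grp]
    exact (he _).trans (congrArg _ (he L)).symm

/-- The correction by half the Gram form acts once in each slot, so together it removes ⟨s L, s L'⟩;
its square vanishes because 𝔦 is isotropic. Invariance of the metric makes the correction
equivariant. -/
lemma exists_isIsotropicSection : ∃ s : 𝔩 →ₗ[ℝ] E.carrier, E.IsIsotropicSection s := by
  obtain ⟨s, hs, halg, hgrp⟩ := E.exists_equivariant_section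
  let β : 𝔩 →ₗ[ℝ] Module.Dual ℝ 𝔩 := (1 / 2 : ℝ) • E.metric.form.compl₁₂ s s
  have hβ : ∀ L L', β L L' = 1 / 2 * E.metric.form (s L) (s L') := fun L L' => rfl
  refine ⟨s - E.ofDual ∘ₗ β, ⟨fun L => ?_, fun X L => ?_, fun k L => ?_, fun L L' => ?_⟩⟩
  · change E.pr (s L - E.ofDual (β L)) = L
    rw [map_sub, hs, pr_ofDual, sub_zero]
  · rw [LinearMap.sub_apply, LinearMap.sub_apply, map_sub, LinearMap.comp_apply,
      LinearMap.comp_apply, halg, E.ofDual_alg X (β L)]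
    intro L'
    rw [hβ, hβ, halg, halg, E.metric.alg_skew]
    ring
  · rw [LinearMap.sub_apply, LinearMap.sub_apply, map_sub, LinearMap.comp_apply,
      LinearMap.comp_apply, hgrp, E.ofDual_grp k (β L)]
    intro L'
    rw [hβ, hβ, hgrp, hgrp, E.metric.grp_isometry]
  · simp only [LinearMap.sub_apply, LinearMap.comp_apply, map_sub, form_ofDual, pr_ofDual, hs,
      E.metric.form_comm (s L) (E.ofDual _), hβ, map_zero]
    rw [E.metric.form_comm (s L') (s L)]
    ring

variable {E} {s : 𝔩 →ₗ[ℝ] E.carrier}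

lemma IsIsotropicSection.pr (hs : E.IsIsotropicSection s) (L : 𝔩) : E.pr (s L) = L := hs.proj L

/-- The component in `𝔞` of the decomposition of `𝔤` given by an isotropic section. -/
def IsIsotropicSection.mid (hs : E.IsIsotropicSection s) : E.carrier →ₗ[ℝ] 𝔞 :=
  (LinearEquiv.ofInjective E.incl E.incl_injective).symm.toLinearMap ∘ₗ
    LinearMap.codRestrict _ (E.quot ∘ₗ (LinearMap.id - s ∘ₗ E.pr.toLinearMap)) (fun x =>
      E.pr_eq_zero_iff_exists.1 (show E.pr (x - s (E.pr x)) = 0 by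
        rw [map_sub, hs.pr, sub_self]))

namespace IsIsotropicSection

lemma incl_mid (hs : E.IsIsotropicSection s) (x : E.carrier) :
    E.incl (hs.mid x) = E.quot (x - s (E.pr x)) :=
  congrArg Subtype.val ((LinearEquiv.ofInjective E.incl E.incl_injective).apply_symm_apply _)

lemma incl_mid_add (hs : E.IsIsotropicSection s) (x : E.carrier) :
    E.quot x = E.incl (hs.mid x) + E.quot (s (E.pr x)) := by
  rw [incl_mid, map_sub, sub_add_cancel]

lemma mid_eq_iff (hs : E.IsIsotropicSection s) (x : E.carrier) (A : 𝔞) :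
    hs.mid x = A ↔ E.quot x = E.incl A + E.quot (s (E.pr x)) := by
  rw [hs.incl_mid_add x]
  constructor
  · rintro rfl; rfl
  · intro h
    exact E.incl_injective (add_right_cancel h)

lemma mid_section (hs : E.IsIsotropicSection s) (L : 𝔩) : hs.mid (s L) = 0 := by
  rw [mid_eq_iff, hs.pr, map_zero, zero_add]

lemma mem_ideal_iff (hs : E.IsIsotropicSection s) (x : E.carrier) :
    x ∈ E.ideal ↔ hs.mid x = 0 ∧ E.pr x = 0 := by
  rw [← E.quot_eq_zero_iff]
  constructor
  · intro h
    have h' : E.pr x = 0 := by rw [pr_apply, h, map_zero]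
    rw [mid_eq_iff, h', h]
    simp
  · rintro ⟨h, h'⟩
    rw [hs.incl_mid_add, h, h']
    simp

lemma mid_eq_of_pr_eq_zero (hs : E.IsIsotropicSection s) {s' : 𝔩 →ₗ[ℝ] E.carrier}
    (hs' : E.IsIsotropicSection s') {x : E.carrier} (hx : E.pr x = 0) : hs'.mid x = hs.mid x := by
  rw [mid_eq_iff, hs.incl_mid_add x, hx]
  simp

/-- The vectors x - s(pr x) and y - s(pr y) lie in 𝔦^⊥, where the metric is that of 𝔞; the term ⟨s,
s⟩ vanishes by isotropy. -/
lemma form_eq (hs : E.IsIsotropicSection s) (x y : E.carrier) : E.metric.form x y =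
    E.metric.form x (s (E.pr y)) + E.metric.form (s (E.pr x)) y
      + ΦA.form (hs.mid x) (hs.mid y) := by
  have h := E.incl_isometry (hs.mid x) (hs.mid y) (x - s (E.pr x)) (y - s (E.pr y))
    (hs.incl_mid x).symm (hs.incl_mid y).symm
  simp only [map_sub, LinearMap.sub_apply, hs.isotropic] at h
  linear_combination h

lemma mid_alg (hs : E.IsIsotropicSection s) (X : 𝔥) (x : E.carrier) :
    hs.mid (E.metric.alg X x) = ΦA.alg X (hs.mid x) := by
  have h := E.incl_alg X (hs.mid x) (x - s (E.pr x)) (hs.incl_mid x).symm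
  rw [mid_eq_iff, ← h, pr_alg, hs.alg]
  change _ = E.quot _ + _
  rw [← map_add, map_sub, sub_add_cancel]

lemma mid_grp (hs : E.IsIsotropicSection s) (k : K) (x : E.carrier) :
    hs.mid (E.metric.grp k x) = ΦA.grp k (hs.mid x) := by
  have h := E.incl_grp k (hs.mid x) (x - s (E.pr x)) (hs.incl_mid x).symm
  rw [mid_eq_iff, ← h, pr_grp, hs.grp]
  change _ = E.quot _ + _
  rw [← map_add, map_sub, sub_add_cancel]

lemma mid_lie (hs : E.IsIsotropicSection s) (x y : E.carrier) : hs.mid ⁅x, y⁆ =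
    hs.mid ⁅s (E.pr x), s (E.pr y)⁆ + ⁅E.pr x, hs.mid y⁆ - ⁅E.pr y, hs.mid x⁆ := by
  have h₁ := hs.incl_mid_add ⁅s (E.pr x), s (E.pr y)⁆
  rw [LieHom.map_lie, hs.pr, hs.pr] at h₁
  have h₂ : ∀ L A, ⁅E.quot (s L), E.incl A⁆ = E.incl ⁅L, A⁆ := fun L A => by
    rw [E.lie_incl, ← pr_apply, hs.pr]
  have h₃ : ∀ L A, ⁅E.incl A, E.quot (s L)⁆ = -E.incl ⁅L, A⁆ := fun L A => by
    rw [← h₂, lie_skew]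
  rw [mid_eq_iff, quot_lie, hs.incl_mid_add x, hs.incl_mid_add y, LieHom.map_lie, add_lie, lie_add,
    lie_add, E.incl_lie, h₂, h₃, map_sub, map_add, ← quot_lie, h₁]
  abel

end IsIsotropicSection

end QuadraticExtension

end Extensions

/-! ### The cocycle of an isotropic section and its dependence on the section. -/

section Extensions

variable {𝔥 K : Type*} [LieRing 𝔥] [LieAlgebra ℝ 𝔥] [Group K] [TopologicalSpace K]
  {κ : HKPair 𝔥 K}
  {𝔩 : Type u} [LieRing 𝔩] [LieAlgebra ℝ 𝔩] [Module.Finite ℝ 𝔩] {Φ : EquivariantLie κ 𝔩}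
  {𝔞 : Type v} [AddCommGroup 𝔞] [Module ℝ 𝔞] [Module.Finite ℝ 𝔞] [LieRingModule 𝔩 𝔞]
  [LieModule ℝ 𝔩 𝔞] {ΦA : OrthogonalModule Φ 𝔞}

namespace QuadraticExtension

variable {E : QuadraticExtension ΦA} {s s' : 𝔩 →ₗ[ℝ] E.carrier}

lemma isCocycleOf_iff (hs : E.IsIsotropicSection s) {z : QuadraticCocycle ΦA} :
    E.IsCocycleOf s z ↔ (∀ x y, z.α.toBilin x y = hs.mid ⁅s x, s y⁆) ∧
      ∀ x y w, z.γ.toTrilin x y w = E.metric.form ⁅s x, s y⁆ (s w) := by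
  refine and_congr (forall₂_congr fun x y => ?_) Iff.rfl
  have h := hs.incl_mid ⁅s x, s y⁆
  rw [LieHom.map_lie, hs.pr, hs.pr] at h
  rw [← h, E.incl_injective.eq_iff]
  rfl

/-- The `𝔩^*`-component of a bracket. -/
lemma IsIsotropicSection.form_lie_section (hs : E.IsIsotropicSection s) (x y : E.carrier) (W : 𝔩) :
    E.metric.form ⁅x, y⁆ (s W) = E.metric.form ⁅s (E.pr x), s (E.pr y)⁆ (s W)
      - ΦA.form (hs.mid y) (hs.mid ⁅s (E.pr x), s W⁆)
      + ΦA.form (hs.mid x) (hs.mid ⁅s (E.pr y), s W⁆)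
      - E.metric.form y (s ⁅E.pr x, W⁆) + E.metric.form x (s ⁅E.pr y, W⁆)
      + ΦA.form (hs.mid y) ⁅W, hs.mid x⁆ := by
  have h₁ := hs.form_eq y ⁅x, s W⁆
  have h₂ := hs.form_eq x ⁅s (E.pr y), s W⁆
  rw [LieHom.map_lie, hs.pr, hs.mid_lie, hs.mid_section, hs.pr, lie_zero, add_zero, map_sub] at h₁
  rw [LieHom.map_lie, hs.pr, hs.pr] at h₂
  have h₃ : E.metric.form (s (E.pr y)) ⁅x, s W⁆ = -E.metric.form x ⁅s (E.pr y), s W⁆ := by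
    rw [← E.metric.form_lie_assoc, ← E.metric.form_lie_assoc, ← lie_skew, map_neg,
      LinearMap.neg_apply]
  have h₄ : E.metric.form (s (E.pr x)) ⁅s (E.pr y), s W⁆ =
      E.metric.form ⁅s (E.pr x), s (E.pr y)⁆ (s W) := (E.metric.form_lie_assoc _ _ _).symm
  rw [E.metric.form_lie_left]
  linear_combination -h₁ - h₃ + h₂ + h₄

/-- The 𝔞-component of the Jacobi identity for three section vectors is dα = 0. Paired with a fourth
section vector, it becomes a relation among products of two brackets, and this is dγ = ½⟨α ∧ α⟩. -/
lemma exists_isCocycleOf (hs : E.IsIsotropicSection s) :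
    ∃ z : QuadraticCocycle ΦA, E.IsCocycleOf s z := by
  let f : 𝔩 →ₗ[ℝ] 𝔩 →ₗ[ℝ] E.carrier := (lieBracketBilin E.carrier).compl₁₂ s s
  let α : 𝔩 [⋀^Fin 2]→ₗ[ℝ] 𝔞 := alternatingOfBilin (f.compr₂ hs.mid) (fun x => by
    change hs.mid ⁅s x, s x⁆ = 0
    rw [lie_self, map_zero])
  let γ : 𝔩 [⋀^Fin 3]→ₗ[ℝ] ℝ := alternatingOfTrilin (f.compr₂ (E.metric.form.compl₂ s))
    (fun x w => by
      change E.metric.form ⁅s x, s x⁆ (s w) = 0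
      rw [lie_self, map_zero, LinearMap.zero_apply])
    (fun x y => by
      change E.metric.form ⁅s x, s y⁆ (s y) = 0
      rw [E.metric.form_lie_assoc, lie_self, map_zero])
  have hα : ∀ x y, α.toBilin x y = hs.mid ⁅s x, s y⁆ := fun x y => rfl
  have hγ : ∀ x y w, γ.toTrilin x y w = E.metric.form ⁅s x, s y⁆ (s w) := fun x y w => rfl
  refine ⟨⟨α, γ, ?_, ?_, ?_, ?_⟩, (isCocycleOf_iff hs).2 ⟨hα, hγ⟩⟩
  · rw [mem_invariantCochains_two_iff]
    simp only [← AlternatingMap.toBilin_apply, hα, hs.alg, hs.grp]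
    refine ⟨fun X x y => ?_, fun k x y => ?_⟩
    · rw [← hs.mid_alg, E.metric.alg_lie, map_add]
    · rw [← hs.mid_grp, E.metric.grp_lie]
  · rw [mem_invariantScalarCochains_three_iff]
    simp only [← AlternatingMap.toTrilin_apply, hγ, hs.alg, hs.grp]
    refine ⟨fun X x y w => ?_, fun k x y w => ?_⟩
    · rw [← LinearMap.add_apply, ← map_add, ← E.metric.alg_lie, E.metric.alg_skew, neg_add_cancel]
    · rw [← E.metric.grp_lie, E.metric.grp_isometry]
  · rw [dRep_two_eq_zero_iff]
    intro x y w
    have h := congrArg hs.mid (leibniz_lie (s x) (s y) (s w))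
    rw [map_add, hs.mid_lie (s x), hs.mid_lie ⁅s x, s y⁆, hs.mid_lie (s y) ⁅s x, s w⁆] at h
    simp only [hs.pr, LieHom.map_lie, hs.mid_section, lie_zero, sub_zero, add_zero, ← hα] at h
    rw [α.toBilin_swap x ⁅y, w⁆, α.toBilin_swap y ⁅x, w⁆] at h
    rw [← sub_eq_zero] at h
    rw [← h]
    abel
  · rw [dTriv_three_eq_iff]
    intro x y w t
    -- Both brackets are decomposed along the section by `form_eq`.
    have key : ∀ x y w t, E.metric.form ⁅s x, s y⁆ ⁅s w, s t⁆ =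
        γ.toTrilin ⁅x, y⁆ w t + γ.toTrilin ⁅w, t⁆ x y
          + ΦA.form (α.toBilin x y) (α.toBilin w t) := by
      intro x y w t
      rw [hs.form_eq, E.metric.form_comm (s _)]
      simp only [LieHom.map_lie, hs.pr]
      rw [← hγ, ← hγ, ← hα, ← hα, γ.toTrilin_rotate, γ.toTrilin_rotate w]
      ring
    have h := E.metric.form_lie_assoc (s x) (s y) ⁅s w, s t⁆
    have h' : E.metric.form (s x) ⁅s y, ⁅s w, s t⁆⁆ =
        E.metric.form ⁅s x, s w⁆ ⁅s y, s t⁆ - E.metric.form ⁅s x, s t⁆ ⁅s y, s w⁆ := by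
      rw [E.metric.form_lie_assoc, E.metric.form_lie_assoc, ← map_sub, leibniz_lie (s y)]
      rw [← lie_skew (s t) ⁅s y, s w⁆]
      congr 1
      abel
    rw [h', key, key, key] at h
    linear_combination -h

/-- Here τ is the 𝔞-component of `s'` relative to `s`, and σ its 𝔩^*-component shifted by ½⟨τ, τ⟩.
-/
lemma IsCocycleOf.isTranslate (hs : E.IsIsotropicSection s) (hs' : E.IsIsotropicSection s')
    {z z' : QuadraticCocycle ΦA} (hz : E.IsCocycleOf s z) (hz' : E.IsCocycleOf s' z')
    {c : QuadraticCochain ΦA} (hτ : ∀ x, c.τ ![x] = hs.mid (s' x))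
    (hσ : ∀ x y, c.σ ![x, y] = E.metric.form (s' x) (s y)
      + 1 / 2 * ΦA.form (c.τ ![x]) (c.τ ![y])) : z.IsTranslate c z' := by
  rw [isCocycleOf_iff hs] at hz
  rw [isCocycleOf_iff hs'] at hz'
  have hα : ∀ x y, z'.α.toBilin x y = z.α.toBilin x y +
      (⁅x, c.τ ![y]⁆ - ⁅y, c.τ ![x]⁆ - c.τ ![⁅x, y⁆]) := by
    intro x y
    have h₀ : E.pr (⁅s' x, s' y⁆ - s' ⁅x, y⁆) = 0 := by
      rw [map_sub, LieHom.map_lie, hs'.pr, hs'.pr, hs'.pr, sub_self]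
    have h := hs.mid_eq_of_pr_eq_zero hs' h₀
    rw [map_sub, map_sub, hs'.mid_section, sub_zero, hs.mid_lie] at h
    rw [hz'.1, h, hs'.pr, hs'.pr, hz.1, hτ, hτ, hτ]
    abel
  refine IsTranslate_iff.2 ⟨hα, fun x y w => ?_⟩
  simp only [← AlternatingMap.toBilin_apply, ← AlternatingMap.toTrilin_apply] at *
  have h₁ := hs.form_eq ⁅s' x, s' y⁆ (s' w)
  have h₂ := hs.form_lie_section (s' x) (s' y) w
  have h₃ := hs.mid_lie (s' x) (s' y)
  rw [LieHom.map_lie, hs'.pr, hs'.pr, hs'.pr, h₃, h₂, hs'.pr, hs'.pr,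
    E.metric.form_comm (s _)] at h₁
  simp only [← hz.1, ← hz.2, ← hτ] at h₁
  rw [hz'.2, h₁]
  rw [c.σ.toBilin_swap ⁅x, y⁆, c.σ.toBilin_swap ⁅x, w⁆, c.σ.toBilin_swap ⁅y, w⁆]
  simp only [hσ]
  simp only [map_add, map_sub, map_smul, LinearMap.add_apply, LinearMap.sub_apply,
    LinearMap.smul_apply, smul_eq_mul]
  have hq : ∀ L A B, ΦA.form ⁅L, A⁆ B = -ΦA.form ⁅L, B⁆ A :=
    fun L A B => by rw [ΦA.rep_skew, ΦA.form_comm]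
  linear_combination 1 / 2 * hq x (c.τ ![y]) (c.τ ![w]) - 1 / 2 * hq y (c.τ ![x]) (c.τ ![w])
    + ΦA.form_comm (c.τ ![y]) ⁅w, c.τ ![x]⁆ + 1 / 2 * hq w (c.τ ![x]) (c.τ ![y])
    - ΦA.form_comm (c.τ ![y]) (z.α.toBilin x w) + ΦA.form_comm (c.τ ![x]) (z.α.toBilin y w)
    - 1 / 2 * ΦA.form_comm (c.τ ![w]) (c.τ ![⁅x, y⁆])
    + 1 / 2 * ΦA.form_comm (c.τ ![y]) (c.τ ![⁅x, w⁆])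
    - 1 / 2 * ΦA.form_comm (c.τ ![x]) (c.τ ![⁅y, w⁆])

lemma IsCocycleOf.exists_isTranslate (hs : E.IsIsotropicSection s) (hs' : E.IsIsotropicSection s')
    {z z' : QuadraticCocycle ΦA} (hz : E.IsCocycleOf s z) (hz' : E.IsCocycleOf s' z') :
    ∃ c, z.IsTranslate c z' := by
  let τ : 𝔩 [⋀^Fin 1]→ₗ[ℝ] 𝔞 :=
    AlternatingMap.ofSubsingleton ℝ 𝔩 𝔞 (0 : Fin 1) (hs.mid ∘ₗ s')
  have hτ : ∀ x, τ ![x] = hs.mid (s' x) := fun x => rfl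
  let f : 𝔩 →ₗ[ℝ] 𝔩 →ₗ[ℝ] ℝ := E.metric.form.compl₁₂ s' s +
    (1 / 2 : ℝ) • ΦA.form.compl₁₂ (hs.mid ∘ₗ s') (hs.mid ∘ₗ s')
  have hf : ∀ x y, f x y = E.metric.form (s' x) (s y)
      + 1 / 2 * ΦA.form (τ ![x]) (τ ![y]) := fun x y => rfl
  -- The shift makes σ alternating: isotropy of `s'` reads 0 = 2⟨s' x, s x⟩ + ⟨τ x, τ x⟩.
  let σ : 𝔩 [⋀^Fin 2]→ₗ[ℝ] ℝ := alternatingOfBilin f (fun x => by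
    have h := hs.form_eq (s' x) (s' x)
    rw [hs'.isotropic, hs'.pr, E.metric.form_comm (s x)] at h
    rw [hf, hτ]
    linarith)
  have hσ : ∀ x y, σ ![x, y] = f x y := fun x y => rfl
  have hτm : τ ∈ invariantCochains ΦA 1 := by
    rw [mem_invariantCochains_one_iff]
    simp only [hτ, hs'.alg, hs'.grp, hs.mid_alg, hs.mid_grp]
    simp
  have hσm : σ ∈ invariantScalarCochains Φ 2 := by
    rw [mem_invariantScalarCochains_two_iff]
    simp only [hσ, hf, hτ, hs'.alg, hs'.grp, hs.mid_alg, hs.mid_grp, hs.alg, hs.grp,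
      E.metric.alg_skew, ΦA.alg_skew, E.metric.grp_isometry, ΦA.grp_isometry]
    exact ⟨fun _ _ _ => by ring, fun _ _ _ => trivial⟩
  exact ⟨⟨τ, σ, hτm, hσm⟩, hz.isTranslate hs hs' hz' hτ hf⟩

end QuadraticExtension

end Extensions

/-! ### Comparison with the standard model, and the bijection on classes. -/

section Extensions

variable {𝔥 K : Type*} [LieRing 𝔥] [LieAlgebra ℝ 𝔥] [Group K] [TopologicalSpace K]
  {κ : HKPair 𝔥 K}
  {𝔩 : Type u} [LieRing 𝔩] [LieAlgebra ℝ 𝔩] [Module.Finite ℝ 𝔩] {Φ : EquivariantLie κ 𝔩}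
  {𝔞 : Type v} [AddCommGroup 𝔞] [Module ℝ 𝔞] [Module.Finite ℝ 𝔞] [LieRingModule 𝔩 𝔞]
  [LieModule ℝ 𝔩 𝔞] {ΦA : OrthogonalModule Φ 𝔞}

namespace QuadraticExtension

section ToModel

variable {E : QuadraticExtension ΦA} {s : 𝔩 →ₗ[ℝ] E.carrier}

/-- The comparison of a quadratic extension with the standard model of a cocycle. -/
def IsIsotropicSection.toModel (hs : E.IsIsotropicSection s) (z : QuadraticCocycle ΦA) :
    E.carrier →ₗ[ℝ] StandardModel z where
  toFun x := ⟨E.metric.form.compl₂ s x, hs.mid x, E.pr x⟩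
  map_add' x y := by ext <;> simp
  map_smul' c x := by ext <;> simp

variable (hs : E.IsIsotropicSection s) {z : QuadraticCocycle ΦA}

lemma IsIsotropicSection.toModel_dual (x : E.carrier) (W : 𝔩) :
    (hs.toModel z x).dual W = E.metric.form x (s W) := rfl

lemma IsIsotropicSection.toModel_mid (x : E.carrier) : (hs.toModel z x).mid = hs.mid x := rfl

lemma IsIsotropicSection.toModel_base (x : E.carrier) : (hs.toModel z x).base = E.pr x := rfl

lemma IsIsotropicSection.form_toModel (x y : E.carrier) :
    StandardModel.form z (hs.toModel z x) (hs.toModel z y) = E.metric.form x y := by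
  rw [StandardModel.form_apply, toModel_dual, toModel_dual, toModel_mid, toModel_mid, toModel_base,
    toModel_base, hs.form_eq x y, E.metric.form_comm (s _)]

/-- Preserving a non-degenerate form gives injectivity. A preimage is a lift of `A` plus `s L`,
corrected in 𝔦 to have the prescribed 𝔩^*-component. -/
lemma IsIsotropicSection.toModel_bijective : Function.Bijective (hs.toModel z) := by
  constructor
  · refine (injective_iff_map_eq_zero _).2 fun x hx => E.metric.nondegenerate.1 x fun y => ?_
    rw [← hs.form_toModel (z := z), hx, map_zero, LinearMap.zero_apply]
  · rintro ⟨Z, A, L⟩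
    obtain ⟨x, hx⟩ := E.quot_surjective (E.incl A)
    have hx' : E.pr x = 0 := E.pr_eq_zero_iff_exists.2 ⟨A, hx.symm⟩
    have hm : hs.mid x = A := by rw [hs.mid_eq_iff, hx, hx']; simp
    have hd : ∀ Z, hs.mid (E.ofDual Z) = 0 := fun Z => ((hs.mem_ideal_iff _).1 (E.ofDual_mem Z)).1
    refine ⟨E.ofDual (Z - E.metric.form.compl₂ s x) + x + s L,
      StandardModel.ext_apply (fun W => ?_) ?_ ?_⟩
    · rw [toModel_dual, map_add, map_add, LinearMap.add_apply, LinearMap.add_apply, E.form_ofDual,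
        hs.pr, hs.isotropic]
      simp
    · rw [toModel_mid, map_add, map_add, hd, hm, hs.mid_section, zero_add, add_zero]
    · rw [toModel_base, map_add, map_add, E.pr_ofDual, hx', hs.pr, zero_add, zero_add]

lemma IsIsotropicSection.toModel_lie (hz : E.IsCocycleOf s z) (x y : E.carrier) :
    hs.toModel z ⁅x, y⁆ = ⁅hs.toModel z x, hs.toModel z y⁆ := by
  rw [isCocycleOf_iff hs] at hz
  refine StandardModel.ext_apply (fun W => ?_) ?_ ?_
  · rw [StandardModel.dual_lie]
    simp only [toModel_dual, toModel_mid, toModel_base, hz.1, hz.2]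
    exact hs.form_lie_section x y W
  · rw [StandardModel.mid_lie]
    simp only [toModel_mid, toModel_base, hz.1]
    exact hs.mid_lie x y
  · rw [StandardModel.base_lie]
    exact E.pr.map_lie x y

/-- A quadratic extension is equivalent to the standard model of its cocycle. -/
lemma IsCocycleOf.exists_isEquivalence [ContinuousInv K] (hs : E.IsIsotropicSection s)
    (hz : E.IsCocycleOf s z) :
    ∃ F, IsEquivalence E (StandardModel.extension z) F := by
  let F : E.carrier ≃ₗ⁅ℝ⁆ StandardModel z := LieEquiv.ofBijective
    { hs.toModel z with map_lie' := hs.toModel_lie hz _ _ } hs.toModel_bijective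
  refine ⟨F, ⟨fun X x => ?_, fun k x => ?_, fun x y => hs.form_toModel x y, fun x => ?_,
    fun A x hx => ?_, fun x => rfl⟩⟩
  · refine StandardModel.ext_apply (fun W => ?_) (hs.mid_alg X x) (E.pr_alg X x)
    refine (E.metric.alg_skew X x (s W)).trans ?_
    rw [← hs.alg]
    rfl
  · refine StandardModel.ext_apply (fun W => ?_) (hs.mid_grp k x) (E.pr_grp k x)
    obtain ⟨W, rfl⟩ : ∃ W', W = Φ.grp k W' := ⟨_, (Φ.grp_apply_inv k W).symm⟩
    have h : E.metric.form (E.metric.grp k x) (s (Φ.grp k W)) = E.metric.form x (s W) := by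
      rw [hs.grp, E.metric.grp_isometry]
    refine h.trans ?_
    exact (congrArg (fun L => E.metric.form x (s L)) (Φ.grp_inv_apply k W)).symm
  · exact (hs.mem_ideal_iff x).symm
  · have hx' : E.pr x = 0 := E.pr_eq_zero_iff_exists.2 ⟨A, hx.symm⟩
    refine (StandardModel.mk_eq_mk_iff (x := hs.toModel z x) (y := StandardModel.ofMid z A)).2
      ⟨?_, hx'⟩
    rw [hs.toModel_mid, hs.mid_eq_iff, hx, hx']
    simp [StandardModel.ofMid]

end ToModel

variable {E E₁ E₂ : QuadraticExtension ΦA}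

lemma IsEquivalence.isIsotropicSection {F : E₁.carrier ≃ₗ⁅ℝ⁆ E₂.carrier}
    (hF : IsEquivalence E₁ E₂ F) {s : 𝔩 →ₗ[ℝ] E₁.carrier} (hs : E₁.IsIsotropicSection s) :
    E₂.IsIsotropicSection ((F : E₁.carrier →ₗ⁅ℝ⁆ E₂.carrier).toLinearMap ∘ₗ s) where
  proj L := (hF.proj (s L)).trans (hs.proj L)
  alg X L := by
    change F (s _) = E₂.metric.alg X (F (s L))
    rw [hs.alg, hF.alg]
  grp k L := by
    change F (s _) = E₂.metric.grp k (F (s L))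
    rw [hs.grp, hF.grp]
  isotropic L L' := (hF.isometry _ _).trans (hs.isotropic L L')

lemma IsEquivalence.isCocycleOf {F : E₁.carrier ≃ₗ⁅ℝ⁆ E₂.carrier}
    (hF : IsEquivalence E₁ E₂ F) {s : 𝔩 →ₗ[ℝ] E₁.carrier} {z : QuadraticCocycle ΦA}
    (hz : E₁.IsCocycleOf s z) :
    E₂.IsCocycleOf ((F : E₁.carrier →ₗ⁅ℝ⁆ E₂.carrier).toLinearMap ∘ₗ s) z := by
  refine ⟨fun L L' => ?_, fun L L' W => (hz.2 L L' W).trans ?_⟩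
  · change _ = E₂.quot (⁅F (s L), F (s L')⁆ - F (s ⁅L, L'⁆))
    rw [← LieEquiv.map_lie, ← map_sub, hF.incl (z.α ![L, L'])]
    exact (hz.1 L L').symm
  · change _ = E₂.metric.form ⁅F (s L), F (s L')⁆ (F (s W))
    rw [← LieEquiv.map_lie, hF.isometry]

/-- The cohomology class of a quadratic extension. -/
def cohomologyClass (E : QuadraticExtension ΦA) : QuadraticCohomology ΦA :=
  (exists_isCocycleOf E.exists_isIsotropicSection.choose_spec).choose.cls

lemma IsCocycleOf.cls_eq {s : 𝔩 →ₗ[ℝ] E.carrier} (hs : E.IsIsotropicSection s)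
    {z : QuadraticCocycle ΦA} (hz : E.IsCocycleOf s z) : E.cohomologyClass = z.cls :=
  Quotient.sound ((exists_isCocycleOf E.exists_isIsotropicSection.choose_spec).choose_spec
    |>.exists_isTranslate E.exists_isIsotropicSection.choose_spec hs hz)

lemma cohomologyClass_eq_of_equivalence (h : equivalence ΦA E₁ E₂) :
    E₁.cohomologyClass = E₂.cohomologyClass := by
  obtain ⟨F, hF⟩ := h
  obtain ⟨s, hs⟩ := E₁.exists_isIsotropicSection
  obtain ⟨z, hz⟩ := exists_isCocycleOf hs
  rw [hz.cls_eq hs, (hF.isCocycleOf hz).cls_eq (hF.isIsotropicSection hs)]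

lemma cohomologyClass_extension [ContinuousInv K] (z : QuadraticCocycle ΦA) :
    (StandardModel.extension z).cohomologyClass = z.cls :=
  (StandardModel.isCocycleOf_ofBase z).cls_eq (StandardModel.isIsotropicSection_ofBase z)

/-- A cocycle and its translates have equivalent standard models. -/
lemma equivalence_extension_of_isTranslate [ContinuousInv K] {z z' : QuadraticCocycle ΦA}
    {c : QuadraticCochain ΦA} (h : z.IsTranslate c z') :
    equivalence ΦA (StandardModel.extension z) (StandardModel.extension z') := by
  -- The section with 𝔞-component τ and 𝔩^*-component σ - ½⟨τ, τ⟩, inverting the formulas of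
  -- `IsCocycleOf.isTranslate`.
  let s : 𝔩 →ₗ[ℝ] StandardModel z := StandardModel.ofBase z
    + StandardModel.ofMid z ∘ₗ cochainOne c.τ
    + StandardModel.ofDual z ∘ₗ (c.σ.toBilin
      - (1 / 2 : ℝ) • ΦA.form.compl₁₂ (cochainOne c.τ) (cochainOne c.τ))
  have hb : ∀ L, (s L).base = L := fun L => by
    simp [s, StandardModel.ofBase, StandardModel.ofMid, StandardModel.ofDual]
  have hm : ∀ L, (s L).mid = c.τ ![L] := fun L => by
    simp [s, StandardModel.ofBase, StandardModel.ofMid, StandardModel.ofDual, cochainOne]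
  have hd : ∀ L W, (s L).dual W = c.σ ![L, W] - 1 / 2 * ΦA.form (c.τ ![L]) (c.τ ![W]) :=
    fun L W => by
      simp [s, StandardModel.ofBase, StandardModel.ofMid, StandardModel.ofDual, cochainOne,
        AlternatingMap.toBilin_apply]
  have hτ := mem_invariantCochains_one_iff.1 c.τ_mem
  have hσ := mem_invariantScalarCochains_two_iff.1 c.σ_mem
  have hs : (StandardModel.extension z).IsIsotropicSection s := by
    refine ⟨fun L => hb L, fun X L => ?_, fun k L => ?_, fun L L' => ?_⟩
    · refine StandardModel.ext_apply (fun W => ?_) ?_ ?_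
      · refine (hd _ _).trans (Eq.trans ?_ (congrArg Neg.neg (hd L (Φ.alg X W))).symm)
        have := hσ.1 X L W
        rw [← hτ.1, ← hτ.1, ΦA.alg_skew]
        linarith
      · refine (hm _).trans (Eq.trans ?_ (congrArg (ΦA.alg X) (hm L)).symm)
        rw [hτ.1]
      · exact (hb _).trans (congrArg (Φ.alg X) (hb L)).symm
    · refine StandardModel.ext_apply (fun W => ?_) ?_ ?_
      · refine (hd _ _).trans (Eq.trans ?_ (hd L (Φ.grp k⁻¹ W)).symm)
        obtain ⟨W, rfl⟩ : ∃ W', W = Φ.grp k W' := ⟨_, (Φ.grp_apply_inv k W).symm⟩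
        rw [Φ.grp_inv_apply, hσ.2, hτ.2, hτ.2, ΦA.grp_isometry]
      · refine (hm _).trans (Eq.trans ?_ (congrArg (ΦA.grp k) (hm L)).symm)
        rw [hτ.2]
      · exact (hb _).trans (congrArg (Φ.grp k) (hb L)).symm
    · refine (StandardModel.form_apply (s L) (s L')).trans ?_
      have := c.σ.toBilin_swap L L'
      rw [AlternatingMap.toBilin_apply, AlternatingMap.toBilin_apply] at this
      rw [hb, hb, hm, hm, hd, hd, this, ΦA.form_comm (c.τ ![L])]
      ring
  have hs₀ := StandardModel.isIsotropicSection_ofBase z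
  obtain ⟨z'', hz''⟩ := exists_isCocycleOf hs
  have ht : z.IsTranslate c z'' := by
    have hm' : ∀ x, hs₀.mid (s x) = c.τ ![x] := fun x => by
      refine (hs₀.mid_eq_iff _ _).2 ((StandardModel.mk_eq_mk_iff (x := s x)
        (y := StandardModel.ofMid z (c.τ ![x]) + StandardModel.ofBase z (s x).base)).2 ⟨?_, ?_⟩)
      · rw [hm]
        simp [StandardModel.ofMid, StandardModel.ofBase]
      · simp [StandardModel.ofMid, StandardModel.ofBase]
    refine (StandardModel.isCocycleOf_ofBase z).isTranslate hs₀ hs hz'' (fun x => (hm' x).symm)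
      fun x y => ?_
    have h' : StandardModel.form z (s x) (StandardModel.ofBase z y) = (s x).dual y :=
      (StandardModel.form_apply (s x) (StandardModel.ofBase z y)).trans (by
        simp [StandardModel.ofBase])
    rw [hd] at h'
    exact (sub_eq_iff_eq_add.1 h'.symm)
  -- A translate is determined by `z` and `c`, so the cocycle of `s` is `z'` itself.
  obtain rfl : z' = z'' := by
    cases z'; cases z''
    simp only [QuadraticCocycle.mk.injEq]
    exact ⟨DFunLike.coe_injective (h.1.trans ht.1.symm),
      DFunLike.coe_injective (h.2.trans ht.2.symm)⟩
  obtain ⟨F, hF⟩ := IsCocycleOf.exists_isEquivalence hs hz''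
  exact ⟨F, hF⟩

lemma equivalence_of_cohomologyClass_eq [ContinuousInv K]
    (h : E₁.cohomologyClass = E₂.cohomologyClass) : equivalence ΦA E₁ E₂ := by
  obtain ⟨s₁, hs₁⟩ := E₁.exists_isIsotropicSection
  obtain ⟨s₂, hs₂⟩ := E₂.exists_isIsotropicSection
  obtain ⟨z₁, hz₁⟩ := exists_isCocycleOf hs₁
  obtain ⟨z₂, hz₂⟩ := exists_isCocycleOf hs₂
  rw [hz₁.cls_eq hs₁, hz₂.cls_eq hs₂] at h
  obtain ⟨c, hc⟩ := Quotient.exact h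
  refine (equivalence ΦA).trans (IsCocycleOf.exists_isEquivalence hs₁ hz₁)
    ((equivalence ΦA).trans (equivalence_extension_of_isTranslate hc) ?_)
  exact (equivalence ΦA).symm (IsCocycleOf.exists_isEquivalence hs₂ hz₂)

/-- The map from equivalence classes of quadratic extensions to quadratic cohomology. -/
def classMap (ΦA : OrthogonalModule Φ 𝔞) : Classes ΦA → QuadraticCohomology ΦA :=
  Quotient.lift cohomologyClass fun _ _ h => cohomologyClass_eq_of_equivalence h

lemma classMap_bijective [ContinuousInv K] (ΦA : OrthogonalModule Φ 𝔞) :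
    Function.Bijective (classMap ΦA) := by
  constructor
  · intro c c'
    induction c using Quotient.inductionOn
    induction c' using Quotient.inductionOn
    exact fun h => Quotient.sound (equivalence_of_cohomologyClass_eq h)
  · intro c
    induction c using Quotient.inductionOn with | h z => ?_
    exact ⟨(StandardModel.extension z).cls, cohomologyClass_extension z⟩

end QuadraticExtension

end Extensions

/-! ### Orthogonal complements of ideals in metric Lie algebras -/

section MetricLie

variable {G : Type*} [LieRing G] [LieAlgebra ℝ G]

/-- An `ad`-invariant inner product. -/
structure IsInvariantInnerProduct (B : LinearMap.BilinForm ℝ G) : Prop where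
  symm : B.IsSymm
  nondegenerate : B.Nondegenerate
  invariant : B.lieInvariant G

namespace IsInvariantInnerProduct

variable {B : LinearMap.BilinForm ℝ G}

lemma comm (hB : IsInvariantInnerProduct B) (x y : G) : B x y = B y x := hB.symm.eq x y

lemma lie_left (hB : IsInvariantInnerProduct B) (x y w : G) : B ⁅x, y⁆ w = -B y ⁅x, w⁆ :=
  hB.invariant x y w

lemma lie_assoc (hB : IsInvariantInnerProduct B) (x y w : G) : B ⁅x, y⁆ w = B x ⁅y, w⁆ := by
  rw [← lie_skew, map_neg, LinearMap.neg_apply, hB.lie_left, neg_neg]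

lemma mem_center_iff (hB : IsInvariantInnerProduct B) {x : G} :
    x ∈ LieAlgebra.center ℝ G ↔ ∀ y w : G, B ⁅y, w⁆ x = 0 := by
  rw [LieModule.mem_maxTrivSubmodule]
  constructor
  · intro h y w
    rw [hB.lie_assoc, h, map_zero]
  · intro h y
    refine hB.nondegenerate.1 _ fun w => ?_
    rw [hB.lie_left, hB.comm, h, neg_zero]

variable (hB : IsInvariantInnerProduct B)

/-- The orthogonal complement of an ideal. -/
def orth (_ : IsInvariantInnerProduct B) (I : LieIdeal ℝ G) : LieIdeal ℝ G :=
  LieAlgebra.InvariantForm.orthogonal B ‹IsInvariantInnerProduct B›.invariant I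

lemma mem_orth {I : LieIdeal ℝ G} {y : G} : y ∈ hB.orth I ↔ ∀ x ∈ I, B x y = 0 :=
  LieAlgebra.InvariantForm.mem_orthogonal ..

lemma orth_anti {I J : LieIdeal ℝ G} (h : I ≤ J) : hB.orth J ≤ hB.orth I := fun _ hx =>
  hB.mem_orth.2 fun y hy => hB.mem_orth.1 hx y (h hy)

lemma le_orth_iff {I J : LieIdeal ℝ G} : I ≤ hB.orth J ↔ ∀ x ∈ I, ∀ y ∈ J, B x y = 0 :=
  ⟨fun h _ hx y hy => by rw [hB.comm]; exact hB.mem_orth.1 (h hx) y hy,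
    fun h x hx => hB.mem_orth.2 fun y hy => by rw [hB.comm]; exact h x hx y hy⟩

lemma lie_eq_zero_of_le_orth {I J : LieIdeal ℝ G} (h : I ≤ hB.orth J) {x y : G} (hx : x ∈ I)
    (hy : y ∈ J) : ⁅x, y⁆ = 0 := by
  refine hB.nondegenerate.1 _ fun w => ?_
  rw [hB.lie_assoc]
  exact hB.le_orth_iff.1 h x hx _ (lie_mem_left ℝ G J y w hy)

/-- By invariance the centre is orthogonal to all brackets. -/
lemma center_le_orth_lie_top (hB : IsInvariantInnerProduct B)
    (I : LieIdeal ℝ G) : LieAlgebra.center ℝ G ≤ hB.orth ⁅(⊤ : LieIdeal ℝ G), I⁆ := by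
  intro x hx
  refine hB.mem_orth.2 fun y hy => ?_
  rw [← LieSubmodule.mem_toSubmodule, LieSubmodule.lieIdeal_oper_eq_linear_span'] at hy
  induction hy using Submodule.span_induction with
  | mem y hy =>
    obtain ⟨y, -, w, -, rfl⟩ := hy
    exact hB.mem_center_iff.1 hx y w
  | zero => simp
  | add y w _ _ hy hw => rw [map_add, LinearMap.add_apply, hy, hw, add_zero]
  | smul c y _ hy => rw [map_smul, LinearMap.smul_apply, hy, smul_zero]

variable [Module.Finite ℝ G]

lemma orth_orth (I : LieIdeal ℝ G) : hB.orth (hB.orth I) = I :=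
  LieSubmodule.toSubmodule_injective
    (LinearMap.BilinForm.orthogonal_orthogonal hB.nondegenerate
      (LinearMap.BilinForm.IsSymm.isRefl hB.symm) I.toSubmodule)

lemma orth_le_orth_iff {I J : LieIdeal ℝ G} : hB.orth J ≤ hB.orth I ↔ I ≤ J :=
  ⟨fun h => by rw [← hB.orth_orth I, ← hB.orth_orth J]; exact hB.orth_anti h, hB.orth_anti⟩

lemma le_orth_comm {I J : LieIdeal ℝ G} : I ≤ hB.orth J ↔ J ≤ hB.orth I := by
  rw [← hB.orth_le_orth_iff, hB.orth_orth]

lemma orth_sup (I J : LieIdeal ℝ G) : hB.orth (I ⊔ J) = hB.orth I ⊓ hB.orth J :=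
  le_antisymm (le_inf (hB.orth_anti le_sup_left) (hB.orth_anti le_sup_right))
    (hB.le_orth_comm.1 (sup_le (hB.le_orth_comm.1 inf_le_left) (hB.le_orth_comm.1 inf_le_right)))

lemma orth_inf (I J : LieIdeal ℝ G) : hB.orth (I ⊓ J) = hB.orth I ⊔ hB.orth J := by
  rw [← hB.orth_orth (hB.orth I ⊔ hB.orth J), hB.orth_sup, hB.orth_orth, hB.orth_orth]

lemma orth_iSup {ι : Sort*} (I : ι → LieIdeal ℝ G) : hB.orth (⨆ i, I i) = ⨅ i, hB.orth (I i) :=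
  le_antisymm (le_iInf fun i => hB.orth_anti (le_iSup I i))
    (hB.le_orth_comm.1 (iSup_le fun i => hB.le_orth_comm.1 (iInf_le _ i)))

lemma orth_top : hB.orth ⊤ = ⊥ :=
  le_bot_iff.1 (by rw [← hB.orth_le_orth_iff, hB.orth_orth]; exact le_top)

lemma complementedIcc_orth {I J : LieIdeal ℝ G} (h : ComplementedIcc I J) :
    ComplementedIcc (hB.orth J) (hB.orth I) := by
  refine ComplementedIcc.ofDual ((ComplementedIcc.map_iff
    (fun X : LieIdeal ℝ G => OrderDual.toDual (hB.orth X)) (fun x y => ?_)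
    fun y _ _ => ⟨hB.orth (OrderDual.ofDual y), ?_⟩).2 h)
  · exact hB.orth_le_orth_iff
  · exact congrArg OrderDual.toDual (hB.orth_orth _)

lemma complementedIcc_orth_radicalChain (k : ℕ) :
    ComplementedIcc (hB.orth (radicalChain G k)) (hB.orth (radicalChain G (k + 1))) :=
  hB.complementedIcc_orth (complementedIcc_radicalChain k)

/-- Orthogonal complements reverse inclusions and preserve semisimple subquotients, so minimality of
R_{k+1} below R_k becomes maximality of R_{k+1}^⊥ above R_k^⊥. -/
lemma le_orth_radicalChain_succ {k : ℕ} {I : LieIdeal ℝ G}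
    (h : ComplementedIcc (hB.orth (radicalChain G k)) I) :
    I ≤ hB.orth (radicalChain G (k + 1)) := by
  have := hB.complementedIcc_orth h
  rw [hB.orth_orth] at this
  exact hB.le_orth_comm.1 (radicalChain_succ_le_of this)

/-- If the part of an ideal outside `R_k^⊥` is semisimple, then the ideal is contained in
`R_{k+1}^⊥`. -/
lemma le_orth_radicalChain_succ_of_inf {k : ℕ} {I J : LieIdeal ℝ G} (h : ComplementedIcc J I)
    (hJ : J ≤ hB.orth (radicalChain G k)) : I ≤ hB.orth (radicalChain G (k + 1)) :=
  le_sup_left.trans (hB.le_orth_radicalChain_succ (h.sup_right_of_le hJ))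

lemma orth_radicalChain_monotone : Monotone fun k => hB.orth (radicalChain G k) :=
  fun _ _ h => hB.orth_anti (radicalChain_antitone h)

/-- The canonical isotropic ideal as an ideal. -/
def canonicalIdeal (hB : IsInvariantInnerProduct B) : LieIdeal ℝ G :=
  ⨆ k : ℕ, radicalChain G (k + 1) ⊓ hB.orth (radicalChain G (k + 1))

lemma toSubmodule_canonicalIdeal :
    hB.canonicalIdeal.toSubmodule = canonicalIsotropicIdeal B := by
  rw [canonicalIdeal, LieSubmodule.iSup_toSubmodule]
  rfl

/-- The complement of the sum is the intersection of the R_k + R_k^⊥ over k ≥ 1; the term k = 0 is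
everything and may be added, after which the lattice identity for opposite chains applies. -/
lemma orth_canonicalIdeal : hB.orth hB.canonicalIdeal =
    ⨆ k, (radicalChain G k ⊓ hB.orth (radicalChain G (k + 1))) := by
  rw [canonicalIdeal, orth_iSup, ← iInf_sup_eq_iSup_inf_succ radicalChain_antitone
    hB.orth_radicalChain_monotone rfl (exists_radicalChain_eq_bot G)]
  simp only [orth_inf, orth_orth]
  apply le_antisymm
  · refine le_iInf fun k => ?_
    cases k with
    | zero => exact le_sup_of_le_left le_top
    | succ k =>
      rw [sup_comm]
      exact iInf_le _ k
  · refine le_iInf fun k => ?_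
    rw [sup_comm]
    exact iInf_le (fun k => radicalChain G k ⊔ hB.orth (radicalChain G k)) (k + 1)

/-- Each summand R_k ∩ R_{k+1}^⊥ of the orthogonal complement is semisimple modulo R_{k+1}, and what
it shares with R_{k+1} already lies in the canonical ideal. -/
lemma complementedIcc_canonicalIdeal :
    ComplementedIcc hB.canonicalIdeal (hB.orth hB.canonicalIdeal) := by
  have hle : hB.canonicalIdeal ≤ hB.orth hB.canonicalIdeal := by
    rw [orth_canonicalIdeal]
    exact iSup_mono fun k => inf_le_inf_right _ (radicalChain_antitone (Nat.le_succ k))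
  have hwf : WellFoundedGT (LieIdeal ℝ G) := LieSubmodule.wellFoundedGT_of_noetherian ℝ G G
  obtain ⟨d, hd, hmax⟩ := ComplementedIcc.exists_isGreatest hB.canonicalIdeal
  refine hd.mono le_rfl hle ?_
  rw [orth_canonicalIdeal]
  refine iSup_le fun k => ?_
  have h := (complementedIcc_radicalChain (L := G) k).mono le_rfl
    (le_sup_right : _ ≤ (radicalChain G k ⊓ hB.orth (radicalChain G (k + 1))) ⊔
      radicalChain G (k + 1))
    (sup_le inf_le_left (radicalChain_antitone (Nat.le_succ k)))
  refine le_sup_left.trans (hmax (h.inf_of_sup_right.sup_right_of_le ?_))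
  refine le_trans (le_inf inf_le_right (inf_le_left.trans inf_le_right)) ?_
  exact le_iSup (fun k => radicalChain G (k + 1) ⊓ hB.orth (radicalChain G (k + 1))) k

end IsInvariantInnerProduct

end MetricLie

/-! ### Ideals of the standard model and condition (B_k). -/

section Model

variable {𝔥 K : Type*} [LieRing 𝔥] [LieAlgebra ℝ 𝔥] [Group K] [TopologicalSpace K]
  {κ : HKPair 𝔥 K}
  {𝔩 : Type u} [LieRing 𝔩] [LieAlgebra ℝ 𝔩] [Module.Finite ℝ 𝔩] {Φ : EquivariantLie κ 𝔩}
  {𝔞 : Type v} [AddCommGroup 𝔞] [Module ℝ 𝔞] [Module.Finite ℝ 𝔞] [LieRingModule 𝔩 𝔞]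
  [LieModule ℝ 𝔩 𝔞] {ΦA : OrthogonalModule Φ 𝔞} [ContinuousInv K]

lemma OrthogonalModule.nondegenerate_restrict_iff (ΦA : OrthogonalModule Φ 𝔞)
    (W : Submodule ℝ 𝔞) : (ΦA.form.restrict W).Nondegenerate ↔
      ∀ A ∈ W, (∀ B ∈ W, ΦA.form A B = 0) → A = 0 := by
  constructor
  · intro h A hA hAB
    exact congrArg Subtype.val (h.1 ⟨A, hA⟩ fun B => hAB B B.2)
  · intro h
    have h' : ∀ A : W, (∀ B : W, ΦA.form A B = 0) → A = 0 := fun A hA =>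
      Subtype.ext (h A A.2 fun B hB => hA ⟨B, hB⟩)
    exact ⟨h', fun A hA => h' A fun B => by rw [ΦA.form_comm]; exact hA B⟩

namespace StandardModel

lemma isInvariantInnerProduct (z : QuadraticCocycle ΦA) : IsInvariantInnerProduct (form z) :=
  ⟨form_isSymm, form_nondegenerate, form_lieInvariant⟩

/-- The orthogonal complement of an ideal of the standard model. -/
abbrev orth {z : QuadraticCocycle ΦA} (I : LieIdeal ℝ (StandardModel z)) :
    LieIdeal ℝ (StandardModel z) := (isInvariantInnerProduct z).orth I

/-- The ideals `R_k` of the standard model. -/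
abbrev rad (z : QuadraticCocycle ΦA) (k : ℕ) : LieIdeal ℝ (StandardModel z) :=
  radicalChain (StandardModel z) k

/-- The ideals `R_k^⊥` of the standard model. -/
abbrev soc (z : QuadraticCocycle ΦA) (k : ℕ) : LieIdeal ℝ (StandardModel z) :=
  orth (rad z k)

/-- The ideal `𝔩^* ⊕ 𝔟` of the standard model, for a submodule `𝔟` of `𝔞`. -/
def midIdeal (z : QuadraticCocycle ΦA) (b : LieSubmodule ℝ 𝔩 𝔞) :
    LieIdeal ℝ (StandardModel z) where
  carrier := {x | x.mid ∈ b ∧ x.base = 0}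
  add_mem' := by
    rintro x y ⟨h, h'⟩ ⟨k, k'⟩
    exact ⟨b.add_mem h k, by simp [h', k']⟩
  zero_mem' := ⟨b.zero_mem, rfl⟩
  smul_mem' := by
    rintro c x ⟨h, h'⟩
    exact ⟨b.smul_mem c h, by simp [h']⟩
  lie_mem := by
    rintro x y ⟨h, h'⟩
    refine ⟨?_, by simp [h']⟩
    rw [mid_lie, h']
    simpa using b.lie_mem h

/-- The ideal `𝔩^* ⊕ 𝔞` of the standard model. -/
abbrev kerIdeal (z : QuadraticCocycle ΦA) : LieIdeal ℝ (StandardModel z) := midIdeal z ⊤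

/-- The components in `𝔞` of the elements of an ideal contained in `𝔩^* ⊕ 𝔞`. -/
def midSub {z : QuadraticCocycle ΦA} (N : LieIdeal ℝ (StandardModel z)) :
    LieSubmodule ℝ 𝔩 𝔞 where
  carrier := {A | ∃ x ∈ N, x.mid = A ∧ x.base = 0}
  add_mem' := by
    rintro _ _ ⟨x, hx, rfl, h⟩ ⟨y, hy, rfl, h'⟩
    exact ⟨x + y, N.add_mem hx hy, rfl, by simp [h, h']⟩
  zero_mem' := ⟨0, N.zero_mem, rfl, rfl⟩
  smul_mem' := by
    rintro c _ ⟨x, hx, rfl, h⟩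
    exact ⟨c • x, N.smul_mem c hx, rfl, by simp [h]⟩
  lie_mem := by
    rintro L _ ⟨x, hx, rfl, h⟩
    refine ⟨⁅ofBase z L, x⁆, lie_mem_right ℝ _ N _ _ hx, ?_, by simp [h]⟩
    simp [mid_lie, ofBase, h]

variable {z : QuadraticCocycle ΦA}

lemma mem_midIdeal {b : LieSubmodule ℝ 𝔩 𝔞} {x : StandardModel z} :
    x ∈ midIdeal z b ↔ x.mid ∈ b ∧ x.base = 0 := Iff.rfl

lemma mem_kerIdeal {x : StandardModel z} : x ∈ kerIdeal z ↔ x.base = 0 := by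
  simp [mem_midIdeal]

lemma mem_midSub {N : LieIdeal ℝ (StandardModel z)} {A : 𝔞} :
    A ∈ midSub N ↔ ∃ x ∈ N, x.mid = A ∧ x.base = 0 := Iff.rfl

lemma midIdeal_bot : midIdeal z ⊥ = dualIdeal z := by
  ext x
  rw [mem_midIdeal, LieSubmodule.mem_bot]
  rfl

lemma ker_baseHom : (baseHom : StandardModel z →ₗ⁅ℝ⁆ 𝔩).ker = kerIdeal z := by
  ext x
  rw [mem_kerIdeal]
  rfl

lemma baseHom_surjective : Function.Surjective (baseHom : StandardModel z →ₗ⁅ℝ⁆ 𝔩) :=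
  fun L => ⟨⟨0, 0, L⟩, rfl⟩

lemma dualIdeal_le_kerIdeal : dualIdeal z ≤ kerIdeal z := fun _ hx => mem_kerIdeal.2 hx.2

lemma orth_dualIdeal : orth (dualIdeal z) = kerIdeal z := by
  ext x
  rw [mem_kerIdeal, IsInvariantInnerProduct.mem_orth]
  constructor
  · intro h
    refine (Module.forall_dual_apply_eq_zero_iff ℝ _).1 fun f => ?_
    simpa [form_apply] using h ⟨f, 0, 0⟩ ⟨rfl, rfl⟩
  · intro h y hy
    simp [form_apply, hy.1, hy.2, h]

lemma orth_kerIdeal : orth (kerIdeal z) = dualIdeal z := by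
  rw [← orth_dualIdeal]
  exact (isInvariantInnerProduct z).orth_orth _

/-- `𝔞` is semisimple if and only if `𝔩^*` has a complement in `𝔩^* ⊕ 𝔞`. -/
lemma complementedIcc_dualIdeal_iff :
    ComplementedIcc (dualIdeal z) (kerIdeal z) ↔ IsSemisimpleLieModule 𝔩 𝔞 := by
  rw [isSemisimpleLieModule_iff, ← midIdeal_bot]
  refine ComplementedIcc.map_iff (midIdeal z) (fun b c => ?_) fun N h h' => ⟨midSub N, ?_⟩
  · refine ⟨fun h A hA => ?_, fun h x hx => ⟨h hx.1, hx.2⟩⟩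
    have : (⟨0, A, 0⟩ : StandardModel z) ∈ midIdeal z b := ⟨hA, rfl⟩
    exact (h this).1
  · ext x
    rw [mem_midIdeal, mem_midSub]
    constructor
    · rintro ⟨⟨y, hy, h₁, h₂⟩, h₃⟩
      have : x - y ∈ midIdeal z ⊥ := ⟨by simp [h₁], by simp [h₂, h₃]⟩
      simpa using N.add_mem (h this) hy
    · intro hx
      exact ⟨⟨x, hx, rfl, (h' hx).2⟩, (h' hx).2⟩

lemma base_mem_radicalChain_iff {k : ℕ} {x : StandardModel z} :
    x.base ∈ radicalChain 𝔩 k ↔ x ∈ rad z k ⊔ kerIdeal z := by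
  rw [← ker_baseHom, ← comap_radicalChain baseHom baseHom_surjective, LieIdeal.mem_comap]
  rfl

/-- Elements of 𝔩^* are orthogonal to 𝔩^* ⊕ 𝔞, so only the image of R_k(𝔤) in 𝔩 counts, and this is
R_k(𝔩). -/
lemma mem_soc_iff_of_mem_dualIdeal {k : ℕ} {x : StandardModel z} (hx : x ∈ dualIdeal z) :
    x ∈ soc z k ↔ ∀ W ∈ radicalChain 𝔩 k, x.dual W = 0 := by
  have h : x ∈ soc z k ↔ x ∈ orth (rad z k ⊔ kerIdeal z) := by
    rw [orth, IsInvariantInnerProduct.orth_sup]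
    change _ ↔ x ∈ soc z k ∧ x ∈ orth (kerIdeal z)
    rw [orth_kerIdeal]
    exact ⟨fun h => ⟨h, hx⟩, fun h => h.1⟩
  rw [h, IsInvariantInnerProduct.mem_orth]
  constructor
  · intro h W hW
    have := h ⟨0, 0, W⟩ (base_mem_radicalChain_iff.1 hW)
    simpa [form_apply, hx.1, hx.2] using this
  · intro h y hy
    have := h _ (base_mem_radicalChain_iff.2 hy)
    simp [form_apply, hx.1, hx.2, this]

lemma lie_eq_zero_of_mem_radicalChain (ha : IsSemisimpleLieModule 𝔩 𝔞) {k : ℕ} (hk : 1 ≤ k)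
    {W : 𝔩} (hW : W ∈ radicalChain 𝔩 k) (A : 𝔞) : ⁅W, A⁆ = 0 :=
  lie_eq_zero_of_mem_radicalChain_one ha (radicalChain_antitone hk hW) A

/-- The greatest submodule in condition `(B_k)`. -/
lemma isGreatest_condB (ha : IsSemisimpleLieModule 𝔩 𝔞) {k : ℕ} (hk : 1 ≤ k) :
    IsGreatest {𝔟 : LieSubmodule ℝ 𝔩 𝔞 | ∃ Ψ : radicalChain 𝔩 k →ₗ[ℝ] 𝔞,
      ∀ (L : 𝔩) (X : radicalChain 𝔩 k), ∀ B ∈ 𝔟,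
        ΦA.form (z.α ![L, X]) B = ΦA.form (⁅L, Ψ X⁆ - Ψ ⁅L, X⁆) B}
      (midSub (kerIdeal z ⊓ soc z (k + 1))) := by
  have hB := isInvariantInnerProduct z
  have hij := (complementedIcc_dualIdeal_iff (z := z)).2 ha
  constructor
  · set Q := kerIdeal z ⊓ soc z (k + 1) with hQ
    have hkk : soc z k ≤ soc z (k + 1) := hB.orth_radicalChain_monotone (Nat.le_succ k)
    -- `Q` is semisimple modulo 𝔩^* because 𝔞 is, and modulo R_k^⊥ because of `Q ≤ soc z (k + 1)`;
    -- hence also modulo both. There the 𝔩^*-part of `Q` has a complement `N`.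
    have h₁ : ComplementedIcc (Q ⊓ dualIdeal z) Q :=
      (hij.mono le_rfl le_sup_right (sup_le inf_le_left dualIdeal_le_kerIdeal)).inf_of_sup_right
    have h₂ : ComplementedIcc (Q ⊓ soc z k) Q :=
      ((hB.complementedIcc_orth_radicalChain k).mono le_rfl le_sup_right
        (sup_le inf_le_right hkk)).inf_of_sup_right
    have h₃ := h₁.inf h₂
    obtain ⟨N, hN₁, hN₂, hN₃, hN₄⟩ := h₃.2 (Q ⊓ dualIdeal z) inf_le_left inf_le_left
    have hmid : ∀ A ∈ midSub Q, ∃ Z : Module.Dual ℝ 𝔩, (⟨Z, A, 0⟩ : StandardModel z) ∈ N := by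
      rintro A ⟨x, hx, rfl, hx'⟩
      rw [← hN₄, LieSubmodule.mem_sup] at hx
      obtain ⟨y, hy, w, hw, rfl⟩ := hx
      refine ⟨w.dual, ?_⟩
      have : (⟨w.dual, (y + w).mid, 0⟩ : StandardModel z) = w := by
        ext
        · rfl
        · simp [hy.2.1]
        · simp [(mem_kerIdeal.1 (hN₂ hw).1)]
      rwa [this]
    have hker : ∀ x ∈ N, x.mid = 0 → ∀ W ∈ radicalChain 𝔩 k, x.dual W = 0 := by
      intro x hx hx'
      have hxi : x ∈ dualIdeal z := ⟨hx', mem_kerIdeal.1 (hN₂ hx).1⟩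
      have : x ∈ Q ⊓ dualIdeal z ⊓ N := ⟨⟨hN₂ hx, hxi⟩, hx⟩
      rw [hN₃] at this
      exact (mem_soc_iff_of_mem_dualIdeal hxi).1 this.2.2
    let p : N →ₗ[ℝ] 𝔞 := midLinear ∘ₗ N.toSubmodule.subtype
    have hp : ∀ A ∈ midSub Q, A ∈ LinearMap.range p := by
      intro A hA
      obtain ⟨Z, hZ⟩ := hmid A hA
      exact ⟨⟨_, hZ⟩, rfl⟩
    obtain ⟨q, hq⟩ := p.rangeRestrict.exists_rightInverse_of_surjective p.range_rangeRestrict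
    -- Up to functionals vanishing on R_k(𝔩), `N` is a graph over its 𝔞-components. `H` is a linear
    -- choice of the 𝔩^*-component, and Ψ is its adjoint.
    obtain ⟨H, hH⟩ := (dualLinear ∘ₗ N.toSubmodule.subtype ∘ₗ q).exists_extend
    have hHN : ∀ A ∈ midSub Q, (⟨H A, A, 0⟩ : StandardModel z) ∈ N := by
      intro A hA
      have h₁ : H A = (q ⟨A, hp A hA⟩ : StandardModel z).dual :=
        LinearMap.congr_fun hH ⟨A, hp A hA⟩
      have h₂ : (q ⟨A, hp A hA⟩ : StandardModel z).mid = A :=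
        congrArg Subtype.val (LinearMap.congr_fun hq ⟨A, hp A hA⟩)
      have h₃ : (q ⟨A, hp A hA⟩ : StandardModel z).base = 0 :=
        mem_kerIdeal.1 (hN₂ (q ⟨A, hp A hA⟩).2).1
      have : (⟨H A, A, 0⟩ : StandardModel z) = q ⟨A, hp A hA⟩ := by
        ext
        · rw [h₁]
        · exact h₂.symm
        · exact h₃.symm
      rw [this]
      exact (q _).2
    let Ψ₀ : 𝔩 →ₗ[ℝ] 𝔞 :=
      (LinearMap.BilinForm.toDual ΦA.form ΦA.nondegenerate).symm.toLinearMap ∘ₗ H.flip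
    have hΨ₀ : ∀ X A, ΦA.form (Ψ₀ X) A = H A X := fun X A =>
      LinearMap.BilinForm.apply_toDual_symm_apply (hB := ΦA.nondegenerate) _ _
    refine ⟨Ψ₀ ∘ₗ (radicalChain 𝔩 k).toSubmodule.subtype, fun L X B hB' => ?_⟩
    -- Two elements of `N` with the same 𝔞-component ρ(L)B: their difference vanishes on R_k(𝔩), and
    -- this is the required equation.
    have hx := lie_mem_right ℝ _ N (⟨0, 0, L⟩ : StandardModel z) _ (hHN B hB')
    have hy := hHN _ ((midSub Q).lie_mem (x := L) hB')
    have := hker _ (N.sub_mem hx hy) (by simp [mid_lie]) X X.2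
    rw [dual_sub, LinearMap.sub_apply, dual_lie] at this
    simp only [map_zero, LinearMap.zero_apply, zero_sub, zero_lie, add_zero, lie_zero,
      AlternatingMap.toBilin_apply] at this
    change _ = ΦA.form (⁅L, Ψ₀ X⁆ - Ψ₀ ⁅L, (X : 𝔩)⁆) B
    rw [map_sub, LinearMap.sub_apply, ΦA.rep_skew, hΨ₀, hΨ₀, ΦA.form_comm]
    linarith
  · rintro b ⟨Ψ, hΨ⟩ A hA
    -- Conversely Ψ defines such an ideal over `b`. Closure under brackets uses that R_k(𝔩) kills 𝔞,
    -- which needs k ≥ 1.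
    let N : LieIdeal ℝ (StandardModel z) :=
      { carrier := {x | x.mid ∈ b ∧ x.base = 0 ∧ ∀ W : radicalChain 𝔩 k,
          x.dual W = ΦA.form (Ψ W) x.mid}
        add_mem' := by
          rintro x y ⟨h₁, h₂, h₃⟩ ⟨k₁, k₂, k₃⟩
          exact ⟨b.add_mem h₁ k₁, by simp [h₂, k₂], fun W => by simp [h₃, k₃]⟩
        zero_mem' := ⟨b.zero_mem, rfl, fun W => by simp⟩
        smul_mem' := by
          rintro c x ⟨h₁, h₂, h₃⟩
          exact ⟨b.smul_mem c h₁, by simp [h₂], fun W => by simp [h₃]⟩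
        lie_mem := by
          rintro y x ⟨h₁, h₂, h₃⟩
          have hm : ⁅y, x⁆.mid = ⁅y.base, x.mid⁆ := by simp [mid_lie, h₂]
          refine ⟨?_, by simp [h₂], fun W => ?_⟩
          · change ⁅y, x⁆.mid ∈ b
            rw [hm]
            exact b.lie_mem h₁
          · change ⁅y, x⁆.dual W = ΦA.form (Ψ W) ⁅y, x⁆.mid
            have e₁ := hΨ y.base W x.mid h₁
            have e₂ : x.dual ⁅y.base, (W : 𝔩)⁆ = _ := h₃ ⁅y.base, W⁆
            rw [map_sub, LinearMap.sub_apply, ΦA.rep_skew] at e₁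
            rw [hm, dual_lie, h₂, e₂, lie_eq_zero_of_mem_radicalChain ha hk W.2, ΦA.form_comm x.mid,
              AlternatingMap.toBilin_apply, e₁]
            simp }
    have hNj : N ≤ kerIdeal z := fun x hx => mem_kerIdeal.2 hx.2.1
    -- `N` is semisimple modulo 𝔩^*, and its part in 𝔩^* vanishes on R_k(𝔩).
    have hN : N ≤ soc z (k + 1) := by
      refine hB.le_orth_radicalChain_succ_of_inf (k := k) (J := N ⊓ dualIdeal z)
        (hij.mono le_rfl le_sup_right (sup_le hNj dualIdeal_le_kerIdeal)).inf_of_sup_right ?_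
      rintro x ⟨hx, hx'⟩
      refine (mem_soc_iff_of_mem_dualIdeal hx').2 fun W hW => ?_
      rw [hx.2.2 ⟨W, hW⟩, hx'.1, map_zero]
    obtain ⟨Z, hZ⟩ := (ΦA.form.flip A ∘ₗ Ψ).exists_extend (p := (radicalChain 𝔩 k).toSubmodule)
    have hx : (⟨Z, A, 0⟩ : StandardModel z) ∈ N := ⟨hA, rfl, fun W => LinearMap.congr_fun hZ W⟩
    exact ⟨_, ⟨hNj hx, hN hx⟩, rfl, rfl⟩

/-- With Q = (𝔩^* ⊕ 𝔞) ∩ R_{k+1}^⊥ one has Q^⊥ = R_{k+1} + 𝔩^*, and the radical of 𝔟_k consists of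
the 𝔞-components of Q ∩ Q^⊥. Note the shift: (B_k) governs R_{k+1}. -/
lemma condB_iff (ha : IsSemisimpleLieModule 𝔩 𝔞) {k : ℕ} (hk : 1 ≤ k) :
    z.CondB k ↔ kerIdeal z ⊓ soc z (k + 1) ⊓ (rad z (k + 1) ⊔ dualIdeal z) ≤ dualIdeal z := by
  have hB := isInvariantInnerProduct z
  have h₁ : z.CondB k ↔
      (ΦA.form.restrict (midSub (kerIdeal z ⊓ soc z (k + 1))).toSubmodule).Nondegenerate := by
    constructor
    · rintro ⟨b, hb, hb'⟩
      rwa [hb.unique (isGreatest_condB ha hk)] at hb'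
    · exact fun h => ⟨_, isGreatest_condB ha hk, h⟩
  have h₂ : rad z (k + 1) ⊔ dualIdeal z = orth (kerIdeal z ⊓ soc z (k + 1)) := by
    rw [orth, hB.orth_inf, hB.orth_orth, sup_comm]
    exact congrArg (· ⊔ _) orth_kerIdeal.symm
  have h₃ : ∀ A, (⟨0, A, 0⟩ : StandardModel z) ∈ orth (kerIdeal z ⊓ soc z (k + 1)) ↔
      ∀ B ∈ midSub (kerIdeal z ⊓ soc z (k + 1)), ΦA.form A B = 0 := by
    intro A
    rw [hB.mem_orth]
    constructor
    · rintro h _ ⟨x, hx, rfl, hx'⟩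
      rw [ΦA.form_comm]
      simpa [form_apply, hx'] using h x hx
    · intro h x hx
      have hx' := mem_kerIdeal.1 hx.1
      simpa [form_apply, hx', ΦA.form_comm x.mid] using h _ ⟨x, hx, rfl, hx'⟩
  have h₄ : ∀ x : StandardModel z, x.base = 0 → ((⟨0, x.mid, 0⟩ : StandardModel z) ∈
      orth (kerIdeal z ⊓ soc z (k + 1)) ↔ x ∈ orth (kerIdeal z ⊓ soc z (k + 1))) := by
    intro x hx
    have hd : (⟨x.dual, 0, 0⟩ : StandardModel z) ∈ orth (kerIdeal z ⊓ soc z (k + 1)) := by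
      rw [← h₂]
      exact (le_sup_right : dualIdeal z ≤ _) ⟨rfl, rfl⟩
    have e : x = ⟨0, x.mid, 0⟩ + ⟨x.dual, 0, 0⟩ := by ext <;> simp [hx]
    conv_rhs => rw [e]
    exact (add_mem_cancel_right hd).symm
  rw [h₁, ΦA.nondegenerate_restrict_iff, h₂]
  constructor
  · rintro h x ⟨hx, hx'⟩
    have hb := mem_kerIdeal.1 hx.1
    exact ⟨h _ ⟨x, hx, rfl, hb⟩ ((h₃ _).1 ((h₄ x hb).2 hx')), hb⟩
  · rintro h _ ⟨x, hx, rfl, hb⟩ h'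
    exact (h ⟨hx, (h₄ x hb).1 ((h₃ _).2 h')⟩).1

end StandardModel

end Model

/-! ### Invariants in semisimple modules. -/

section LieModules

variable {L M : Type*} [LieRing L] [LieAlgebra ℝ L] [AddCommGroup M] [Module ℝ M]
  [LieRingModule L M] [LieModule ℝ L M]

/-- A semisimple submodule without invariants is generated by the image of the action. -/
lemma lie_top_eq_of_inf_maxTrivSubmodule {C : LieSubmodule ℝ L M} (hC : ComplementedIcc ⊥ C)
    (h : C ⊓ LieModule.maxTrivSubmodule ℝ L M = ⊥) : ⁅(⊤ : LieIdeal ℝ L), C⁆ = C := by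
  obtain ⟨D, -, hDC, h₁, h₂⟩ := hC.2 ⁅(⊤ : LieIdeal ℝ L), C⁆ bot_le (LieSubmodule.lie_le_right _ _)
  have hD : D ≤ C ⊓ LieModule.maxTrivSubmodule ℝ L M := by
    refine le_inf hDC fun m hm => ?_
    rw [LieModule.mem_maxTrivSubmodule]
    intro x
    have : ⁅x, m⁆ ∈ ⁅(⊤ : LieIdeal ℝ L), C⁆ ⊓ D :=
      ⟨LieSubmodule.lie_mem_lie (LieSubmodule.mem_top x) (hDC hm), D.lie_mem hm⟩
    rwa [h₁, LieSubmodule.mem_bot] at this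
  rw [h, le_bot_iff] at hD
  rwa [hD, sup_bot_eq] at h₂

lemma exists_isCompl_maxTrivSubmodule (hM : IsSemisimpleLieModule L M) :
    ∃ C : LieSubmodule ℝ L M, IsCompl (LieModule.maxTrivSubmodule ℝ L M) C ∧
      ⁅(⊤ : LieIdeal ℝ L), C⁆ = C := by
  rw [isSemisimpleLieModule_iff] at hM
  obtain ⟨C, -, -, h₁, h₂⟩ := hM.2 (LieModule.maxTrivSubmodule ℝ L M) bot_le le_top
  refine ⟨C, ⟨disjoint_iff.2 h₁, codisjoint_iff.2 h₂⟩, ?_⟩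
  exact lie_top_eq_of_inf_maxTrivSubmodule (hM.mono le_rfl bot_le le_top) (by rw [inf_comm, h₁])

end LieModules

/-! ### The centre of the standard model and the kernel of the bracket on ⋀² 𝔩. -/

section Model

variable {𝔥 K : Type*} [LieRing 𝔥] [LieAlgebra ℝ 𝔥] [Group K] [TopologicalSpace K]
  {κ : HKPair 𝔥 K}
  {𝔩 : Type u} [LieRing 𝔩] [LieAlgebra ℝ 𝔩] [Module.Finite ℝ 𝔩] {Φ : EquivariantLie κ 𝔩}
  {𝔞 : Type v} [AddCommGroup 𝔞] [Module ℝ 𝔞] [Module.Finite ℝ 𝔞] [LieRingModule 𝔩 𝔞]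
  [LieModule ℝ 𝔩 𝔞] {ΦA : OrthogonalModule Φ 𝔞} [ContinuousInv K]

lemma OrthogonalModule.form_maxTriv_lie (ΦA : OrthogonalModule Φ 𝔞) {A B : 𝔞}
    (hA : A ∈ LieModule.maxTrivSubmodule ℝ 𝔩 𝔞)
    (hB : B ∈ ⁅(⊤ : LieIdeal ℝ 𝔩), (⊤ : LieSubmodule ℝ 𝔩 𝔞)⁆) : ΦA.form A B = 0 := by
  rw [← LieSubmodule.mem_toSubmodule, LieSubmodule.lieIdeal_oper_eq_linear_span'] at hB
  induction hB using Submodule.span_induction with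
  | mem x hx =>
    obtain ⟨L, -, A', -, rfl⟩ := hx
    rw [ΦA.form_comm, ΦA.rep_skew, hA L, map_zero, neg_zero]
  | zero => rw [map_zero]
  | add x y _ _ hx hy => rw [map_add, hx, hy, add_zero]
  | smul c x _ hx => rw [map_smul, hx, smul_zero]

/-- Invariant vectors are orthogonal to ρ(𝔩)𝔞, so against them α may be replaced by α₀. -/
lemma OrthogonalModule.form_exteriorPower (ΦA : OrthogonalModule Φ 𝔞)
    {α₀ α₁ : 𝔩 [⋀^Fin 2]→ₗ[ℝ] 𝔞}
    (h₁ : ∀ v, α₁ v ∈ ⁅(⊤ : LieIdeal ℝ 𝔩), (⊤ : LieSubmodule ℝ 𝔩 𝔞)⁆) {A : 𝔞}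
    (hA : A ∈ LieModule.maxTrivSubmodule ℝ 𝔩 𝔞) (ξ : ⋀[ℝ]^2 𝔩) :
    ΦA.form A (exteriorPower.alternatingMapLinearEquiv (α₀ + α₁) ξ) =
      ΦA.form A (exteriorPower.alternatingMapLinearEquiv α₀ ξ) := by
  have : ΦA.form A ∘ₗ exteriorPower.alternatingMapLinearEquiv α₁ = 0 := by
    refine exteriorPower.linearMap_ext ?_
    ext v
    simp [ΦA.form_maxTriv_lie hA (h₁ v)]
  have := LinearMap.congr_fun this ξ
  rw [map_add, LinearMap.add_apply, map_add]
  simpa using this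

/-- A functional given by `α` that vanishes on the kernel of the bracket `⋀² 𝔩 → 𝔩` factors through
the bracket. -/
lemma exists_dual_of_forall_ker (f : 𝔩 [⋀^Fin 2]→ₗ[ℝ] ℝ)
    (h : ∀ ξ, exteriorPower.alternatingMapLinearEquiv
      (alternatingOfBilin (lieBracketBilin 𝔩) lie_self) ξ = 0 →
      exteriorPower.alternatingMapLinearEquiv f ξ = 0) :
    ∃ Z : Module.Dual ℝ 𝔩, ∀ x y, f ![x, y] = Z ⁅x, y⁆ := by
  set b := exteriorPower.alternatingMapLinearEquiv
    (alternatingOfBilin (lieBracketBilin 𝔩) lie_self)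
  have hf : exteriorPower.alternatingMapLinearEquiv f ∈ (LinearMap.ker b).dualAnnihilator :=
    (Submodule.mem_dualAnnihilator _).2 h
  rw [← LinearMap.range_dualMap_eq_dualAnnihilator_ker] at hf
  obtain ⟨Z, hZ⟩ := hf
  refine ⟨Z, fun x y => ?_⟩
  have := LinearMap.congr_fun hZ (exteriorPower.ιMulti ℝ 2 ![x, y])
  rw [exteriorPower.alternatingMapLinearEquiv_apply_ιMulti] at this
  rw [← this, LinearMap.dualMap_apply, exteriorPower.alternatingMapLinearEquiv_apply_ιMulti]
  rfl

namespace StandardModel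

variable {z : QuadraticCocycle ΦA}

/-- The central elements of the standard model in `𝔩^* ⊕ 𝔞`. -/
lemma mem_center_iff {x : StandardModel z} (hx : x.base = 0) :
    x ∈ LieAlgebra.center ℝ (StandardModel z) ↔
      x.mid ∈ LieModule.maxTrivSubmodule ℝ 𝔩 𝔞 ∧
      ∀ L W, ΦA.form x.mid (z.α ![L, W]) = -x.dual ⁅L, W⁆ := by
  rw [LieModule.mem_maxTrivSubmodule, LieModule.mem_maxTrivSubmodule]
  constructor
  · intro h
    have h₁ : ∀ L : 𝔩, ⁅L, x.mid⁆ = 0 := fun L => by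
      have := congrArg mid (h (ofBase z L))
      simpa [mid_lie, ofBase, hx] using this
    refine ⟨h₁, fun L W => ?_⟩
    have := congrArg (fun y => y.dual W) (h (ofBase z L))
    simp only [dual_lie, ofBase, LinearMap.coe_mk, AddHom.coe_mk, hx, map_zero, dual_zero,
      LinearMap.zero_apply, zero_lie, lie_zero, AlternatingMap.toBilin_apply] at this
    linarith
  · rintro ⟨h₁, h₂⟩ y
    refine ext_apply (fun W => ?_) ?_ ?_
    · have h₃ : ΦA.form x.mid ⁅W, y.mid⁆ = 0 := by
        rw [form_lie_right, h₁]
        simp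
      rw [dual_lie, hx, AlternatingMap.toBilin_apply, h₂, h₃]
      simp
    · simp [mid_lie, hx, h₁]
    · simp [hx]

/-- The centre is a trivial, hence semisimple, module, and R_1^⊥ is the socle because R_0^⊥ = 0. -/
lemma center_le_soc : LieAlgebra.center ℝ (StandardModel z) ≤ soc z 1 := by
  refine (isInvariantInnerProduct z).le_orth_radicalChain_succ (k := 0) ?_
  have h : (isInvariantInnerProduct z).orth (radicalChain (StandardModel z) 0) = ⊥ :=
    (isInvariantInnerProduct z).orth_top
  rw [h]
  exact complementedIcc_bot_of_trivial _ fun x m hm => hm x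

lemma complementedIcc_bot_soc_one : ComplementedIcc ⊥ (soc z 1) := by
  have h := (isInvariantInnerProduct z).complementedIcc_orth_radicalChain 0
  have h' : (isInvariantInnerProduct z).orth (radicalChain (StandardModel z) 0) = ⊥ :=
    (isInvariantInnerProduct z).orth_top
  rwa [h'] at h

end StandardModel

end Model

section Model

variable {𝔥 K : Type*} [LieRing 𝔥] [LieAlgebra ℝ 𝔥] [Group K] [TopologicalSpace K]
  {κ : HKPair 𝔥 K}
  {𝔩 : Type u} [LieRing 𝔩] [LieAlgebra ℝ 𝔩] [Module.Finite ℝ 𝔩] {Φ : EquivariantLie κ 𝔩}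
  {𝔞 : Type v} [AddCommGroup 𝔞] [Module ℝ 𝔞] [Module.Finite ℝ 𝔞] [LieRingModule 𝔩 𝔞]
  [LieModule ℝ 𝔩 𝔞] {ΦA : OrthogonalModule Φ 𝔞} [ContinuousInv K]

namespace StandardModel

variable {z : QuadraticCocycle ΦA}

/-- The orthogonality makes ⟨A, α⟩ factor through the bracket; the negative of the resulting
functional is the 𝔩^*-component of a central lift of `A`. -/
lemma exists_mem_center {A : 𝔞} (hA : A ∈ LieModule.maxTrivSubmodule ℝ 𝔩 𝔞)
    (h : ∀ ξ, exteriorPower.alternatingMapLinearEquiv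
      (alternatingOfBilin (lieBracketBilin 𝔩) lie_self) ξ = 0 →
      ΦA.form A (exteriorPower.alternatingMapLinearEquiv z.α ξ) = 0) :
    ∃ Z : Module.Dual ℝ 𝔩, (⟨Z, A, 0⟩ : StandardModel z) ∈
      LieAlgebra.center ℝ (StandardModel z) := by
  obtain ⟨Z, hZ⟩ := exists_dual_of_forall_ker ((ΦA.form A).compAlternatingMap z.α) (fun ξ hξ => by
    rw [exteriorPower.alternatingMapLinearEquiv_comp]
    exact h ξ hξ)
  refine ⟨-Z, (mem_center_iff rfl).2 ⟨hA, fun L W => ?_⟩⟩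
  rw [LinearMap.neg_apply, neg_neg]
  exact hZ L W

lemma form_mid_eq_zero_of_mem_center {x : StandardModel z} (hx : x.base = 0)
    (h : x ∈ LieAlgebra.center ℝ (StandardModel z)) (ξ : ⋀[ℝ]^2 𝔩)
    (hξ : exteriorPower.alternatingMapLinearEquiv
      (alternatingOfBilin (lieBracketBilin 𝔩) lie_self) ξ = 0) :
    ΦA.form x.mid (exteriorPower.alternatingMapLinearEquiv z.α ξ) = 0 := by
  have : ΦA.form x.mid ∘ₗ exteriorPower.alternatingMapLinearEquiv z.α =
      -x.dual ∘ₗ exteriorPower.alternatingMapLinearEquiv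
        (alternatingOfBilin (lieBracketBilin 𝔩) lie_self) := by
    refine exteriorPower.linearMap_ext ?_
    ext v
    have := ((mem_center_iff hx).1 h).2 (v 0) (v 1)
    have e : ![v 0, v 1] = v := by ext i; fin_cases i <;> rfl
    rw [e] at this
    simp only [LinearMap.compAlternatingMap_apply, LinearMap.comp_apply, LinearMap.neg_apply,
      exteriorPower.alternatingMapLinearEquiv_apply_ιMulti]
    exact this
  have := LinearMap.congr_fun this ξ
  simpa [hξ] using this

/-! ### If the canonical ideal is 𝔩^*, the cocycle is balanced. -/

section Canonical

lemma rad_inf_soc_le (hc : (isInvariantInnerProduct z).canonicalIdeal = dualIdeal z) (k : ℕ) :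
    rad z (k + 1) ⊓ soc z (k + 1) ≤ dualIdeal z := by
  rw [← hc]
  exact le_iSup (fun k => rad z (k + 1) ⊓ soc z (k + 1)) k

lemma iSup_rad_inf_soc_succ (hc : (isInvariantInnerProduct z).canonicalIdeal = dualIdeal z) :
    ⨆ k, (rad z k ⊓ soc z (k + 1)) = kerIdeal z := by
  rw [← orth_dualIdeal, ← hc]
  exact (isInvariantInnerProduct z).orth_canonicalIdeal.symm

lemma rad_inf_soc_succ_le (hc : (isInvariantInnerProduct z).canonicalIdeal = dualIdeal z) (k : ℕ) :
    rad z k ⊓ soc z (k + 1) ≤ kerIdeal z := by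
  rw [← iSup_rad_inf_soc_succ hc]
  exact le_iSup (fun k => rad z k ⊓ soc z (k + 1)) k

lemma isSemisimple_of_canonicalIdeal
    (hc : (isInvariantInnerProduct z).canonicalIdeal = dualIdeal z) :
    IsSemisimpleLieModule 𝔩 𝔞 := by
  rw [← complementedIcc_dualIdeal_iff (z := z), ← orth_dualIdeal, ← hc]
  exact (isInvariantInnerProduct z).complementedIcc_canonicalIdeal

/-- Modulo R_{k+1}, elements of 𝔩^* can be moved into R_{k+1}^⊥; the modular law then reduces the
claim to R_{k+1} ∩ R_{k+1}^⊥ ⊆ 𝔩^*. -/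
lemma condB_of_canonicalIdeal (hc : (isInvariantInnerProduct z).canonicalIdeal = dualIdeal z)
    {k : ℕ} (hk : 1 ≤ k) : z.CondB k := by
  have hB := isInvariantInnerProduct z
  rw [condB_iff (isSemisimple_of_canonicalIdeal hc) hk]
  have h := iSup_inf_le_sup (R := rad z) (S := soc z) radicalChain_antitone
    hB.orth_radicalChain_monotone (k + 1)
  have h' : dualIdeal z ≤ rad z (k + 1) ⊔ dualIdeal z ⊓ soc z (k + 1) := by
    rw [← hc]; exact h
  calc kerIdeal z ⊓ soc z (k + 1) ⊓ (rad z (k + 1) ⊔ dualIdeal z)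
      ≤ (dualIdeal z ⊓ soc z (k + 1) ⊔ rad z (k + 1)) ⊓ soc z (k + 1) :=
        le_inf (inf_le_right.trans (sup_le le_sup_right (by rwa [sup_comm])))
          (inf_le_left.trans inf_le_right)
    _ = dualIdeal z ⊓ soc z (k + 1) ⊔ rad z (k + 1) ⊓ soc z (k + 1) :=
        sup_inf_assoc_of_le _ inf_le_right
    _ ≤ dualIdeal z := sup_le inf_le_left (rad_inf_soc_le hc k)

lemma condA_of_canonicalIdeal (hc : (isInvariantInnerProduct z).canonicalIdeal = dualIdeal z)
    {k : ℕ} (hk : 1 ≤ k) : z.CondA k := by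
  have hB := isInvariantInnerProduct z
  have ha := isSemisimple_of_canonicalIdeal hc
  rintro 𝔨 h𝔨 ⟨Φ₁, Φ₂, h₁, h₂⟩
  have hact : ∀ X : 𝔨, ∀ A : 𝔞, ⁅(X : 𝔩), A⁆ = 0 := fun X A =>
    lie_eq_zero_of_mem_radicalChain ha hk (h𝔨 X.2).2 A
  have hsoc : ∀ X : 𝔨, ∀ W ∈ radicalChain 𝔩 k, ⁅W, (X : 𝔩)⁆ = 0 := fun X W hW => by
    have := lie_eq_zero_of_mem_radicalChain_one (V := lieSocle 𝔩)
      ((isSemisimpleLieModule_coe_iff _).2 isGreatest_lieSocle.1)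
      (radicalChain_antitone hk hW) ⟨X, (h𝔨 X.2).1⟩
    exact congrArg Subtype.val this
  -- The equations of (A_k) say that this subspace over 𝔨 is an ideal, given that 𝔨 kills 𝔞 and
  -- commutes with R_k(𝔩). It will be forced into 𝔩^* ⊕ 𝔞, whence 𝔨 = 0.
  let N : LieIdeal ℝ (StandardModel z) :=
    { carrier := {x | ∃ X : 𝔨, x.base = X ∧ x.mid = -Φ₁ X ∧
        ∀ W : radicalChain 𝔩 k, x.dual W = Φ₂ X W}
      add_mem' := by
        rintro x y ⟨X, h₁, h₂, h₃⟩ ⟨Y, k₁, k₂, k₃⟩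
        exact ⟨X + Y, by simp [h₁, k₁], by simp [h₂, k₂, add_comm], fun W => by simp [h₃, k₃]⟩
      zero_mem' := ⟨0, by simp, by simp, fun W => by simp⟩
      smul_mem' := by
        rintro c x ⟨X, h₁, h₂, h₃⟩
        exact ⟨c • X, by simp [h₁], by simp [h₂], fun W => by simp [h₃]⟩
      lie_mem := by
        rintro y x ⟨X, hx₁, hx₂, hx₃⟩
        refine ⟨⁅y.base, X⁆, by simp [hx₁], ?_, fun W => ?_⟩
        · have := h₁ y.base X
          rw [mid_lie, hx₁, hx₂, hact, AlternatingMap.toBilin_apply, this, lie_neg]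
          abel
        · have e₁ := h₂ y.base X W
          have e₂ : x.dual ⁅y.base, (W : 𝔩)⁆ = _ := hx₃ ⁅y.base, W⁆
          have e₃ : z.α.toBilin (X : 𝔩) (W : 𝔩) = 0 := by
            have : ⁅(W : 𝔩), X⁆ = 0 := Subtype.ext (hsoc X W W.2)
            rw [z.α.toBilin_swap, AlternatingMap.toBilin_apply, h₁, this,
              lie_eq_zero_of_mem_radicalChain ha hk W.2]
            simp
          have e₄ : ⁅(X : 𝔩), (W : 𝔩)⁆ = 0 := by rw [← lie_skew, hsoc X W W.2, neg_zero]
          rw [dual_lie, hx₁, hx₂, e₂, e₃, e₄, lie_eq_zero_of_mem_radicalChain ha hk W.2,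
            AlternatingMap.toBilin_apply, AlternatingMap.toTrilin_apply, e₁]
          simp only [map_neg, map_zero, LinearMap.neg_apply]
          ring }
  have hNbase : ∀ x ∈ N, x.base ∈ 𝔨 := by
    rintro x ⟨X, hx, -⟩
    rw [hx]
    exact X.2
  have hNsoc : N ⊔ kerIdeal z ≤ (lieSocle 𝔩).comap baseHom := by
    refine sup_le (fun x hx => LieIdeal.mem_comap.2 (h𝔨 (hNbase x hx)).1) fun x hx => ?_
    rw [LieIdeal.mem_comap]
    have : baseHom x = 0 := mem_kerIdeal.1 hx
    rw [this]
    exact zero_mem _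
  have hs : ComplementedIcc (kerIdeal z) ((lieSocle 𝔩).comap baseHom) := by
    rw [← ker_baseHom, ← LieIdeal.comap_bot_eq_ker, complementedIcc_comap_iff _ baseHom_surjective]
    exact isGreatest_lieSocle.1
  -- Over 𝔩^* ⊕ 𝔞 the ideal `N` is semisimple because 𝔨 lies in the socle; what remains is a
  -- functional vanishing on R_k(𝔩).
  have hN₁ : N ≤ soc z (k + 1) := by
    refine hB.le_orth_radicalChain_succ_of_inf (hs.mono le_rfl le_sup_right hNsoc).inf_of_sup_right
      ?_
    rintro x ⟨⟨X, hx₁, hx₂, hx₃⟩, hx⟩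
    have hX : X = 0 := Subtype.ext (hx₁.symm.trans (mem_kerIdeal.1 hx))
    rw [hX, map_zero, neg_zero] at hx₂
    refine (mem_soc_iff_of_mem_dualIdeal ⟨hx₂, mem_kerIdeal.1 hx⟩).2 fun W hW => ?_
    rw [hx₃ ⟨W, hW⟩, hX, map_zero, LinearMap.zero_apply]
  -- Since 𝔩^* ⊕ 𝔞 is the sum of the R_n ∩ R_{n+1}^⊥, modulo R_k it can be moved into R_k^⊥.
  have hN₂ : N ≤ kerIdeal z ⊓ soc z k ⊔ rad z k := by
    have h := iSup_inf_succ_le_sup (R := rad z) (S := soc z) radicalChain_antitone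
      hB.orth_radicalChain_monotone k
    rw [iSup_rad_inf_soc_succ hc] at h
    refine le_trans (b := rad z k ⊔ kerIdeal z)
      (fun x hx => base_mem_radicalChain_iff.1 (h𝔨 (hNbase x hx)).2) ?_
    rw [sup_comm _ (rad z k)]
    exact sup_le le_sup_left h
  have hN₃ : N ≤ kerIdeal z := by
    refine (le_inf hN₂ hN₁).trans ?_
    rw [sup_inf_assoc_of_le _ (inf_le_right.trans (hB.orth_radicalChain_monotone (Nat.le_succ k)))]
    exact sup_le inf_le_left (rad_inf_soc_succ_le hc k)
  refine le_bot_iff.1 fun X hX => ?_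
  obtain ⟨Z, hZ⟩ := (Φ₂ ⟨X, hX⟩).exists_extend (p := (radicalChain 𝔩 k).toSubmodule)
  have : (⟨Z, -Φ₁ ⟨X, hX⟩, X⟩ : StandardModel z) ∈ N :=
    ⟨⟨X, hX⟩, rfl, rfl, fun W => LinearMap.congr_fun hZ W⟩
  exact mem_kerIdeal.1 (hN₃ this)

/-- The data of (A_0) make (Z₀, -A₀, L₀) central; the centre lies in R_0 ∩ R_1^⊥ ⊆ 𝔩^* ⊕ 𝔞. -/
lemma condA0_of_canonicalIdeal (hc : (isInvariantInnerProduct z).canonicalIdeal = dualIdeal z) :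
    z.CondA0 := by
  rintro L₀ hL₀ hL₀' ⟨A₀, Z₀, h₁, h₂⟩
  have hx : (⟨Z₀, -A₀, L₀⟩ : StandardModel z) ∈ LieAlgebra.center ℝ (StandardModel z) := by
    rw [LieModule.mem_maxTrivSubmodule]
    intro y
    have hl : ∀ L : 𝔩, ⁅L, L₀⁆ = 0 := hL₀
    have hl' : ∀ L : 𝔩, ⁅L₀, L⁆ = 0 := fun L => by rw [← lie_skew, hl, neg_zero]
    have ha : ∀ A : 𝔞, ⁅L₀, A⁆ = 0 := (LieModule.mem_ker ℝ 𝔩 𝔞 L₀).1 hL₀'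
    refine ext_apply (fun W => ?_) ?_ (hl _)
    · have e := ΦA.rep_skew W y.mid A₀
      rw [dual_lie]
      simp only [AlternatingMap.toTrilin_apply]
      rw [z.α.toBilin_swap L₀ W]
      simp only [AlternatingMap.toBilin_apply, h₁, h₂, hl', map_neg, map_zero, LinearMap.neg_apply,
        dual_zero, LinearMap.zero_apply, ΦA.form_comm A₀ ⁅W, y.mid⁆]
      linarith
    · simp only [mid_lie, AlternatingMap.toBilin_apply, h₁, ha, lie_neg, mid_zero]
      abel
  have := rad_inf_soc_succ_le hc 0 ⟨LieSubmodule.mem_top _, center_le_soc hx⟩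
  exact mem_kerIdeal.1 this

/-- A vector in the radical of the given image lifts to a central element, which turns out to lie in
R_1 ∩ R_1^⊥ ⊆ 𝔩^*. -/
lemma condB0_of_canonicalIdeal (hc : (isInvariantInnerProduct z).canonicalIdeal = dualIdeal z) :
    z.CondB0 := by
  have hB := isInvariantInnerProduct z
  have ha := isSemisimple_of_canonicalIdeal hc
  obtain ⟨C, hTC, hC⟩ := exists_isCompl_maxTrivSubmodule ha
  have hTC' : IsCompl (LieModule.maxTrivSubmodule ℝ 𝔩 𝔞).toSubmodule C.toSubmodule :=
    LieSubmodule.isCompl_toSubmodule.2 hTC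
  let P : 𝔞 →ₗ[ℝ] 𝔞 := (LieModule.maxTrivSubmodule ℝ 𝔩 𝔞).toSubmodule.projection C.toSubmodule hTC'
  have hα₁ : ∀ v, (z.α - P.compAlternatingMap z.α) v ∈
      ⁅(⊤ : LieIdeal ℝ 𝔩), (⊤ : LieSubmodule ℝ 𝔩 𝔞)⁆ := fun v => by
    have h : ⁅(⊤ : LieIdeal ℝ 𝔩), C⁆ ≤ ⁅(⊤ : LieIdeal ℝ 𝔩), (⊤ : LieSubmodule ℝ 𝔩 𝔞)⁆ :=
      LieSubmodule.mono_lie_right _ le_top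
    rw [hC] at h
    exact h (Submodule.sub_projection_mem hTC' (z.α v))
  have hT : ∀ ξ, exteriorPower.alternatingMapLinearEquiv (P.compAlternatingMap z.α) ξ ∈
      LieModule.maxTrivSubmodule ℝ 𝔩 𝔞 := fun ξ => by
    rw [exteriorPower.alternatingMapLinearEquiv_comp]
    exact Submodule.projection_apply_mem hTC' _
  have hα : z.α = P.compAlternatingMap z.α + (z.α - P.compAlternatingMap z.α) := by abel
  refine ⟨P.compAlternatingMap z.α, z.α - P.compAlternatingMap z.α, hα,
    fun v => Submodule.projection_apply_mem hTC' _, hα₁, ?_⟩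
  have hform : ∀ {A : 𝔞}, A ∈ LieModule.maxTrivSubmodule ℝ 𝔩 𝔞 → ∀ ξ,
      ΦA.form A (exteriorPower.alternatingMapLinearEquiv z.α ξ) =
      ΦA.form A (exteriorPower.alternatingMapLinearEquiv (P.compAlternatingMap z.α) ξ) := by
    intro A hA ξ
    rw [← ΦA.form_exteriorPower (α₀ := P.compAlternatingMap z.α) hα₁ hA, ← hα]
  rw [ΦA.nondegenerate_restrict_iff]
  rintro _ ⟨η, hη, rfl⟩ hx
  obtain ⟨Z, hZ⟩ := exists_mem_center (z := z) (hT η) fun ξ hξ => by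
    rw [hform (hT η)]
    exact hx _ ⟨ξ, hξ, rfl⟩
  have hcen : ∀ c ∈ LieAlgebra.center ℝ (StandardModel z), form z c
      ⟨Z, exteriorPower.alternatingMapLinearEquiv (P.compAlternatingMap z.α) η, 0⟩ = 0 := by
    intro c hc'
    have hb := mem_kerIdeal.1
      (rad_inf_soc_succ_le hc 0 ⟨LieSubmodule.mem_top _, center_le_soc hc'⟩)
    have := form_mid_eq_zero_of_mem_center hb hc' η hη
    rw [hform ((mem_center_iff hb).1 hc').1] at this
    simp [form_apply, hb, this]
  obtain ⟨D, -, hD, h₁, h₂⟩ := complementedIcc_bot_soc_one.2 _ bot_le (center_le_soc (z := z))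
  have hD' := lie_top_eq_of_inf_maxTrivSubmodule
    (complementedIcc_bot_soc_one.mono le_rfl bot_le hD) ((inf_comm _ _).trans h₁)
  -- The socle R_1^⊥ is the centre plus D with [𝔤, D] = D. The lift is orthogonal to the centre by
  -- `hcen`, and to D because it is central itself.
  have hw : (⟨Z, exteriorPower.alternatingMapLinearEquiv (P.compAlternatingMap z.α) η, 0⟩ :
      StandardModel z) ∈ orth (soc z 1) := by
    rw [← h₂, orth, hB.orth_sup]
    refine ⟨hB.mem_orth.2 hcen, ?_⟩
    rw [← hD']
    exact hB.center_le_orth_lie_top D hZ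
  rw [orth, soc, orth, hB.orth_orth] at hw
  exact (rad_inf_soc_le hc 0 ⟨hw, center_le_soc hZ⟩).1

/-- A cocycle is balanced if the canonical isotropic ideal of its standard model is `𝔩^*`. -/
lemma isBalanced_of_canonicalIdeal
    (hc : (isInvariantInnerProduct z).canonicalIdeal = dualIdeal z) : z.IsBalanced := by
  obtain ⟨m, hm⟩ := exists_radicalChain_eq_bot 𝔩
  exact ⟨condA0_of_canonicalIdeal hc, condB0_of_canonicalIdeal hc, m,
    le_bot_iff.1 (hm ▸ radicalChain_antitone (Nat.le_succ m)),
    fun k hk _ => ⟨condA_of_canonicalIdeal hc hk, condB_of_canonicalIdeal hc hk⟩⟩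

end Canonical

end StandardModel

end Model

/-! ### If the module is semisimple and the cocycle balanced, the canonical ideal is 𝔩^*. -/

section Model

variable {𝔥 K : Type*} [LieRing 𝔥] [LieAlgebra ℝ 𝔥] [Group K] [TopologicalSpace K]
  {κ : HKPair 𝔥 K}
  {𝔩 : Type u} [LieRing 𝔩] [LieAlgebra ℝ 𝔩] [Module.Finite ℝ 𝔩] {Φ : EquivariantLie κ 𝔩}
  {𝔞 : Type v} [AddCommGroup 𝔞] [Module ℝ 𝔞] [Module.Finite ℝ 𝔞] [LieRingModule 𝔩 𝔞]
  [LieModule ℝ 𝔩 𝔞] {ΦA : OrthogonalModule Φ 𝔞} [ContinuousInv K]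

namespace QuadraticCocycle

variable {z : QuadraticCocycle ΦA}

lemma condA_of_radicalChain_eq_bot {k : ℕ} (hk : radicalChain 𝔩 k = ⊥) : z.CondA k := by
  intro 𝔨 h𝔨 _
  rw [hk, inf_bot_eq] at h𝔨
  exact le_bot_iff.1 h𝔨

lemma condB_of_radicalChain_eq_bot {k : ℕ} (hk : radicalChain 𝔩 k = ⊥) : z.CondB k := by
  refine ⟨⊤, ⟨⟨0, fun L X B _ => ?_⟩, fun _ _ => le_top⟩, ?_⟩
  · have hX : (X : 𝔩) = 0 := (LieSubmodule.mem_bot _).1 (hk.le X.2)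
    rw [hX, z.α.map_coord_zero 1 (by rfl)]
    simp
  · rw [ΦA.nondegenerate_restrict_iff]
    exact fun A _ h => ΦA.nondegenerate.1 A fun B => h B (LieSubmodule.mem_top B)

/-- Both conditions are automatic once R_k(𝔩) = 0, so the bound `m` plays no role. -/
lemma IsBalanced.condA_and_condB (h : z.IsBalanced) {k : ℕ} (hk : 1 ≤ k) :
    z.CondA k ∧ z.CondB k := by
  obtain ⟨-, -, m, hm, hAB⟩ := h
  obtain hkm | hkm := le_or_gt k m
  · exact hAB k hk hkm
  · have : radicalChain 𝔩 k = ⊥ := le_bot_iff.1 (hm ▸ radicalChain_antitone hkm)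
    exact ⟨condA_of_radicalChain_eq_bot this, condB_of_radicalChain_eq_bot this⟩

end QuadraticCocycle

namespace StandardModel

variable {z : QuadraticCocycle ΦA}

/-- A complement `C` of the 𝔩^*-part consists of central elements with invariant 𝔞-component. Such a
component is orthogonal to the non-degenerate space of (B_0). It is also orthogonal to the
invariants perpendicular to that space, since these lift to the centre, hence to R_1^⊥, while `C`
lies in R_1. Being invariant, it is orthogonal to ρ(𝔩)𝔞 as well, so it vanishes. -/
lemma rad_one_inf_soc_one_inf_kerIdeal_le (ha : IsSemisimpleLieModule 𝔩 𝔞) (hB₀ : z.CondB0) :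
    rad z 1 ⊓ soc z 1 ⊓ kerIdeal z ≤ dualIdeal z := by
  have hB := isInvariantInnerProduct z
  obtain ⟨α₀, α₁, hα, h₀, h₁, hW⟩ := hB₀
  set W := (LinearMap.ker (exteriorPower.alternatingMapLinearEquiv
    (alternatingOfBilin (lieBracketBilin 𝔩) lie_self))).map
      (exteriorPower.alternatingMapLinearEquiv α₀) with hWdef
  have hWT : W ≤ (LieModule.maxTrivSubmodule ℝ 𝔩 𝔞).toSubmodule := by
    rintro _ ⟨ξ, -, rfl⟩
    have : ⊤ ≤ (LieModule.maxTrivSubmodule ℝ 𝔩 𝔞).toSubmodule.comap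
        (exteriorPower.alternatingMapLinearEquiv α₀) := by
      rw [← exteriorPower.ιMulti_span ℝ 2 𝔩, Submodule.span_le]
      rintro _ ⟨v, rfl⟩
      simpa using h₀ v
    exact this (Submodule.mem_top (x := ξ))
  have hform : ∀ {A : 𝔞}, A ∈ LieModule.maxTrivSubmodule ℝ 𝔩 𝔞 → ∀ ξ,
      ΦA.form A (exteriorPower.alternatingMapLinearEquiv z.α ξ) =
      ΦA.form A (exteriorPower.alternatingMapLinearEquiv α₀ ξ) := by
    intro A hA ξ
    rw [hα, ΦA.form_exteriorPower h₁ hA]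
  have hN : ComplementedIcc ⊥ (rad z 1 ⊓ soc z 1 ⊓ kerIdeal z) :=
    complementedIcc_bot_soc_one.mono le_rfl bot_le (inf_le_left.trans inf_le_right)
  obtain ⟨C, -, hC, hC₁, hC₂⟩ := hN.2 (rad z 1 ⊓ soc z 1 ⊓ kerIdeal z ⊓ dualIdeal z) bot_le
    inf_le_left
  suffices h : ∀ x ∈ C, x.mid = 0 by
    rw [← hC₂]
    exact sup_le inf_le_right fun x hx => ⟨h x hx, mem_kerIdeal.1 (hC hx).2⟩
  intro x hx
  have hb := mem_kerIdeal.1 (hC hx).2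
  have hCi : ∀ y ∈ C, y ∈ dualIdeal z → y = 0 := by
    intro y hy hy'
    have : y ∈ rad z 1 ⊓ soc z 1 ⊓ kerIdeal z ⊓ dualIdeal z ⊓ C := ⟨⟨hC hy, hy'⟩, hy⟩
    rwa [hC₁, LieSubmodule.mem_bot] at this
  have hT : x.mid ∈ LieModule.maxTrivSubmodule ℝ 𝔩 𝔞 := by
    rw [LieModule.mem_maxTrivSubmodule]
    intro L
    refine ΦA.nondegenerate.1 _ fun A => ?_
    have h : ⁅(⟨0, A, 0⟩ : StandardModel z), x⁆ = 0 :=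
      hCi _ (C.lie_mem hx) ⟨by simp [mid_lie, hb], by simp⟩
    have := congrArg (fun y => y.dual L) h
    simp only [dual_lie, hb, map_zero, LinearMap.zero_apply, zero_lie, dual_zero] at this
    rw [ΦA.rep_skew]
    linarith
  have hx' : x ∈ LieAlgebra.center ℝ (StandardModel z) := by
    rw [LieModule.mem_maxTrivSubmodule]
    intro y
    refine hCi _ (C.lie_mem hx) ⟨?_, by simp [hb]⟩
    rw [mid_lie, hb, hT]
    simp
  have hxW : ∀ A ∈ W, ΦA.form x.mid A = 0 := by
    rintro _ ⟨ξ, hξ, rfl⟩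
    rw [← hform hT]
    exact form_mid_eq_zero_of_mem_center hb hx' ξ hξ
  have hxT : ∀ A ∈ LieModule.maxTrivSubmodule ℝ 𝔩 𝔞, ΦA.form x.mid A = 0 := by
    intro A hA
    have hsup := (LinearMap.BilinForm.isCompl_orthogonal_of_restrict_nondegenerate
      (LinearMap.BilinForm.IsSymm.isRefl ΦA.symm) hW).sup_eq_top
    have hA' : A ∈ W ⊔ ΦA.form.orthogonal W := hsup ▸ Submodule.mem_top
    obtain ⟨B, hBW, D, hD, rfl⟩ := Submodule.mem_sup.1 hA'
    have hDT : D ∈ LieModule.maxTrivSubmodule ℝ 𝔩 𝔞 := by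
      simpa using sub_mem hA (hWT hBW : B ∈ LieModule.maxTrivSubmodule ℝ 𝔩 𝔞)
    obtain ⟨Z, hZ⟩ := exists_mem_center (z := z) hDT fun ξ hξ => by
      rw [hform hDT, ΦA.form_comm]
      exact hD _ ⟨ξ, hξ, rfl⟩
    have := hB.mem_orth.1 (center_le_soc hZ) x (hC hx).1.1
    rw [form_apply, hb] at this
    rw [map_add, hxW B hBW, zero_add]
    simpa using this
  obtain ⟨D, hTD, hD⟩ := exists_isCompl_maxTrivSubmodule ha
  refine ΦA.nondegenerate.1 _ fun A => ?_
  have hA : A ∈ LieModule.maxTrivSubmodule ℝ 𝔩 𝔞 ⊔ D := by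
    rw [hTD.sup_eq_top]
    exact LieSubmodule.mem_top A
  obtain ⟨B, hBT, E, hE, rfl⟩ := (LieSubmodule.mem_sup _ _ _).1 hA
  rw [map_add, hxT B hBT, zero_add]
  rw [← hD] at hE
  exact ΦA.form_maxTriv_lie hT (LieSubmodule.mono_lie_right _ le_top hE)

/-- Condition `(A_k)` in terms of the ideals of the standard model. -/
lemma le_kerIdeal_of_condA {k : ℕ} (hA : z.CondA k) {N₀ a : LieIdeal ℝ (StandardModel z)}
    (hN₀ : ComplementedIcc a N₀) (h : a ≤ dualIdeal z ⊓ soc z k)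
    (h' : N₀ ≤ rad z k ⊔ kerIdeal z) : N₀ ≤ kerIdeal z := by
  set e := dualIdeal z ⊓ soc z k with he
  have hej : e ≤ kerIdeal z := inf_le_left.trans dualIdeal_le_kerIdeal
  -- Modulo `e`, a complement of the part of `N₀` inside 𝔩^* ⊕ 𝔞; its image in 𝔩 is the ideal to
  -- which (A_k) applies.
  obtain ⟨N, heN, hNN, hN₁, hN₂⟩ := (hN₀.sup_right_of_le h).2 ((N₀ ⊔ e) ⊓ kerIdeal z)
    (le_inf le_sup_right hej) inf_le_left
  have hNj : N ⊓ kerIdeal z ≤ e := by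
    rw [← hN₁]
    exact le_inf (le_inf (inf_le_left.trans hNN) inf_le_right) inf_le_left
  suffices hN : N ≤ kerIdeal z from
    le_sup_left.trans (hN₂.ge.trans (sup_le inf_le_right hN))
  let 𝔨 : LieIdeal ℝ 𝔩 :=
    { carrier := {L | ∃ x ∈ N, x.base = L}
      add_mem' := by
        rintro _ _ ⟨x, hx, rfl⟩ ⟨y, hy, rfl⟩
        exact ⟨x + y, N.add_mem hx hy, rfl⟩
      zero_mem' := ⟨0, N.zero_mem, rfl⟩
      smul_mem' := by
        rintro c _ ⟨x, hx, rfl⟩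
        exact ⟨c • x, N.smul_mem c hx, rfl⟩
      lie_mem := by
        rintro L _ ⟨x, hx, rfl⟩
        exact ⟨⁅(⟨0, 0, L⟩ : StandardModel z), x⁆, N.lie_mem hx, rfl⟩ }
  have h𝔨 : 𝔨.comap (baseHom : StandardModel z →ₗ⁅ℝ⁆ 𝔩) = N ⊔ kerIdeal z := by
    ext x
    rw [LieIdeal.mem_comap, LieSubmodule.mem_sup]
    constructor
    · rintro ⟨y, hy, hyx⟩
      exact ⟨y, hy, x - y, (mem_kerIdeal (z := z)).2 (sub_eq_zero.2 hyx.symm), by abel⟩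
    · rintro ⟨y, hy, w, hw, rfl⟩
      have hw' := mem_kerIdeal.1 hw
      refine ⟨y, hy, ?_⟩
      change y.base = y.base + w.base
      rw [hw', add_zero]
  have hsoc : 𝔨 ≤ lieSocle 𝔩 := by
    refine isGreatest_lieSocle.2 ?_
    change ComplementedIcc ⊥ 𝔨
    rw [← complementedIcc_comap_iff _ (baseHom_surjective (z := z)),
      LieIdeal.comap_bot_eq_ker, ker_baseHom, h𝔨]
    refine ComplementedIcc.sup_right_of_inf ?_
    exact (hN₀.sup_right_of_le h).mono (le_inf heN hej) inf_le_left hNN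
  have hrad : 𝔨 ≤ radicalChain 𝔩 k := by
    rintro _ ⟨x, hx, rfl⟩
    exact base_mem_radicalChain_iff.2 (hNN.trans (sup_le h' (hej.trans le_sup_right)) hx)
  let p : N →ₗ[ℝ] 𝔨 :=
    LinearMap.codRestrict 𝔨.toSubmodule (baseHom.toLinearMap ∘ₗ N.toSubmodule.subtype)
      fun x => ⟨x, x.2, rfl⟩
  have hp : LinearMap.range p = ⊤ := by
    rw [LinearMap.range_eq_top]
    rintro ⟨_, x, hx, rfl⟩
    exact ⟨⟨x, hx⟩, rfl⟩
  obtain ⟨q, hq⟩ := p.exists_rightInverse_of_surjective hp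
  have hqb : ∀ X, (q X : StandardModel z).base = X := fun X =>
    congrArg Subtype.val (LinearMap.congr_fun hq X)
  -- The failure of the linear section `q` to be equivariant has no 𝔞-component, and its functional
  -- vanishes on R_k(𝔩). These are the two equations of (A_k), up to the sign of Φ₁.
  have hlie : ∀ (L : 𝔩) (X : 𝔨),
      ⁅(⟨0, 0, L⟩ : StandardModel z), (q X : StandardModel z)⁆ - q ⁅L, X⁆ ∈ e := by
    intro L X
    refine hNj ⟨N.sub_mem (N.lie_mem (q X).2) (q ⁅L, X⁆).2, mem_kerIdeal.2 ?_⟩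
    rw [base_sub, base_lie, hqb, hqb]
    exact sub_self _
  have : 𝔨 = ⊥ := by
    refine hA 𝔨 (le_inf hsoc hrad) ⟨-(midLinear ∘ₗ N.toSubmodule.subtype ∘ₗ q),
      (radicalChain 𝔩 k).toSubmodule.subtype.dualMap ∘ₗ dualLinear ∘ₗ N.toSubmodule.subtype ∘ₗ q,
      fun L X => ?_, fun L X Y => ?_⟩
    · have := (hlie L X).1.1
      rw [mid_sub, mid_lie, hqb, AlternatingMap.toBilin_apply] at this
      change z.α ![L, X] = ⁅L, -(q X : StandardModel z).mid⁆ - -(q ⁅L, X⁆ : StandardModel z).mid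
      rw [lie_neg, lie_zero, sub_zero] at *
      rw [eq_comm, ← sub_eq_zero, ← neg_eq_zero, ← this]
      abel
    · have := (mem_soc_iff_of_mem_dualIdeal (hlie L X).1).1 (hlie L X).2 Y Y.2
      rw [dual_sub, LinearMap.sub_apply, dual_lie, hqb] at this
      simp only [map_zero, LinearMap.zero_apply, add_zero, lie_zero,
        AlternatingMap.toBilin_apply, AlternatingMap.toTrilin_apply] at this
      change z.γ ![L, X, Y] = -ΦA.form (-(q X : StandardModel z).mid) (z.α ![L, Y]) +
        (q X : StandardModel z).dual ⁅L, (Y : 𝔩)⁆ + (q ⁅L, X⁆ : StandardModel z).dual Y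
      rw [map_neg, LinearMap.neg_apply]
      linarith
  intro x hx
  have hx' : x.base ∈ 𝔨 := ⟨x, hx, rfl⟩
  rw [this] at hx'
  exact mem_kerIdeal.2 hx'

/-- For k = 1 this is (B_0); for k ≥ 2 it is (B_{k-1}), by the shift in `condB_iff`. -/
lemma rad_inf_soc_inf_kerIdeal_le (ha : IsSemisimpleLieModule 𝔩 𝔞) (hz : z.IsBalanced) {k : ℕ}
    (hk : 1 ≤ k) : rad z k ⊓ soc z k ⊓ kerIdeal z ≤ dualIdeal z := by
  obtain _ | _ | k := k
  · omega
  · exact rad_one_inf_soc_one_inf_kerIdeal_le ha hz.2.1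
  · refine le_trans ?_ ((condB_iff ha (Nat.le_add_left 1 k)).1
      (hz.condA_and_condB (Nat.le_add_left 1 k)).2)
    exact le_inf (le_inf inf_le_right (inf_le_left.trans inf_le_right))
      (inf_le_left.trans (inf_le_left.trans le_sup_left))

lemma complementedIcc_inf_soc {k : ℕ} {I : LieIdeal ℝ (StandardModel z)}
    (hI : I ≤ soc z (k + 1)) : ComplementedIcc (I ⊓ soc z k) I := by
  have hB := isInvariantInnerProduct z
  exact ((hB.complementedIcc_orth_radicalChain k).mono le_rfl le_sup_right
    (sup_le hI (hB.orth_radicalChain_monotone (Nat.le_succ k)))).inf_of_sup_right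

/-- Induction on `l`: the part in R_l^⊥ lies in 𝔩^* ⊕ 𝔞 by induction, hence in 𝔩^* by the
(B)-conditions, and (A_{l+1}) handles the semisimple layer above it. -/
lemma rad_inf_soc_le_kerIdeal (ha : IsSemisimpleLieModule 𝔩 𝔞) (hz : z.IsBalanced) {k l : ℕ}
    (hl : l ≤ k) : rad z k ⊓ soc z l ≤ kerIdeal z := by
  have hB := isInvariantInnerProduct z
  induction l with
  | zero =>
    have : soc z 0 = ⊥ := hB.orth_top
    rw [this, inf_bot_eq]
    exact bot_le
  | succ l ih =>
    refine le_kerIdeal_of_condA (hz.condA_and_condB (Nat.le_add_left 1 l)).1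
      (complementedIcc_inf_soc (k := l) inf_le_right) (le_inf ?_ (inf_le_left.trans inf_le_right))
      (inf_le_left.trans ((radicalChain_antitone hl).trans le_sup_left))
    refine le_trans ?_ (rad_inf_soc_inf_kerIdeal_le ha hz ((Nat.le_add_left 1 l).trans hl))
    refine le_inf (inf_le_left.trans (inf_le_inf_left _ (hB.orth_radicalChain_monotone hl))) ?_
    exact (inf_le_inf_right _ inf_le_left).trans (ih ((Nat.le_succ l).trans hl))

/-- A complement `C` of (𝔩^* ⊕ 𝔞) ∩ R_1^⊥ in the socle contains no non-zero central elements by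
(A_0), so C = [𝔤, C]. This forces C into R_1, where (A_1) applies. -/
lemma soc_one_le_kerIdeal (hz : z.IsBalanced) : soc z 1 ≤ kerIdeal z := by
  have hB := isInvariantInnerProduct z
  obtain ⟨C, -, hC, h₁, h₂⟩ := complementedIcc_bot_soc_one.2 (soc z 1 ⊓ kerIdeal z) bot_le
    inf_le_left
  have hCC := complementedIcc_bot_soc_one.mono le_rfl bot_le hC
  have hCj : ∀ x ∈ C, x.base = 0 → x = 0 := by
    intro x hx hx'
    have : x ∈ soc z 1 ⊓ kerIdeal z ⊓ C := ⟨⟨hC hx, mem_kerIdeal.2 hx'⟩, hx⟩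
    rwa [h₁, LieSubmodule.mem_bot] at this
  suffices h : C ≤ kerIdeal z by
    rw [← h₂]
    exact sup_le inf_le_right h
  have hcen : C ⊓ LieModule.maxTrivSubmodule ℝ (StandardModel z) (StandardModel z) = ⊥ := by
    rw [eq_bot_iff]
    rintro x ⟨hx, hx'⟩
    have hx' : ∀ y, ⁅y, x⁆ = 0 := hx'
    have hb : ∀ L : 𝔩, ⁅L, x.base⁆ = 0 := fun L =>
      congrArg base (hx' ⟨0, 0, L⟩)
    have hb' : ∀ L : 𝔩, ⁅x.base, L⁆ = 0 := fun L => by rw [← lie_skew, hb, neg_zero]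
    have hm : ∀ L : 𝔩, z.α ![L, x.base] = -⁅L, x.mid⁆ := fun L => by
      have := congrArg mid (hx' ⟨0, 0, L⟩)
      rw [mid_lie, AlternatingMap.toBilin_apply, lie_zero, sub_zero] at this
      exact eq_neg_of_add_eq_zero_left this
    refine hCj x hx (hz.1 x.base hb ((LieModule.mem_ker ℝ 𝔩 𝔞 _).2 fun A => ?_)
      ⟨-x.mid, x.dual, fun L => by rw [hm, lie_neg], fun L L' => ?_⟩)
    · have := congrArg mid (hx' ⟨0, A, 0⟩)
      rw [mid_lie] at this
      simpa using this
    · have := congrArg (fun y => y.dual L') (hx' ⟨0, 0, L⟩)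
      simp only [dual_lie, map_zero, LinearMap.zero_apply, add_zero, lie_zero, hb',
        AlternatingMap.toBilin_apply, AlternatingMap.toTrilin_apply, dual_zero] at this
      rw [map_neg, LinearMap.neg_apply]
      linarith
  have htop := lie_top_eq_of_inf_maxTrivSubmodule hCC hcen
  -- For w in 𝔩^* the bracket [y, w] lies in `C` without 𝔩-component, so it vanishes. Hence [x, y]
  -- is orthogonal to 𝔩^*, has no 𝔩-component and vanishes too.
  have hab : ∀ x ∈ C, ∀ y ∈ C, ⁅x, y⁆ = 0 := by
    intro x hx y hy
    refine hCj _ (C.lie_mem hy) (mem_kerIdeal.1 ?_)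
    rw [← orth_dualIdeal, hB.mem_orth]
    intro w hw
    rw [hB.comm, hB.lie_assoc, hCj ⁅y, w⁆ (lie_mem_left ℝ _ C y w hy) (by simp [hw.2]), map_zero]
  -- Write 𝔤 = (C + R_1) + D with (C + R_1) ∩ D = R_1. Here C is abelian, R_1 kills C ⊆ R_1^⊥, and
  -- [D, C] lies in R_1.
  have hCr : C ≤ rad z 1 := by
    obtain ⟨D, -, -, hD₁, hD₂⟩ :=
      (complementedIcc_radicalChain (L := StandardModel z) 0).2 (C ⊔ rad z 1) le_sup_right le_top
    rw [← htop, LieSubmodule.lieIdeal_oper_eq_span, LieSubmodule.lieSpan_le]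
    rintro _ ⟨⟨y, -⟩, ⟨x, hx⟩, rfl⟩
    have hy : y ∈ C ⊔ rad z 1 ⊔ D := by
      rw [hD₂]
      exact LieSubmodule.mem_top y
    obtain ⟨y, hyC, d, hd, rfl⟩ := (LieSubmodule.mem_sup _ _ _).1 hy
    obtain ⟨c, hc, r, hr, rfl⟩ := (LieSubmodule.mem_sup _ _ _).1 hyC
    have hr' : ⁅r, x⁆ = 0 := by
      rw [← lie_skew, hB.lie_eq_zero_of_le_orth hC hx hr, neg_zero]
    have hd' : ⁅d, x⁆ ∈ (C ⊔ rad z 1) ⊓ D :=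
      ⟨(le_sup_left : C ≤ _) (C.lie_mem hx), lie_mem_left ℝ _ D d x hd⟩
    rw [hD₁] at hd'
    change ⁅c + r + d, x⁆ ∈ rad z 1
    rwa [add_lie, add_lie, hab c hc x hx, hr', zero_add, zero_add]
  exact le_kerIdeal_of_condA (hz.condA_and_condB le_rfl).1 hCC bot_le (hCr.trans le_sup_left)

/-- For k ≥ 1 the part in R_k^⊥ already lies in 𝔩^*, and (A_k) handles the layer above it. -/
lemma rad_inf_soc_succ_le_kerIdeal (ha : IsSemisimpleLieModule 𝔩 𝔞) (hz : z.IsBalanced) (k : ℕ) :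
    rad z k ⊓ soc z (k + 1) ≤ kerIdeal z := by
  obtain _ | k := k
  · exact inf_le_right.trans (soc_one_le_kerIdeal hz)
  · refine le_kerIdeal_of_condA (hz.condA_and_condB (Nat.le_add_left 1 k)).1
      (complementedIcc_inf_soc (k := k + 1) inf_le_right) (le_inf ?_ inf_le_right)
      (inf_le_left.trans le_sup_left)
    refine le_trans ?_ (rad_inf_soc_inf_kerIdeal_le ha hz (Nat.le_add_left 1 k))
    have h := inf_le_inf_right (soc z (k + 1)) (inf_le_left : rad z (k + 1) ⊓ soc z (k + 2) ≤ _)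
    exact le_inf h (h.trans (rad_inf_soc_le_kerIdeal ha hz le_rfl))

/-- The canonical isotropic ideal of the standard model is `𝔩^*` if and only if the module is
semisimple and the cocycle is balanced. -/
lemma canonicalIdeal_eq_iff : (isInvariantInnerProduct z).canonicalIdeal = dualIdeal z ↔
    IsSemisimpleLieModule 𝔩 𝔞 ∧ z.IsBalanced := by
  refine ⟨fun h => ⟨isSemisimple_of_canonicalIdeal h, isBalanced_of_canonicalIdeal h⟩, ?_⟩
  rintro ⟨ha, hz⟩
  have hB := isInvariantInnerProduct z
  refine le_antisymm (iSup_le fun k => ?_) ?_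
  · have h := rad_inf_soc_le_kerIdeal ha hz (le_refl (k + 1))
    exact (le_inf le_rfl h).trans (rad_inf_soc_inf_kerIdeal_le ha hz (Nat.le_add_left 1 k))
  -- This inclusion is tested on orthogonal complements, where it concerns R_k ∩ R_{k+1}^⊥.
  · rw [← hB.orth_le_orth_iff, hB.orth_canonicalIdeal]
    refine iSup_le fun k => ?_
    exact (rad_inf_soc_succ_le_kerIdeal ha hz k).trans_eq orth_dualIdeal.symm

end StandardModel

end Model

/-! ### Transport of the canonical ideal along isometric isomorphisms. -/

section Invariance

variable {G G' : Type*} [LieRing G] [LieAlgebra ℝ G] [Module.Finite ℝ G] [LieRing G']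
  [LieAlgebra ℝ G'] [Module.Finite ℝ G']

lemma LieEquiv.apply_mem_radicalChain_iff (F : G ≃ₗ⁅ℝ⁆ G') {k : ℕ} {x : G} :
    F x ∈ radicalChain G' k ↔ x ∈ radicalChain G k := by
  have h := comap_radicalChain F.toLieHom F.surjective k
  rw [(LieHom.ker_eq_bot F.toLieHom).2 F.injective, sup_bot_eq] at h
  rw [← h, LieIdeal.mem_comap]
  rfl

lemma LieEquiv.map_canonicalIsotropicIdeal (F : G ≃ₗ⁅ℝ⁆ G') {B : LinearMap.BilinForm ℝ G}
    {B' : LinearMap.BilinForm ℝ G'} (hF : ∀ x y, B' (F x) (F y) = B x y) :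
    (canonicalIsotropicIdeal B).map (F.toLinearEquiv : G →ₗ[ℝ] G') =
      canonicalIsotropicIdeal B' := by
  rw [canonicalIsotropicIdeal, canonicalIsotropicIdeal, Submodule.map_iSup]
  refine iSup_congr fun k => ?_
  ext y
  obtain ⟨x, rfl⟩ := F.surjective y
  have h₁ : F x ∈ ((radicalChain G (k + 1)).toSubmodule ⊓
      B.orthogonal (radicalChain G (k + 1)).toSubmodule).map (F.toLinearEquiv : G →ₗ[ℝ] G') ↔
      x ∈ (radicalChain G (k + 1)).toSubmodule ⊓
        B.orthogonal (radicalChain G (k + 1)).toSubmodule :=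
    F.injective.mem_set_image
  refine h₁.trans
    (and_congr F.apply_mem_radicalChain_iff.symm ⟨fun h y hy => ?_, fun h y hy => ?_⟩)
  · obtain ⟨w, rfl⟩ := F.surjective y
    exact (hF w x).trans (h w (F.apply_mem_radicalChain_iff.1 hy))
  · exact (hF y x).symm.trans (h (F y) (F.apply_mem_radicalChain_iff.2 hy))

end Invariance

/-! ### Balanced extensions correspond to balanced classes. -/

section Extensions

variable {𝔥 K : Type*} [LieRing 𝔥] [LieAlgebra ℝ 𝔥] [Group K] [TopologicalSpace K]
  {κ : HKPair 𝔥 K}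
  {𝔩 : Type u} [LieRing 𝔩] [LieAlgebra ℝ 𝔩] [Module.Finite ℝ 𝔩] {Φ : EquivariantLie κ 𝔩}
  {𝔞 : Type v} [AddCommGroup 𝔞] [Module ℝ 𝔞] [Module.Finite ℝ 𝔞] [LieRingModule 𝔩 𝔞]
  [LieModule ℝ 𝔩 𝔞] {ΦA : OrthogonalModule Φ 𝔞}

namespace QuadraticExtension

lemma IsEquivalence.isBalanced {E₁ E₂ : QuadraticExtension ΦA}
    {F : E₁.carrier ≃ₗ⁅ℝ⁆ E₂.carrier} (hF : IsEquivalence E₁ E₂ F) (h : E₁.IsBalanced) :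
    E₂.IsBalanced := by
  rw [IsBalanced, ← F.map_canonicalIsotropicIdeal hF.isometry, ← h]
  ext y
  obtain ⟨x, rfl⟩ := F.surjective y
  exact (hF.map_ideal x).trans F.injective.mem_set_image.symm

lemma isBalanced_extension_iff [ContinuousInv K] {z : QuadraticCocycle ΦA} :
    (StandardModel.extension z).IsBalanced ↔ IsSemisimpleLieModule 𝔩 𝔞 ∧ z.IsBalanced := by
  rw [← StandardModel.canonicalIdeal_eq_iff, ← LieSubmodule.toSubmodule_inj,
    IsInvariantInnerProduct.toSubmodule_canonicalIdeal]
  exact eq_comm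

lemma classMap_image_isBalanced [ContinuousInv K] (ΦA : OrthogonalModule Φ 𝔞) :
    classMap ΦA '' {c | ∃ E : QuadraticExtension ΦA, E.IsBalanced ∧ E.cls = c} =
      balancedClasses ΦA := by
  ext c
  constructor
  · rintro ⟨_, ⟨E, hE, rfl⟩, rfl⟩
    obtain ⟨s, hs⟩ := E.exists_isIsotropicSection
    obtain ⟨z, hz⟩ := exists_isCocycleOf hs
    obtain ⟨F, hF⟩ := IsCocycleOf.exists_isEquivalence hs hz
    obtain ⟨ha, hb⟩ := isBalanced_extension_iff.1 (hF.isBalanced hE)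
    exact ⟨ha, z, hb, (hz.cls_eq hs).symm⟩
  · rintro ⟨ha, z, hb, rfl⟩
    exact ⟨_, ⟨StandardModel.extension z, isBalanced_extension_iff.2 ⟨ha, hb⟩, rfl⟩,
      cohomologyClass_extension z⟩

end QuadraticExtension

end Extensions

theorem mainTheorem2
    {𝔥 K : Type*} [LieRing 𝔥] [LieAlgebra ℝ 𝔥]
    {M : Type*} [NormedAddCommGroup M] [NormedSpace ℝ M] [FiniteDimensional ℝ M]
    [Group K] [TopologicalSpace K] [ChartedSpace M K] [LieGroup 𝓘(ℝ, M) ∞ K] [T2Space K]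
    [Finite (ConnectedComponents K)]
    (κ : HKPair 𝔥 K)
    {𝔩 : Type u} [LieRing 𝔩] [LieAlgebra ℝ 𝔩] [Module.Finite ℝ 𝔩] (Φ : EquivariantLie κ 𝔩)
    {𝔞 : Type v} [AddCommGroup 𝔞] [Module ℝ 𝔞] [Module.Finite ℝ 𝔞] [LieRingModule 𝔩 𝔞]
    [LieModule ℝ 𝔩 𝔞] (ΦA : OrthogonalModule Φ 𝔞) :
    ∃ Ψ : QuadraticExtension.Classes ΦA → QuadraticCohomology ΦA,
      Function.Bijective Ψ ∧
      Ψ '' {c | ∃ E : QuadraticExtension ΦA, E.IsBalanced ∧ E.cls = c} = balancedClasses ΦA ∧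
      ∀ E : QuadraticExtension ΦA,
        (∃ s : 𝔩 →ₗ[ℝ] E.carrier, E.IsIsotropicSection s) ∧
        ∀ s : 𝔩 →ₗ[ℝ] E.carrier, E.IsIsotropicSection s →
          ∃ z : QuadraticCocycle ΦA, E.IsCocycleOf s z ∧ Ψ E.cls = z.cls := by
  -- Continuity of inversion makes 𝔩^* a continuous `K`-module, as the standard model requires.
  have : IsTopologicalGroup K := topologicalGroup_of_lieGroup 𝓘(ℝ, M) ∞
  refine ⟨QuadraticExtension.classMap ΦA, QuadraticExtension.classMap_bijective ΦA,
    QuadraticExtension.classMap_image_isBalanced ΦA,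
    fun E => ⟨E.exists_isIsotropicSection, fun s hs => ?_⟩⟩
  obtain ⟨z, hz⟩ := QuadraticExtension.exists_isCocycleOf hs
  exact ⟨z, hz, hz.cls_eq hs⟩

end
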